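/- Let $A\in\mathbb R^{m\times d_1}$ be a nonzero matrix with rows $a_1,\dots,a_m$, spectral norm $\|A\|$, Frobenius norm $\|A\|_F$ and stable rank $\rho_A=\|A\|_F^2/\|A\|^2$. For $r\ge 1$ sample indices $t_1,\dots,t_r$ i.i.d. with $\Pr[t_j=t]=p_t=\|a_t\|^2/\|A\|_F^2$, and let $\tilde A\in\mathbb R^{r\times d_1}$ be the matrix whose $j$-th row is $a_{t_j}/\sqrt{r\,p_{t_j}}$. Let $z_1,\dots,z_{d_1}$ be independent standard normal variables, independent of the sample, and put $x_0=z/\|z\|$, $x_k=\tilde A^{T}\tilde A x_{k-1}/\|\tilde A^{T}\tilde A x_{k-1}\|$ for $k\ge1$. The spectral norm estimate after $n$ power iterations is $\tilde\sigma_1^2=\|\tilde A^{T}\tilde A x_n\|$. There is an absolute constant $c>0$ such that the following holds. (i) For all $m,d_1$, all nonzero $A\in\mathbb R^{m\times d_1}$, all $0<\epsilon\le\frac12$ and $0<\delta<1$, if $$r\ge\frac{4\rho_A}{\epsilon^2}\ln\frac{2d_1}{\delta}\quad\text{and}\quad n\ge c\ln\frac{d_1}{\delta},$$ then, with probability at least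 $1-2\delta$, $$\frac1{2\sqrt5}\|A\|^2\le\tilde\sigma_1^2\le\frac32\|A\|^2 .$$ (ii) The estimate can be computed in $O\!\left(m d_1+\frac{\rho_A d_1}{\epsilon^2}\ln^2\frac{d_1}{\delta}\right)$ time: there are a constant $C$ and one program for a randomized real RAM (exact arithmetic $+,-,\times,/,\sqrt{\cdot}$, comparisons, indexed memory, draws of standard normals, of uniform reals in $[0,1]$ and of uniform integers below a given bound, each in one step) which, on input $A$, $r\geq 1$, $n$, outputs a random number with the same distribution as $\tilde\sigma_1^2$, and which, for $0<\epsilon\le\frac12$, $0<\delta<1$ with $2\delta\le d_1$, $r=\lceil\frac{4\rho_A}{\epsilon^2}\ln\frac{2d_1}{\delta}\rceil$ and $n=\lceil c\ln\frac{d_1}{\delta}\rceil$, always halts within $C\left(m d_1+\frac{\rho_A d_1}{\epsilon^2}\ln^2\frac{d_1}{\delta}\right)$ steps. -/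

import Mathlib

open MeasureTheory ProbabilityTheory
open scoped Matrix Matrix.Norms.L2Operator

noncomputable section

namespace RowSampling

/-! ### Stable rank, row sampling, power iteration

With the scoped instance opened above, `‖A‖` is the spectral norm of a real matrix `A`. -/

/-- The squared Frobenius norm. -/
def frobSq {m d : ℕ} (A : Matrix (Fin m) (Fin d) ℝ) : ℝ :=
  ∑ i, ∑ j, A i j ^ 2

/-- The stable rank `ρ_A = ‖A‖_F² / ‖A‖²`. -/
def stableRank {m d : ℕ} (A : Matrix (Fin m) (Fin d) ℝ) : ℝ :=
  frobSq A / ‖A‖ ^ 2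

/-- The row-norm sampling probabilities `p_t = ‖a_t‖² / ‖A‖_F²`. -/
def rowProb {m d : ℕ} (A : Matrix (Fin m) (Fin d) ℝ) (t : Fin m) : ℝ :=
  (∑ j, A t j ^ 2) / frobSq A

/-- The distribution on row indices with point masses `p_t`
(a probability measure when `A ≠ 0`). -/
def rowMeasure {m d : ℕ} (A : Matrix (Fin m) (Fin d) ℝ) : Measure (Fin m) :=
  ∑ t, ENNReal.ofReal (rowProb A t) • Measure.dirac t

/-- The row-sampling matrix `Q` whose `j`-th row is `e_{t_j} / √(r p_{t_j})`. -/
def samplingMatrix {m d r : ℕ} (A : Matrix (Fin m) (Fin d) ℝ) (t : Fin r → Fin m) :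
    Matrix (Fin r) (Fin m) ℝ :=
  Matrix.of fun j i => if i = t j then 1 / Real.sqrt (r * rowProb A i) else 0

/-- The row sample `Ã = Q A`. -/
def rowSample {m d r : ℕ} (A : Matrix (Fin m) (Fin d) ℝ) (t : Fin r → Fin m) :
    Matrix (Fin r) (Fin d) ℝ :=
  samplingMatrix A t * A

/-- The power iterates on `BᵀB` started at `z / ‖z‖`. -/
def powerIter {r d : ℕ} (B : Matrix (Fin r) (Fin d) ℝ) (z : Fin d → ℝ) :
    ℕ → EuclideanSpace ℝ (Fin d)
  | 0 => ‖WithLp.toLp 2 z‖⁻¹ • WithLp.toLp 2 z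
  | n + 1 =>
    ‖Matrix.toEuclideanLin (Bᵀ * B) (powerIter B z n)‖⁻¹ •
      Matrix.toEuclideanLin (Bᵀ * B) (powerIter B z n)

/-- The estimate `‖BᵀB x_n‖` of `‖B‖²` after `n` power iterations. -/
def powerEstimate {r d : ℕ} (B : Matrix (Fin r) (Fin d) ℝ) (z : Fin d → ℝ) (n : ℕ) : ℝ :=
  ‖Matrix.toEuclideanLin (Bᵀ * B) (powerIter B z n)‖

/-- The randomness of the estimator: `r` i.i.d. row indices with probabilities `p_t` and,
independently of them, `d` independent standard normal variables. -/
def sampleMeasure {m d : ℕ} (A : Matrix (Fin m) (Fin d) ℝ) (r : ℕ) :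
    Measure ((Fin r → Fin m) × (Fin d → ℝ)) :=
  (Measure.pi fun _ : Fin r => rowMeasure A).prod
    (Measure.pi fun _ : Fin d => gaussianReal 0 1)

/-- The spectral norm estimate `σ̃₁²`: sample `r` rows, then run `n` power iterations on `ÃᵀÃ`
from the normalized Gaussian vector. -/
def estimate {m d : ℕ} (A : Matrix (Fin m) (Fin d) ℝ) (r n : ℕ)
    (ω : (Fin r → Fin m) × (Fin d → ℝ)) : ℝ :=
  powerEstimate (rowSample A ω.1) ω.2 n

/-! ### A randomized real RAM with a step count

A program is a finite piece of code in a structured language over integer arrays `N a i` and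
two-dimensional real arrays `R a i j`, with exact real arithmetic.  Every operation, memory access
and random draw takes one step.  The sources of randomness are a stream of independent standard
normal reals and a stream of independent uniform elements of `[0,1]`. -/

/-- Integer expressions: literals, memory access, addition, truncated subtraction. -/
inductive NExp where
  | lit (k : ℕ)
  | get (a : ℕ) (i : NExp)
  | add (x y : NExp)
  | sub (x y : NExp)

/-- Real expressions: conversion of integers, memory access, the four operations (with `x / 0 = 0`)
and square root. -/
inductive RExp where
  | ofNat (x : NExp)
  | get (a : ℕ) (i j : NExp)
  | add (x y : RExp)
  | sub (x y : RExp)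
  | mul (x y : RExp)
  | div (x y : RExp)
  | sqrt (x : RExp)

/-- Programs. -/
inductive Prog where
  | skip
  /-- `N a i := e` -/
  | setN (a : ℕ) (i e : NExp)
  /-- `R a i j := e` -/
  | setR (a : ℕ) (i j : NExp) (e : RExp)
  /-- `R a i j :=` a fresh standard normal variable -/
  | normal (a : ℕ) (i j : NExp)
  /-- `R a i j :=` a fresh uniform variable in `[0,1]` -/
  | uniform (a : ℕ) (i j : NExp)
  /-- `N a i :=` a fresh uniform integer in `{0, …, e - 1}` -/
  | randInt (a : ℕ) (i e : NExp)
  | seq (p q : Prog)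
  /-- `if x ≤ y then p else q`, on integers -/
  | iteN (x y : NExp) (p q : Prog)
  /-- `if x ≤ y then p else q`, on reals -/
  | iteR (x y : RExp) (p q : Prog)
  /-- `for N a 0 = 0, …, e - 1 do p`, where `e` is evaluated once, on entry -/
  | loop (a : ℕ) (e : NExp) (p : Prog)

/-- A state of the machine: memory, positions in the two random streams, steps so far. -/
structure State where
  N : ℕ → ℕ → ℕ
  R : ℕ → ℕ → ℕ → ℝ
  gpos : ℕ
  upos : ℕ
  time : ℕ

/-- The two random streams. -/
abbrev Tape : Type := (ℕ → ℝ) × (ℕ → unitInterval)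

/-- The law of the random streams. -/
def tapeMeasure : Measure Tape :=
  (Measure.infinitePi fun _ : ℕ => gaussianReal 0 1).prod
    (Measure.infinitePi fun _ : ℕ => (volume : Measure unitInterval))

def NExp.eval (s : State) : NExp → ℕ
  | .lit k => k
  | .get a i => s.N a (i.eval s)
  | .add x y => x.eval s + y.eval s
  | .sub x y => x.eval s - y.eval s

/-- The number of steps needed to evaluate an integer expression. -/
def NExp.cost : NExp → ℕ
  | .lit _ => 1
  | .get _ i => 1 + i.cost
  | .add x y => 1 + x.cost + y.cost
  | .sub x y => 1 + x.cost + y.cost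

def RExp.eval (s : State) : RExp → ℝ
  | .ofNat x => (x.eval s : ℝ)
  | .get a i j => s.R a (i.eval s) (j.eval s)
  | .add x y => x.eval s + y.eval s
  | .sub x y => x.eval s - y.eval s
  | .mul x y => x.eval s * y.eval s
  | .div x y => x.eval s / y.eval s
  | .sqrt x => Real.sqrt (x.eval s)

/-- The number of steps needed to evaluate a real expression. -/
def RExp.cost : RExp → ℕ
  | .ofNat x => 1 + x.cost
  | .get _ i j => 1 + i.cost + j.cost
  | .add x y => 1 + x.cost + y.cost
  | .sub x y => 1 + x.cost + y.cost
  | .mul x y => 1 + x.cost + y.cost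
  | .div x y => 1 + x.cost + y.cost
  | .sqrt x => 1 + x.cost

/-- Spend `k` steps. -/
def State.tick (s : State) (k : ℕ) : State :=
  { s with time := s.time + k }

/-- Write an integer cell. -/
def State.writeN (s : State) (a i v : ℕ) : State :=
  { s with N := fun a' i' => if a' = a ∧ i' = i then v else s.N a' i' }

/-- Write a real cell. -/
def State.writeR (s : State) (a i j : ℕ) (v : ℝ) : State :=
  { s with R := fun a' i' j' => if a' = a ∧ i' = i ∧ j' = j then v else s.R a' i' j' }

/-- Execution of a program on the random streams `ω`. -/
def Prog.run (ω : Tape) : Prog → State → State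
  | .skip, s => s.tick 1
  | .setN a i e, s =>
      (s.writeN a (i.eval s) (e.eval s)).tick (1 + i.cost + e.cost)
  | .setR a i j e, s =>
      (s.writeR a (i.eval s) (j.eval s) (e.eval s)).tick (1 + i.cost + j.cost + e.cost)
  | .normal a i j, s =>
      let s' := (s.writeR a (i.eval s) (j.eval s) (ω.1 s.gpos)).tick (1 + i.cost + j.cost)
      { s' with gpos := s.gpos + 1 }
  | .uniform a i j, s =>
      let s' := (s.writeR a (i.eval s) (j.eval s) (ω.2 s.upos : ℝ)).tick (1 + i.cost + j.cost)
      { s' with upos := s.upos + 1 }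
  | .randInt a i e, s =>
      let s' := (s.writeN a (i.eval s) ⌊(ω.2 s.upos : ℝ) * (e.eval s : ℝ)⌋₊).tick
        (1 + i.cost + e.cost)
      { s' with upos := s.upos + 1 }
  | .seq p q, s => q.run ω (p.run ω s)
  | .iteN x y p q, s =>
      if x.eval s ≤ y.eval s then p.run ω (s.tick (1 + x.cost + y.cost))
      else q.run ω (s.tick (1 + x.cost + y.cost))
  | .iteR x y p q, s =>
      open Classical in
      if x.eval s ≤ y.eval s then p.run ω (s.tick (1 + x.cost + y.cost))
      else q.run ω (s.tick (1 + x.cost + y.cost))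
  | .loop a e p, s =>
      (List.range (e.eval s)).foldl (fun s' k => p.run ω ((s'.writeN a 0 k).tick 1))
        (s.tick (1 + e.cost))

/-- The initial state: `m, d, r, n` in `N 0 0, …, N 0 3`, the entries of `A` in `R 0`, and
zeros elsewhere. -/
def inputState {m d : ℕ} (A : Matrix (Fin m) (Fin d) ℝ) (r n : ℕ) : State where
  N := fun a i =>
    if a = 0 then
      if i = 0 then m else if i = 1 then d else if i = 2 then r else if i = 3 then n else 0
    else 0
  R := fun a i j =>
    if a = 0 then (if h : i < m ∧ j < d then A ⟨i, h.1⟩ ⟨j, h.2⟩ else 0) else 0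
  gpos := 0
  upos := 0
  time := 0

/-- The output of a program on input `A, r, n`: the final content of the cell `R 1 0 0`. -/
def Prog.output {m d : ℕ} (P : Prog) (A : Matrix (Fin m) (Fin d) ℝ) (r n : ℕ) (ω : Tape) : ℝ :=
  (P.run ω (inputState A r n)).R 1 0 0

/-- The running time of a program on input `A, r, n`. -/
def Prog.runtime {m d : ℕ} (P : Prog) (A : Matrix (Fin m) (Fin d) ℝ) (r n : ℕ) (ω : Tape) : ℕ :=
  (P.run ω (inputState A r n)).time

end RowSampling

end

open MeasureTheory ProbabilityTheory
open scoped Matrix Matrix.Norms.L2Operator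

noncomputable section

namespace RowSampling

/-! ### The Golden–Thompson inequality -/

section GoldenThompson

/-! Accuracy. The Gram matrix of the row sample is a sum of `r` independent rank-one matrices, each
with mean `AᵀA / r`. Because `p_t` is proportional to `‖a_t‖²`, every nonzero summand has the same
nonzero eigenvalue `L = ‖A‖_F² / r`. Concentration is therefore governed by `‖A‖² / L = r / ρ_A`.
The upper tail of `‖Ã‖²` is a matrix Chernoff bound: Golden–Thompson (`trace_exp_add_le`) peels off
one summand at a time (`sum_prod_mul_trace_exp_le`), at the price of a factor `d`. The lower tail
needs only the single direction of the top singular vector of `A`, hence only a scalar Chernoff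
bound. Together they put `‖Ã‖²` between `‖A‖² / 2` and `3‖A‖² / 2`, except with probability `δ`.

The estimate never exceeds `‖Ã‖²`. From below, each power iteration multiplies the component along a
top singular vector `v` by `‖Ã‖²` and divides it by the current estimate, and the estimates
increase. So the last estimate to the power `n + 1` is at least `‖Ã‖^(2(n+1))` times the initial
correlation `|⟨v, z⟩| / ‖z‖`. For Gaussian `z` this correlation is at least `(δ/d)³` except with
probability `δ` (if `d ≥ 2`), and its `(n+1)`-st root exceeds `1/√5` once `n ≥ 6 log (d/δ)`. Neither
a spectral gap nor a full spectral decomposition is used.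

Computation. The program computes the row norms in `O(m d)` steps and builds an alias table in
`O(m)` steps. Each index then costs constant time and two uniform variables, storing its row costs
`O(d)`, and each power iteration costs `O(r d)`. Off a null event the output is exactly the estimate
evaluated at a measure-preserving image of the random streams (`measurePreserving_sampleMap`), which
gives equality in law. Step counts follow from the syntax, since all loops are bounded by input
sizes. -/

lemma trace_mul_le_half {ι : Type*} [Fintype ι] (X Y : Matrix ι ι ℝ) :
    (X * Y).trace ≤ ((X * Xᵀ).trace + (Y * Yᵀ).trace) / 2 := by
  have h : (Y * Yᵀ).trace = (Yᵀ * Y).trace := Matrix.trace_mul_comm _ _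
  rw [h]
  simp only [Matrix.trace, Matrix.diag, Matrix.mul_apply, Matrix.transpose_apply]
  rw [← Finset.sum_add_distrib, Finset.sum_div]
  refine Finset.sum_le_sum fun i _ => ?_
  rw [← Finset.sum_add_distrib, Finset.sum_div]
  refine Finset.sum_le_sum fun j _ => ?_
  nlinarith [sq_nonneg (X i j - Y j i)]

variable {ι : Type*} [Fintype ι] [DecidableEq ι]

lemma trace_pow_mul_comm (X Y : Matrix ι ι ℝ) (n : ℕ) :
    ((X * Y) ^ n).trace = ((Y * X) ^ n).trace := by
  cases n with
  | zero => simp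
  | succ n =>
    have h : (X * Y) ^ (n + 1) = X * ((Y * X) ^ n * Y) := by
      induction n with
      | zero => simp
      | succ n ih => rw [pow_succ, ih, pow_succ]; simp only [mul_assoc]
    rw [h, Matrix.trace_mul_comm, mul_assoc, ← pow_succ]

/-- Dyadic trace inequalities of Lieb–Thirring and Weyl type. -/
lemma trace_pow_dyadic (k : ℕ) :
    (∀ P Q : Matrix ι ι ℝ, Pᵀ = P → Qᵀ = Q →
      ((P * Q) ^ 2 ^ k).trace ≤ (P ^ 2 ^ k * Q ^ 2 ^ k).trace) ∧
    ∀ X : Matrix ι ι ℝ, (X ^ 2 ^ (k + 1)).trace ≤ ((X * Xᵀ) ^ 2 ^ k).trace := by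
  -- The two statements feed each other. The second, applied to `X = P Q`, produces `P Q² P`,
  -- cyclically equivalent to `P² Q²`, where the first applies at a lower level. Conversely, the
  -- second for `X * X` leads to the product of the symmetric matrices `X Xᵀ` and `Xᵀ X`.
  induction k with
  | zero =>
    refine ⟨fun P Q _ _ => by simp, fun X => ?_⟩
    have := trace_mul_le_half X X
    simpa [pow_two] using this
  | succ k ih =>
    obtain ⟨hS, hT⟩ := ih
    have hsymm : ∀ P : Matrix ι ι ℝ, Pᵀ = P → (P * P)ᵀ = P * P := fun P h => by
      rw [Matrix.transpose_mul, h]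
    constructor
    · intro P Q hP hQ
      calc ((P * Q) ^ 2 ^ (k + 1)).trace ≤ ((P * Q * (P * Q)ᵀ) ^ 2 ^ k).trace := hT _
        _ = ((P * (Q * Q * P)) ^ 2 ^ k).trace := by
            rw [Matrix.transpose_mul, hP, hQ]; simp only [mul_assoc]
        _ = ((P * P * (Q * Q)) ^ 2 ^ k).trace := by
            rw [trace_pow_mul_comm, trace_pow_mul_comm (P * P)]; simp only [mul_assoc]
        _ ≤ ((P * P) ^ 2 ^ k * (Q * Q) ^ 2 ^ k).trace := hS _ _ (hsymm P hP) (hsymm Q hQ)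
        _ = _ := by rw [← pow_two, ← pow_two, ← pow_mul, ← pow_mul, ← pow_succ']
    · intro X
      have h1 : (X * Xᵀ)ᵀ = X * Xᵀ := by simp
      have h2 : (Xᵀ * X)ᵀ = Xᵀ * X := by simp
      calc (X ^ 2 ^ (k + 1 + 1)).trace = ((X * X) ^ 2 ^ (k + 1)).trace := by
            rw [← pow_two, ← pow_mul, ← pow_succ']
        _ ≤ ((X * X * (X * X)ᵀ) ^ 2 ^ k).trace := hT _
        _ = ((X * (X * Xᵀ * Xᵀ)) ^ 2 ^ k).trace := by
            rw [Matrix.transpose_mul]; simp only [mul_assoc]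
        _ = ((X * Xᵀ * (Xᵀ * X)) ^ 2 ^ k).trace := by
            rw [trace_pow_mul_comm]; simp only [mul_assoc]
        _ ≤ ((X * Xᵀ) ^ 2 ^ k * (Xᵀ * X) ^ 2 ^ k).trace := hS _ _ h1 h2
        _ ≤ (((X * Xᵀ) ^ 2 ^ k * ((X * Xᵀ) ^ 2 ^ k)ᵀ).trace +
              ((Xᵀ * X) ^ 2 ^ k * ((Xᵀ * X) ^ 2 ^ k)ᵀ).trace) / 2 := trace_mul_le_half _ _
        _ = ((X * Xᵀ) ^ 2 ^ (k + 1)).trace := by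
            rw [Matrix.transpose_pow, Matrix.transpose_pow, h1, h2, ← pow_add, ← pow_add,
              ← two_mul, ← pow_succ', trace_pow_mul_comm Xᵀ X]
            ring

/-- Telescoping. In the Lie product formula it turns an `o(1/n)` error in one factor into an `o(1)`
error in the `n`-th power. -/
lemma norm_pow_succ_sub_le {𝔸 : Type*} [NormedRing 𝔸] {x y : 𝔸} {c : ℝ} (hc : 0 ≤ c)
    (hx : ‖x‖ ≤ c) (hy : ‖y‖ ≤ c) (n : ℕ) :
    ‖x ^ (n + 1) - y ^ (n + 1)‖ ≤ (n + 1) * (c ^ n * ‖x - y‖) := by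
  induction n with
  | zero => simp
  | succ n ih =>
    have hxn : ‖x ^ (n + 1)‖ ≤ c ^ (n + 1) :=
      (norm_pow_le' x n.succ_pos).trans (by gcongr)
    have h : x ^ (n + 1 + 1) - y ^ (n + 1 + 1) =
        x ^ (n + 1) * (x - y) + (x ^ (n + 1) - y ^ (n + 1)) * y := by
      rw [pow_succ x, pow_succ y]; noncomm_ring
    rw [h]
    calc _ ≤ ‖x ^ (n + 1)‖ * ‖x - y‖ + ‖x ^ (n + 1) - y ^ (n + 1)‖ * ‖y‖ :=
          (norm_add_le _ _).trans (add_le_add (norm_mul_le _ _) (norm_mul_le _ _))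
      _ ≤ c ^ (n + 1) * ‖x - y‖ + ((n + 1) * (c ^ n * ‖x - y‖)) * c := by gcongr
      _ = _ := by push_cast; ring

lemma norm_exp_le_exp_norm {𝔸 : Type*} [NormedRing 𝔸] [NormedAlgebra ℝ 𝔸] [CompleteSpace 𝔸]
    [NormOneClass 𝔸] (C : 𝔸) : ‖NormedSpace.exp C‖ ≤ Real.exp ‖C‖ := by
  have h1 := NormedSpace.exp_series_hasSum_exp' (𝕂 := ℝ) C
  have h2 := NormedSpace.exp_series_hasSum_exp' (𝕂 := ℝ) ‖C‖
  rw [← Real.exp_eq_exp_ℝ] at h2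
  refine h1.norm_le_of_bounded h2 fun n => ?_
  rw [norm_smul, Real.norm_of_nonneg (by positivity), smul_eq_mul]
  gcongr
  exact norm_pow_le C n

lemma exp_inv_smul_pow {𝔸 : Type*} [NormedRing 𝔸] [NormedAlgebra ℝ 𝔸] [CompleteSpace 𝔸]
    (C : 𝔸) {n : ℕ} (hn : n ≠ 0) :
    NormedSpace.exp ((n : ℝ)⁻¹ • C) ^ n = NormedSpace.exp C := by
  let _ : NormedAlgebra ℚ 𝔸 := NormedAlgebra.restrictScalars ℚ ℝ 𝔸
  have hn' : (n : ℝ) ≠ 0 := Nat.cast_ne_zero.2 hn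
  rw [← NormedSpace.exp_nsmul, ← Nat.cast_smul_eq_nsmul ℝ, smul_smul, mul_inv_cancel₀ hn', one_smul]

open Filter Topology NormedSpace in
/-- The Lie product formula. -/
lemma tendsto_exp_mul_exp_pow {𝔸 : Type*} [NormedRing 𝔸] [NormedAlgebra ℝ 𝔸] [CompleteSpace 𝔸]
    [NormOneClass 𝔸] (A B : 𝔸) :
    Tendsto (fun n : ℕ => (exp ((n : ℝ)⁻¹ • A) * exp ((n : ℝ)⁻¹ • B)) ^ n) atTop
      (𝓝 (exp (A + B))) := by
  -- The two curves agree to first order at `0`, so `n` times their difference at `1/n` tends to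
  -- zero.
  have hd : HasDerivAt (fun t : ℝ => exp (t • A) * exp (t • B) - exp (t • (A + B))) 0 0 := by
    have h := fun C : 𝔸 => hasDerivAt_exp_smul_const (𝕂 := ℝ) C (0 : ℝ)
    have h' := ((h A).mul (h B)).sub (h (A + B))
    refine HasDerivAt.congr_deriv (f := fun t : ℝ => exp (t • A) * exp (t • B) - exp (t • (A + B)))
      h' ?_
    simp
  have hlim : Tendsto (fun n : ℕ => (n : ℝ) * ‖exp ((n : ℝ)⁻¹ • A) * exp ((n : ℝ)⁻¹ • B) -
      exp ((n : ℝ)⁻¹ • (A + B))‖) atTop (𝓝 0) := by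
    have h1 : Tendsto (fun n : ℕ => ((n : ℝ))⁻¹) atTop (𝓝[≠] 0) := by
      refine tendsto_nhdsWithin_iff.2 ⟨tendsto_inv_atTop_nhds_zero_nat, ?_⟩
      filter_upwards [eventually_ge_atTop 1] with n hn
      have : (0 : ℝ) < n := by exact_mod_cast hn
      simpa using this.ne'
    have h2 := ((hasDerivAt_iff_tendsto_slope.1 hd).comp h1).norm
    simp only [norm_zero] at h2
    refine h2.congr fun n => ?_
    simp [slope, norm_smul]
  have hnorm : ∀ C : 𝔸, ‖exp C‖ ≤ Real.exp ‖C‖ := norm_exp_le_exp_norm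
  set M : ℝ := ‖A‖ + ‖B‖ with hM
  rw [tendsto_iff_norm_sub_tendsto_zero]
  have hlim' := hlim.mul_const (Real.exp M)
  rw [zero_mul] at hlim'
  refine squeeze_zero' (Eventually.of_forall fun _ => norm_nonneg _) ?_ hlim'
  filter_upwards [eventually_ge_atTop 1] with n hn
  have hn0 : (0 : ℝ) < n := by exact_mod_cast hn
  have hC : ∀ C : 𝔸, ‖(n : ℝ)⁻¹ • C‖ = (n : ℝ)⁻¹ * ‖C‖ := fun C => by
    rw [norm_smul, Real.norm_of_nonneg (by positivity)]
  have hx : ‖exp ((n : ℝ)⁻¹ • A) * exp ((n : ℝ)⁻¹ • B)‖ ≤ Real.exp ((n : ℝ)⁻¹ * M) := by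
    rw [hM, mul_add, Real.exp_add, ← hC, ← hC]
    exact (norm_mul_le _ _).trans (by gcongr <;> exact hnorm _)
  have hy : ‖exp ((n : ℝ)⁻¹ • (A + B))‖ ≤ Real.exp ((n : ℝ)⁻¹ * M) := by
    refine (hnorm _).trans ?_
    rw [hC]
    gcongr
    exact norm_add_le _ _
  have hpow : exp (A + B) = exp ((n : ℝ)⁻¹ • (A + B)) ^ n :=
    (exp_inv_smul_pow _ (Nat.one_le_iff_ne_zero.1 hn)).symm
  obtain ⟨k, rfl⟩ := Nat.exists_eq_add_of_le' hn
  rw [hpow]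
  refine (norm_pow_succ_sub_le (Real.exp_pos _).le hx hy k).trans ?_
  have hexp : Real.exp (((k + 1 : ℕ) : ℝ)⁻¹ * M) ^ k ≤ Real.exp M := by
    rw [← Real.exp_nat_mul, Real.exp_le_exp]
    have : (k : ℝ) * (((k + 1 : ℕ) : ℝ)⁻¹ * M) = (k / ((k + 1 : ℕ) : ℝ)) * M := by ring
    rw [this]
    have hM0 : 0 ≤ M := by positivity
    refine mul_le_of_le_one_left hM0 ?_
    rw [div_le_one hn0]; push_cast; linarith
  calc _ ≤ ((k : ℝ) + 1) * (Real.exp M * _) := by gcongr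
    _ = _ := by push_cast; ring

open Filter Topology NormedSpace in
/-- The Golden–Thompson inequality for real symmetric matrices. -/
lemma trace_exp_add_le (A B : Matrix ι ι ℝ) (hA : Aᵀ = A) (hB : Bᵀ = B) :
    (exp (A + B)).trace ≤ (exp A * exp B).trace := by
  -- The Lie product formula needs `‖1‖ = 1`, which fails for empty matrices.
  cases isEmpty_or_nonempty ι
  · simp [Matrix.trace]
  -- The dyadic trace inequality is available only for exponents `2 ^ k`, so the limit is taken
  -- along this subsequence.
  have h2 : Tendsto (fun k : ℕ => 2 ^ k) atTop atTop := 
    tendsto_pow_atTop_atTop_of_one_lt one_lt_two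
  have h := (tendsto_exp_mul_exp_pow A B).comp h2
  have ht := (Continuous.matrix_trace (continuous_id (X := Matrix ι ι ℝ))).continuousAt.tendsto.comp h
  refine le_of_tendsto ht (Eventually.of_forall fun k => ?_)
  have hpow : ∀ C : Matrix ι ι ℝ, exp ((((2 ^ k : ℕ) : ℝ))⁻¹ • C) ^ 2 ^ k = exp C := fun C =>
    exp_inv_smul_pow C (by positivity)
  have hs : ∀ C : Matrix ι ι ℝ, Cᵀ = C → (exp ((((2 ^ k : ℕ) : ℝ))⁻¹ • C))ᵀ =
      exp ((((2 ^ k : ℕ) : ℝ))⁻¹ • C) := fun C hC => by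
    rw [← Matrix.exp_transpose, Matrix.transpose_smul, hC]
  have := (trace_pow_dyadic k).1 _ _ (hs A hA) (hs B hB)
  rw [hpow, hpow] at this
  exact this

end GoldenThompson

/-! ### Matrix Chernoff bounds for the row sample -/

section Chernoff

open NormedSpace (exp)

variable {m d r : ℕ}

/-! ### Frobenius norms and the rank-one decomposition of the sampled Gram matrix. -/

lemma frobSq_eq_trace (A : Matrix (Fin m) (Fin d) ℝ) : frobSq A = (Aᵀ * A).trace := by
  simp only [frobSq, Matrix.trace, Matrix.diag, Matrix.mul_apply, Matrix.transpose_apply, pow_two]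
  exact Finset.sum_comm

lemma norm_toLp_sq (x : Fin d → ℝ) : ‖WithLp.toLp 2 x‖ ^ 2 = ∑ i, x i ^ 2 := by
  rw [EuclideanSpace.real_norm_sq_eq]

lemma sum_sq_mulVec_le (A : Matrix (Fin m) (Fin d) ℝ) (x : Fin d → ℝ) :
    ∑ i, (A *ᵥ x) i ^ 2 ≤ ‖A‖ ^ 2 * ∑ i, x i ^ 2 := by
  have h := A.l2_opNorm_mulVec (WithLp.toLp 2 x)
  have h2 := pow_le_pow_left₀ (norm_nonneg _) h 2
  rw [mul_pow, norm_toLp_sq, EuclideanSpace.real_norm_sq_eq] at h2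
  exact h2

lemma frobSq_mul_le (A : Matrix (Fin m) (Fin d) ℝ) (Y : Matrix (Fin d) (Fin r) ℝ) :
    frobSq (A * Y) ≤ ‖A‖ ^ 2 * frobSq Y := by
  unfold frobSq
  rw [Finset.sum_comm, Finset.sum_comm (f := fun i j => Y i j ^ 2), Finset.mul_sum]
  exact Finset.sum_le_sum fun j _ => sum_sq_mulVec_le A fun i => Y i j

lemma sum_sq_mulVec_le_frobSq (A : Matrix (Fin m) (Fin d) ℝ) (x : Fin d → ℝ) :
    ∑ i, (A *ᵥ x) i ^ 2 ≤ frobSq A * ∑ i, x i ^ 2 := by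
  unfold frobSq
  rw [Finset.sum_mul]
  exact Finset.sum_le_sum fun i _ =>
    Finset.sum_mul_sq_le_sq_mul_sq Finset.univ (fun j => A i j) x

lemma frobSq_nonneg (A : Matrix (Fin m) (Fin d) ℝ) : 0 ≤ frobSq A :=
  Finset.sum_nonneg fun _ _ => Finset.sum_nonneg fun _ _ => sq_nonneg _

lemma frobSq_pos {A : Matrix (Fin m) (Fin d) ℝ} (hA : A ≠ 0) : 0 < frobSq A := by
  refine (frobSq_nonneg A).lt_of_ne fun h => hA ?_
  ext i j
  have h1 := (Finset.sum_eq_zero_iff_of_nonneg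
    (fun i _ => Finset.sum_nonneg fun j _ => sq_nonneg (A i j))).1 h.symm i (Finset.mem_univ _)
  have h2 := (Finset.sum_eq_zero_iff_of_nonneg (fun j _ => sq_nonneg (A i j))).1 h1 j
    (Finset.mem_univ _)
  exact pow_eq_zero_iff two_ne_zero |>.1 h2

lemma rowProb_nonneg (A : Matrix (Fin m) (Fin d) ℝ) (t : Fin m) : 0 ≤ rowProb A t :=
  div_nonneg (Finset.sum_nonneg fun _ _ => sq_nonneg _) (frobSq_nonneg A)

lemma sum_rowProb {A : Matrix (Fin m) (Fin d) ℝ} (hA : A ≠ 0) : ∑ t, rowProb A t = 1 := by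
  unfold rowProb
  rw [← Finset.sum_div]
  exact div_self (frobSq_pos hA).ne'

/-- The rank-one summand `a_t a_tᵀ / (r p_t)` of `ÃᵀÃ`. -/
def rowTerm (A : Matrix (Fin m) (Fin d) ℝ) (r : ℕ) (t : Fin m) : Matrix (Fin d) (Fin d) ℝ :=
  Matrix.of fun k l => A t k * A t l / (r * rowProb A t)

lemma rowSample_apply (A : Matrix (Fin m) (Fin d) ℝ) (t : Fin r → Fin m) (j : Fin r) (l : Fin d) :
    rowSample A t j l = A (t j) l / Real.sqrt (r * rowProb A (t j)) := by
  simp [rowSample, samplingMatrix, Matrix.mul_apply, div_eq_inv_mul]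

lemma rowSample_gram (A : Matrix (Fin m) (Fin d) ℝ) (t : Fin r → Fin m) :
    (rowSample A t)ᵀ * rowSample A t = ∑ j, rowTerm A r (t j) := by
  ext k l
  simp only [Matrix.mul_apply, Matrix.transpose_apply, rowSample_apply, Matrix.sum_apply, rowTerm,
    Matrix.of_apply]
  refine Finset.sum_congr rfl fun j _ => ?_
  rw [div_mul_div_comm, Real.mul_self_sqrt (mul_nonneg (Nat.cast_nonneg _) (rowProb_nonneg A _))]

lemma transpose_rowTerm (A : Matrix (Fin m) (Fin d) ℝ) (t : Fin m) :
    (rowTerm A r t)ᵀ = rowTerm A r t := by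
  ext k l
  simp [rowTerm, mul_comm]

lemma row_eq_zero_of_rowProb {A : Matrix (Fin m) (Fin d) ℝ} (hA : A ≠ 0) {t : Fin m}
    (h : rowProb A t = 0) (l : Fin d) : A t l = 0 := by
  have h1 := (div_eq_zero_iff.1 h).resolve_right (frobSq_pos hA).ne'
  have h2 := (Finset.sum_eq_zero_iff_of_nonneg (fun j _ => sq_nonneg (A t j))).1 h1 l
    (Finset.mem_univ _)
  exact pow_eq_zero_iff two_ne_zero |>.1 h2

/-- Row-norm sampling makes the eigenvalue `‖a_t‖² / (r p_t)` independent of `t`. This gives the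
exponential of every summand the same closed form. A row of probability zero contributes the zero
matrix, by division by zero. -/
lemma rowTerm_mul_self {A : Matrix (Fin m) (Fin d) ℝ} (hA : A ≠ 0) (t : Fin m) :
    rowTerm A r t * rowTerm A r t = (frobSq A / r) • rowTerm A r t := by
  by_cases hp : rowProb A t = 0
  · ext k l
    simp [rowTerm, Matrix.mul_apply, hp]
  · ext k l
    have hF := (frobSq_pos hA).ne'
    have hs : ∑ i, A t i ^ 2 = rowProb A t * frobSq A := by
      rw [rowProb, div_mul_cancel₀ _ hF]
    rcases Nat.eq_zero_or_pos r with rfl | hr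
    · simp [rowTerm, Matrix.mul_apply]
    have hr' : (r : ℝ) ≠ 0 := by positivity
    simp only [rowTerm, Matrix.mul_apply, Matrix.of_apply, Matrix.smul_apply, smul_eq_mul]
    have : ∀ i, A t k * A t i / (r * rowProb A t) * (A t i * A t l / (r * rowProb A t)) =
        A t k * A t l / (r * rowProb A t) ^ 2 * A t i ^ 2 := fun i => by ring
    simp_rw [this]
    rw [← Finset.mul_sum, hs]
    field_simp

/-- Unbiasedness of a single draw: the weights `p_t` cancel, and rows of probability zero vanish, so
excluding them loses nothing. -/
lemma sum_rowProb_smul_rowTerm {A : Matrix (Fin m) (Fin d) ℝ} (hA : A ≠ 0) :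
    ∑ t, rowProb A t • rowTerm A r t = (r : ℝ)⁻¹ • (Aᵀ * A) := by
  ext k l
  simp only [Matrix.sum_apply, Matrix.smul_apply, rowTerm, Matrix.of_apply, smul_eq_mul,
    Matrix.mul_apply, Matrix.transpose_apply, Finset.mul_sum]
  refine Finset.sum_congr rfl fun t _ => ?_
  by_cases hp : rowProb A t = 0
  · simp [hp, row_eq_zero_of_rowProb hA hp]
  · rw [div_eq_mul_inv, mul_inv]
    field_simp

/-- Since `X ^ (n + 1) = c ^ n • X`, the exponential series collapses to a scalar one. -/
lemma exp_eq_of_mul_self {𝔸 : Type*} [NormedRing 𝔸] [NormedAlgebra ℝ 𝔸] [CompleteSpace 𝔸]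
    {X : 𝔸} {c : ℝ} (hc : c ≠ 0) (h : X * X = c • X) :
    exp X = 1 + ((Real.exp c - 1) / c) • X := by
  have h1 := NormedSpace.exp_series_hasSum_exp' (𝕂 := ℝ) X
  have h2 := NormedSpace.exp_series_hasSum_exp' (𝕂 := ℝ) c
  rw [← Real.exp_eq_exp_ℝ] at h2
  have h3 := (h2.smul_const (c⁻¹ • X)).add (hasSum_ite_eq (0 : ℕ) (1 - c⁻¹ • X))
  have hpow : ∀ n : ℕ, X ^ (n + 1) = c ^ n • X := fun n => by
    induction n with
    | zero => simp
    | succ n ih => rw [pow_succ, ih, smul_mul_assoc, h, smul_smul, ← pow_succ]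
  refine (h1.unique (h3.congr_fun ?_)).trans ?_
  · intro n
    cases n with
    | zero => simp
    | succ n =>
      simp only [hpow, smul_smul, smul_eq_mul, Nat.succ_ne_zero, if_false, add_zero]
      congr 1
      rw [pow_succ]; field_simp
  · rw [smul_smul, sub_div, sub_smul, one_div, div_eq_mul_inv]
    abel

lemma exp_mulVec_of_mulVec {ι : Type*} [Fintype ι] [DecidableEq ι] {X : Matrix ι ι ℝ} {v : ι → ℝ}
    {c : ℝ} (h : X *ᵥ v = c • v) : exp X *ᵥ v = Real.exp c • v := by
  have h1 := (NormedSpace.exp_series_hasSum_exp' (𝕂 := ℝ) X).map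
    (Matrix.mulVec.addMonoidHomLeft v) (continuous_id.matrix_mulVec continuous_const)
  have h2 := (NormedSpace.exp_series_hasSum_exp' (𝕂 := ℝ) c).smul_const v
  rw [← Real.exp_eq_exp_ℝ] at h2
  refine h1.unique (h2.congr_fun fun n => ?_)
  have hpow : X ^ n *ᵥ v = c ^ n • v := by
    induction n with
    | zero => simp
    | succ n ih => rw [pow_succ, ← Matrix.mulVec_mulVec, h, Matrix.mulVec_smul, ih, smul_smul, pow_succ, mul_comm]
  simp [Matrix.mulVec.addMonoidHomLeft, Matrix.smul_mulVec, hpow, smul_smul]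

/-- For symmetric `S` this writes `exp S` as the square of a symmetric matrix, so that its traces
are squared Frobenius norms and positivity needs no spectral theorem. -/
lemma exp_eq_mul_self (S : Matrix (Fin d) (Fin d) ℝ) :
    exp S = exp ((2 : ℝ)⁻¹ • S) * exp ((2 : ℝ)⁻¹ • S) := by
  have := exp_inv_smul_pow S two_ne_zero
  rw [pow_two] at this
  exact_mod_cast this.symm

lemma transpose_exp {S : Matrix (Fin d) (Fin d) ℝ} (hS : Sᵀ = S) (c : ℝ) :
    (exp (c • S))ᵀ = exp (c • S) := by
  rw [← Matrix.exp_transpose, Matrix.transpose_smul, hS]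

/-- An eigenvalue of a symmetric matrix is bounded through the trace of the exponential. -/
lemma exp_eigenvalue_le_trace {S : Matrix (Fin d) (Fin d) ℝ} (hS : Sᵀ = S) {v : Fin d → ℝ}
    (hv : ∑ i, v i ^ 2 = 1) {c : ℝ} (h : S *ᵥ v = c • v) : Real.exp c ≤ (exp S).trace := by
  have h1 : ((2 : ℝ)⁻¹ • S) *ᵥ v = (c / 2) • v := by
    rw [Matrix.smul_mulVec, h, smul_smul]; congr 1; ring
  -- `exp c = ‖exp (S/2) v‖²` is bounded by `‖exp (S/2)‖_F² = tr (exp S)`.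
  have h2 := sum_sq_mulVec_le_frobSq (exp ((2 : ℝ)⁻¹ • S)) v
  rw [exp_mulVec_of_mulVec h1, hv, frobSq_eq_trace, transpose_exp hS, ← exp_eq_mul_self] at h2
  simp only [Pi.smul_apply, smul_eq_mul, mul_pow, ← Finset.mul_sum, hv, mul_one] at h2
  rwa [← Real.exp_nat_mul, Nat.cast_ofNat, mul_div_cancel₀ _ two_ne_zero] at h2

/-- The exponential trace moment of a sum of i.i.d. symmetric matrices. -/
lemma sum_prod_mul_trace_exp_le (p : Fin m → ℝ) (hp : ∀ i, 0 ≤ p i)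
    (Z : Fin m → Matrix (Fin d) (Fin d) ℝ) (hZ : ∀ i, (Z i)ᵀ = Z i) {κ : ℝ} (hκ : 0 ≤ κ)
    (h : ∀ Y : Matrix (Fin d) (Fin d) ℝ, Yᵀ = Y →
      ∑ i, p i * (Y * Y * exp (Z i)).trace ≤ κ * (Y * Y).trace) (k : ℕ) :
    ∑ t : Fin k → Fin m, (∏ j, p (t j)) * (exp (∑ j, Z (t j))).trace ≤ κ ^ k * d := by
  induction k with
  | zero => simp
  | succ k ih =>
    rw [← (Fin.consEquiv fun _ : Fin (k + 1) => Fin m).sum_comp, Fintype.sum_prod_type,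
      Finset.sum_comm]
    simp only [Fin.consEquiv_apply, Fin.prod_univ_succ, Fin.sum_univ_succ, Fin.cons_zero,
      Fin.cons_succ]
    calc _ ≤ ∑ t : Fin k → Fin m, (∏ j, p (t j)) * (κ * (exp (∑ j, Z (t j))).trace) := by
          refine Finset.sum_le_sum fun t _ => ?_
          have hS : (∑ j, Z (t j))ᵀ = ∑ j, Z (t j) := by
            rw [Matrix.transpose_sum]; simp [hZ]
          -- With `S` the sum over the other indices and `Y = exp (S/2)`, one has `Y * Y = exp S`.
          -- Golden–Thompson separates the new summand from `S`, and `h` then averages it out.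
          have hY := h _ (transpose_exp hS (2 : ℝ)⁻¹)
          rw [← exp_eq_mul_self] at hY
          refine le_trans ?_ (mul_le_mul_of_nonneg_left hY
            (Finset.prod_nonneg fun j _ => hp (t j)))
          rw [Finset.mul_sum]
          refine Finset.sum_le_sum fun i _ => ?_
          have hGT := trace_exp_add_le (Z i) _ (hZ i) hS
          rw [Matrix.trace_mul_comm] at hGT
          have := mul_le_mul_of_nonneg_left hGT
            (mul_nonneg (Finset.prod_nonneg fun j (_ : j ∈ Finset.univ) => hp (t j)) (hp i))
          linarith
      _ = κ * ∑ t : Fin k → Fin m, (∏ j, p (t j)) * (exp (∑ j, Z (t j))).trace := by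
          rw [Finset.mul_sum]
          exact Finset.sum_congr rfl fun t _ => by ring
      _ ≤ κ * (κ ^ k * d) := by gcongr
      _ = _ := by ring

/-- A top right singular vector. -/
lemma exists_top_singular (hd : 0 < d) (B : Matrix (Fin m) (Fin d) ℝ) :
    ∃ v : Fin d → ℝ, ∑ i, v i ^ 2 = 1 ∧ ∑ i, (B *ᵥ v) i ^ 2 = ‖B‖ ^ 2 ∧
      (Bᵀ * B) *ᵥ v = ‖B‖ ^ 2 • v := by
  have : Nonempty (Fin d) := ⟨⟨0, hd⟩⟩
  set T : EuclideanSpace ℝ (Fin d) →L[ℝ] EuclideanSpace ℝ (Fin m) :=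
    (Matrix.toEuclideanLin.trans LinearMap.toContinuousLinearMap) B with hT
  have hnorm : ‖B‖ = ‖T‖ := Matrix.l2_opNorm_def B
  obtain ⟨v, hv, hmax⟩ := (isCompact_sphere (0 : EuclideanSpace ℝ (Fin d)) 1).exists_isMaxOn
    (NormedSpace.sphere_nonempty.2 zero_le_one) (f := fun x => ‖T x‖) (by fun_prop)
  have hv1 : ‖v‖ = 1 := by simpa using hv
  have hge : ‖T‖ ≤ ‖T v‖ := by
    refine ContinuousLinearMap.opNorm_le_of_unit_norm (norm_nonneg _) fun x hx => hmax ?_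
    simpa using hx
  have hTv : ‖T v‖ = ‖B‖ := by
    refine le_antisymm ?_ (hnorm ▸ hge)
    simpa [hv1, hnorm] using T.le_opNorm v
  have hvs : ∑ i, v i ^ 2 = 1 := by
    rw [← EuclideanSpace.real_norm_sq_eq, hv1, one_pow]
  have hBv : ∑ i, (B *ᵥ v) i ^ 2 = ‖B‖ ^ 2 := by
    rw [← hTv, EuclideanSpace.real_norm_sq_eq]; rfl
  refine ⟨v, hvs, hBv, ?_⟩
  have h1 : ∑ i, ((Bᵀ * B) *ᵥ v) i ^ 2 ≤ ‖B‖ ^ 4 := by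
    rw [← Matrix.mulVec_mulVec]
    refine (sum_sq_mulVec_le Bᵀ _).trans ?_
    rw [hBv, ← Matrix.conjTranspose_eq_transpose_of_trivial, Matrix.l2_opNorm_conjTranspose]
    exact le_of_eq (by ring)
  have h2 : ∑ i, ((Bᵀ * B) *ᵥ v) i * v i = ‖B‖ ^ 2 := by
    rw [← hBv]
    have : ∑ i, ((Bᵀ * B) *ᵥ v) i * v i = (Bᵀ *ᵥ (B *ᵥ v)) ⬝ᵥ v.ofLp := by
      rw [Matrix.mulVec_mulVec]; rfl
    rw [this, Matrix.mulVec_transpose, ← Matrix.dotProduct_mulVec]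
    simp [dotProduct, pow_two]
  -- The eigenvector equation: expanding `‖BᵀB v - ‖B‖² v‖²` gives at most `‖B‖⁴ - 2‖B‖⁴ + ‖B‖⁴ =
  -- 0`.
  have h3 : ∑ i, (((Bᵀ * B) *ᵥ v) i - ‖B‖ ^ 2 * v i) ^ 2 ≤ 0 := by
    have : ∀ i, (((Bᵀ * B) *ᵥ v) i - ‖B‖ ^ 2 * v i) ^ 2 = ((Bᵀ * B) *ᵥ v) i ^ 2 -
        2 * ‖B‖ ^ 2 * (((Bᵀ * B) *ᵥ v) i * v i) + ‖B‖ ^ 4 * v i ^ 2 := fun i => by ring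
    simp_rw [this]
    rw [Finset.sum_add_distrib, Finset.sum_sub_distrib, ← Finset.mul_sum, ← Finset.mul_sum, h2, hvs]
    linarith
  ext i
  have h4 := (Finset.sum_eq_zero_iff_of_nonneg (fun i _ => sq_nonneg
    (((Bᵀ * B) *ᵥ v) i - ‖B‖ ^ 2 * v i))).1
      (le_antisymm h3 (Finset.sum_nonneg fun _ _ => sq_nonneg _)) i (Finset.mem_univ _)
  exact sub_eq_zero.1 (pow_eq_zero_iff two_ne_zero |>.1 h4)

/-- The probability of an index vector. -/
def sampleWeight (A : Matrix (Fin m) (Fin d) ℝ) (t : Fin r → Fin m) : ℝ :=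
  ∏ j, rowProb A (t j)

lemma sampleWeight_nonneg (A : Matrix (Fin m) (Fin d) ℝ) (t : Fin r → Fin m) :
    0 ≤ sampleWeight A t :=
  Finset.prod_nonneg fun _ _ => rowProb_nonneg A _

/-- The two traces are the squared Frobenius norms of `A Y` and of `Y`. This is `AᵀA ≤ ‖A‖²` in the
order of positive matrices, tested against `Y²`. -/
lemma trace_mul_gram_le (A : Matrix (Fin m) (Fin d) ℝ) {Y : Matrix (Fin d) (Fin d) ℝ}
    (hY : Yᵀ = Y) : (Y * Y * (Aᵀ * A)).trace ≤ ‖A‖ ^ 2 * (Y * Y).trace := by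
  have h := frobSq_mul_le A Y
  rw [frobSq_eq_trace, frobSq_eq_trace, Matrix.transpose_mul, hY] at h
  refine le_trans (le_of_eq ?_) h
  rw [mul_assoc, Matrix.trace_mul_comm]
  simp only [mul_assoc, Matrix.mul_assoc]

lemma norm_pos_of_ne_zero {A : Matrix (Fin m) (Fin d) ℝ} (hA : A ≠ 0) : 0 < ‖A‖ :=
  norm_pos_iff.2 hA

/-- Upper tail of the norm of the row sample. -/
lemma sum_sampleWeight_upper_le {A : Matrix (Fin m) (Fin d) ℝ} (hA : A ≠ 0) (hr : 0 < r) :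
    ∑ t : Fin r → Fin m, (if 3 / 2 * ‖A‖ ^ 2 < ‖rowSample A t‖ ^ 2 then sampleWeight A t else 0) ≤
      d * Real.exp (-(r * ‖A‖ ^ 2 / frobSq A / 16)) := by
  have hF := frobSq_pos hA
  have hr' : (0 : ℝ) < r := Nat.cast_pos.2 hr
  have hd : 0 < d := by
    rcases Nat.eq_zero_or_pos d with rfl | h
    · exact absurd (Matrix.ext fun i j => j.elim0) hA
    · exact h
  set L := frobSq A / r with hL
  have hL0 : 0 < L := by positivity
  -- As `exp (2/5) ≤ 3/2`, the trace moment is at most `d exp (Q/2)`, while the threshold `3/2 ‖A‖²`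
  -- contributes `exp (-3Q/5)`. The net rate `Q/10` is weakened to `Q/16` to match the lower tail.
  set θ := (2 / 5) / L with hθ
  have hθ0 : 0 < θ := by positivity
  have hθL : θ * L = 2 / 5 := div_mul_cancel₀ _ hL0.ne'
  set Q := r * ‖A‖ ^ 2 / frobSq A with hQ
  have hQ0 : 0 ≤ Q := by positivity
  have hQL : ‖A‖ ^ 2 / L = Q := by rw [hL, hQ]; field_simp
  have hsymm : ∀ i, (θ • rowTerm A r i)ᵀ = θ • rowTerm A r i := fun i => by
    rw [Matrix.transpose_smul, transpose_rowTerm]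
  have hexp : ∀ i, exp (θ • rowTerm A r i) =
      1 + ((Real.exp (2 / 5) - 1) / L) • rowTerm A r i := fun i => by
    rw [exp_eq_of_mul_self (X := θ • rowTerm A r i) (c := 2 / 5) (by norm_num)]
    · rw [smul_smul]
      congr 2
      rw [hθ]; field_simp
    · rw [smul_mul_smul_comm, rowTerm_mul_self hA, smul_smul, smul_smul, ← hL, mul_assoc, hθL,
        mul_comm]
  have he : Real.exp (2 / 5) ≤ 3 / 2 := by
    have h := Real.exp_bound' (x := 2 / 5) (by norm_num) (by norm_num) (n := 4) (by norm_num)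
    refine h.trans ?_
    norm_num [Finset.sum_range_succ, Nat.factorial]
  have he1 : 1 ≤ Real.exp (2 / 5) := Real.one_le_exp (by norm_num)
  set κ := 1 + (1 / 2) * (Q / r) with hκ
  have hκ0 : 0 ≤ κ := by positivity
  have hstep : ∀ Y : Matrix (Fin d) (Fin d) ℝ, Yᵀ = Y →
      ∑ i, rowProb A i * (Y * Y * exp (θ • rowTerm A r i)).trace ≤ κ * (Y * Y).trace := by
    intro Y hY
    have hYY : 0 ≤ (Y * Y).trace := by
      have := frobSq_nonneg Y
      rwa [frobSq_eq_trace, hY] at this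
    have h1 : ∑ i, rowProb A i * (Y * Y * exp (θ • rowTerm A r i)).trace =
        (Y * Y).trace + (Real.exp (2 / 5) - 1) / L *
          (Y * Y * ∑ i, rowProb A i • rowTerm A r i).trace := by
      simp_rw [hexp, mul_add, mul_one, Matrix.trace_add, mul_add, Finset.sum_add_distrib]
      rw [← Finset.sum_mul, sum_rowProb hA, one_mul, Matrix.mul_sum, Matrix.trace_sum,
        Finset.mul_sum]
      congr 1
      refine Finset.sum_congr rfl fun i _ => ?_
      rw [mul_smul_comm, mul_smul_comm, Matrix.trace_smul, Matrix.trace_smul, smul_eq_mul,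
        smul_eq_mul]
      ring
    rw [h1, sum_rowProb_smul_rowTerm hA, mul_smul_comm, Matrix.trace_smul, smul_eq_mul]
    have h2 := trace_mul_gram_le A hY
    calc _ ≤ (Y * Y).trace + (1 / 2) / L * ((r : ℝ)⁻¹ * (‖A‖ ^ 2 * (Y * Y).trace)) := by
          have h0 : 0 ≤ (Y * Y * (Aᵀ * A)).trace := by
            have := frobSq_nonneg (A * Y)
            rw [frobSq_eq_trace, Matrix.transpose_mul, hY] at this
            refine this.trans (le_of_eq ?_)
            rw [mul_assoc, Matrix.trace_mul_comm (Y : Matrix _ _ ℝ)]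
            simp only [Matrix.mul_assoc]
          gcongr
          linarith
      _ = κ * (Y * Y).trace := by
          rw [hκ, ← hQL]; field_simp
  have hmain := sum_prod_mul_trace_exp_le (rowProb A) (rowProb_nonneg A)
    (fun i => θ • rowTerm A r i) hsymm hκ0 hstep r
  have hκr : κ ^ r ≤ Real.exp (Q / 2) := by
    have : κ ≤ Real.exp (1 / 2 * (Q / r)) := by
      rw [hκ, add_comm]; exact Real.add_one_le_exp _
    refine (pow_le_pow_left₀ hκ0 this r).trans (le_of_eq ?_)
    rw [← Real.exp_nat_mul]; congr 1; field_simp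
  -- Markov's inequality pointwise: on the tail event, the trace of the exponential dominates its
  -- value at the top eigenvalue.
  have hterm : ∀ t : Fin r → Fin m,
      (if 3 / 2 * ‖A‖ ^ 2 < ‖rowSample A t‖ ^ 2 then sampleWeight A t else 0) ≤
      Real.exp (-(3 / 5 * Q)) *
        ((∏ j, rowProb A (t j)) * (exp (∑ j, θ • rowTerm A r (t j))).trace) := by
    intro t
    obtain ⟨v, hv, -, hev⟩ := exists_top_singular hd (rowSample A t)
    have hS : (∑ j, θ • rowTerm A r (t j)) = θ • ((rowSample A t)ᵀ * rowSample A t) := by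
      rw [rowSample_gram, Finset.smul_sum]
    have htr : Real.exp (θ * ‖rowSample A t‖ ^ 2) ≤ (exp (∑ j, θ • rowTerm A r (t j))).trace := by
      refine exp_eigenvalue_le_trace ?_ hv ?_
      · rw [hS]; simp
      · rw [hS, Matrix.smul_mulVec, hev, smul_smul]
    have hw := sampleWeight_nonneg A t
    have hpos := (Real.exp_pos _).le.trans htr
    split_ifs with h
    · have h3 : 3 / 5 * Q ≤ θ * ‖rowSample A t‖ ^ 2 := by
        have : 3 / 5 * Q = θ * (3 / 2 * ‖A‖ ^ 2) := by rw [← hQL, hθ]; ring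
        rw [this]; gcongr
      have h4 : 1 ≤ Real.exp (-(3 / 5 * Q)) * (exp (∑ j, θ • rowTerm A r (t j))).trace := by
        calc (1 : ℝ) = Real.exp (-(3 / 5 * Q)) * Real.exp (3 / 5 * Q) := by
              rw [← Real.exp_add]; simp
          _ ≤ _ := by
              gcongr
              exact (Real.exp_le_exp.2 h3).trans htr
      calc sampleWeight A t = sampleWeight A t * 1 := (mul_one _).symm
        _ ≤ sampleWeight A t * _ := mul_le_mul_of_nonneg_left h4 hw
        _ = _ := by rw [sampleWeight]; ring
    · exact mul_nonneg (Real.exp_pos _).le (mul_nonneg hw hpos)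
  refine (Finset.sum_le_sum fun t _ => hterm t).trans ?_
  rw [← Finset.mul_sum]
  calc _ ≤ Real.exp (-(3 / 5 * Q)) * (Real.exp (Q / 2) * d) := by
        gcongr
        exact hmain.trans (by gcongr)
    _ = d * Real.exp (-(Q / 10)) := by
        rw [← mul_assoc, ← Real.exp_add, mul_comm]; congr 2; ring
    _ ≤ _ := by
        gcongr
        linarith

/-- Lower tail of the norm of the row sample. -/
lemma sum_sampleWeight_lower_le {A : Matrix (Fin m) (Fin d) ℝ} (hA : A ≠ 0) (hr : 0 < r) :
    ∑ t : Fin r → Fin m, (if ‖rowSample A t‖ ^ 2 < 1 / 2 * ‖A‖ ^ 2 then sampleWeight A t else 0) ≤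
      Real.exp (-(r * ‖A‖ ^ 2 / frobSq A / 16)) := by
  have hF := frobSq_pos hA
  have hr' : (0 : ℝ) < r := Nat.cast_pos.2 hr
  have hd : 0 < d := by
    rcases Nat.eq_zero_or_pos d with rfl | h
    · exact absurd (Matrix.ext fun i j => j.elim0) hA
    · exact h
  -- Since `‖Ã‖² ≥ ‖Ã v‖²`, it suffices to follow the top singular vector `v` of `A`. There `‖Ã v‖²`
  -- is a sum of independent scalars in `[0, L]` with mean `‖A‖² / r`, so no dimension factor
  -- appears.
  obtain ⟨v, hv, hAv, -⟩ := exists_top_singular hd A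
  set L := frobSq A / r with hL
  have hL0 : 0 < L := by positivity
  -- On `[0, 1/4]` one has `exp (-x) ≤ 1 - x + x² ≤ 1 - 3x/4`. The moment is thus at most `exp
  -- (-3Q/16)`, the threshold costs `exp (Q/8)`, and `Q/16` remains.
  set θ := (1 / 4) / L with hθ
  have hθ0 : 0 < θ := by positivity
  have hθL : θ * L = 1 / 4 := div_mul_cancel₀ _ hL0.ne'
  set Q := r * ‖A‖ ^ 2 / frobSq A with hQ
  have hQL : ‖A‖ ^ 2 / L = Q := by rw [hL, hQ]; field_simp
  set s : Fin m → ℝ := fun i => (A *ᵥ v) i ^ 2 / (r * rowProb A i) with hs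
  have hs0 : ∀ i, 0 ≤ s i := fun i =>
    div_nonneg (sq_nonneg _) (mul_nonneg hr'.le (rowProb_nonneg A i))
  have hAv0 : ∀ i, rowProb A i = 0 → (A *ᵥ v) i = 0 := fun i hp => by
    simp [Matrix.mulVec, dotProduct, row_eq_zero_of_rowProb hA hp]
  have hsL : ∀ i, s i ≤ L := fun i => by
    have h1 : (A *ᵥ v) i ^ 2 ≤ rowProb A i * frobSq A := by
      rw [rowProb, div_mul_cancel₀ _ hF.ne']
      have : (A *ᵥ v) i ^ 2 ≤ (∑ j, A i j ^ 2) * ∑ j, v j ^ 2 :=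
        Finset.sum_mul_sq_le_sq_mul_sq Finset.univ (fun j => A i j) v
      rwa [hv, mul_one] at this
    rcases (rowProb_nonneg A i).eq_or_lt with hp | hp
    · simp only [hs, ← hp]; simpa using hL0.le
    · rw [hs, hL]; simp only
      rw [div_le_div_iff₀ (by positivity) hr']
      nlinarith
  have hps : ∑ i, rowProb A i * s i = ‖A‖ ^ 2 / r := by
    rw [← hAv, Finset.sum_div]
    refine Finset.sum_congr rfl fun i _ => ?_
    by_cases hp : rowProb A i = 0
    · simp [hp, hAv0 i hp]
    · simp only [hs]; field_simp
  have hone : ∑ i, rowProb A i * Real.exp (-(θ * s i)) ≤ Real.exp (-(3 / 16 * (Q / r))) := by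
    have h1 : ∀ i, Real.exp (-(θ * s i)) ≤ 1 - 3 / 4 * (θ * s i) := fun i => by
      have hx0 : 0 ≤ θ * s i := mul_nonneg hθ0.le (hs0 i)
      have hx1 : θ * s i ≤ 1 / 4 := hθL ▸ mul_le_mul_of_nonneg_left (hsL i) hθ0.le
      have := Real.abs_exp_sub_one_sub_id_le (x := -(θ * s i)) (by rw [abs_neg, abs_of_nonneg hx0]; linarith)
      have := (abs_le.1 this).2
      nlinarith
    calc _ ≤ ∑ i, (rowProb A i - 3 / 4 * θ * (rowProb A i * s i)) := by
          refine Finset.sum_le_sum fun i _ => ?_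
          have := mul_le_mul_of_nonneg_left (h1 i) (rowProb_nonneg A i)
          linarith
      _ = -(3 / 16 * (Q / r)) + 1 := by
          rw [Finset.sum_sub_distrib, ← Finset.mul_sum, hps, sum_rowProb hA, ← hQL, hθ]
          field_simp
          ring
      _ ≤ _ := Real.add_one_le_exp _
  have hterm : ∀ t : Fin r → Fin m,
      (if ‖rowSample A t‖ ^ 2 < 1 / 2 * ‖A‖ ^ 2 then sampleWeight A t else 0) ≤
      Real.exp (Q / 8) * ∏ j, (rowProb A (t j) * Real.exp (-(θ * s (t j)))) := by
    intro t
    have hw := sampleWeight_nonneg A t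
    rw [Finset.prod_mul_distrib, ← Real.exp_sum]
    change _ ≤ Real.exp (Q / 8) * (sampleWeight A t * _)
    split_ifs with h
    · have h1 : ∑ j, s (t j) ≤ ‖rowSample A t‖ ^ 2 := by
        have := sum_sq_mulVec_le (rowSample A t) v
        rw [hv, mul_one] at this
        refine le_trans (le_of_eq (Finset.sum_congr rfl fun j _ => ?_)) this
        have h2 : (rowSample A t *ᵥ v) j = (A *ᵥ v) (t j) / Real.sqrt (r * rowProb A (t j)) := by
          simp only [Matrix.mulVec, dotProduct, rowSample_apply, Finset.sum_div]
          exact Finset.sum_congr rfl fun l _ => by ring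
        rw [h2, div_pow, Real.sq_sqrt (mul_nonneg hr'.le (rowProb_nonneg A _))]
      have h2 : 1 ≤ Real.exp (Q / 8) * Real.exp (∑ j, -(θ * s (t j))) := by
        rw [← Real.exp_add]
        refine Real.one_le_exp ?_
        rw [Finset.sum_neg_distrib, ← Finset.mul_sum]
        have h3 : θ * ∑ j, s (t j) ≤ θ * (1 / 2 * ‖A‖ ^ 2) := by
          gcongr; exact h1.trans h.le
        have h4 : θ * (1 / 2 * ‖A‖ ^ 2) = Q / 8 := by rw [← hQL, hθ]; ring
        linarith
      calc sampleWeight A t = sampleWeight A t * 1 := (mul_one _).symm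
        _ ≤ sampleWeight A t * _ := mul_le_mul_of_nonneg_left h2 hw
        _ = _ := by ring
    · positivity
  refine (Finset.sum_le_sum fun t _ => hterm t).trans ?_
  -- Independence of the draws: the sum over index vectors of a product is a power of the one-draw
  -- sum.
  rw [← Finset.mul_sum, ← Fintype.sum_pow (fun i => rowProb A i * Real.exp (-(θ * s i)))]
  calc _ ≤ Real.exp (Q / 8) * Real.exp (-(3 / 16 * (Q / r))) ^ r := by
        gcongr
        exact Finset.sum_nonneg fun i _ => mul_nonneg (rowProb_nonneg A i) (Real.exp_pos _).le
    _ = _ := by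
        rw [← Real.exp_nat_mul, ← Real.exp_add]; congr 1; field_simp; ring

end Chernoff

/-! ### The power method -/

section PowerMethod

variable {r d : ℕ}

lemma isSymmetric_gram (B : Matrix (Fin r) (Fin d) ℝ) :
    (Matrix.toEuclideanLin (Bᵀ * B)).IsSymmetric := by
  rw [Matrix.isSymmetric_toEuclideanLin_iff]
  simp [Matrix.IsHermitian]

lemma norm_gram_apply_le (B : Matrix (Fin r) (Fin d) ℝ) (x : EuclideanSpace ℝ (Fin d)) :
    ‖Matrix.toEuclideanLin (Bᵀ * B) x‖ ≤ ‖B‖ ^ 2 * ‖x‖ := by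
  have h := (Bᵀ * B).l2_opNorm_mulVec x
  rw [← Matrix.conjTranspose_eq_transpose_of_trivial, Matrix.l2_opNorm_conjTranspose_mul_self,
    ← pow_two] at h
  exact h

/-- Only an inequality: a vanishing vector is normalized to zero. -/
lemma norm_powerIter_le_one (B : Matrix (Fin r) (Fin d) ℝ) (z : Fin d → ℝ) (n : ℕ) :
    ‖powerIter B z n‖ ≤ 1 := by
  cases n <;> simp only [powerIter, norm_smul, norm_inv, norm_norm] <;>
    exact inv_mul_le_one_of_le₀ le_rfl (norm_nonneg _)

lemma powerEstimate_le (B : Matrix (Fin r) (Fin d) ℝ) (z : Fin d → ℝ) (n : ℕ) :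
    powerEstimate B z n ≤ ‖B‖ ^ 2 :=
  (norm_gram_apply_le B _).trans
    (mul_le_of_le_one_right (sq_nonneg _) (norm_powerIter_le_one B z n))

/-- The power method started at a vector that correlates with the top singular vector. -/
lemma pow_mul_abs_inner_le_powerEstimate_pow {B : Matrix (Fin r) (Fin d) ℝ} (hB : 0 < ‖B‖)
    {v : EuclideanSpace ℝ (Fin d)} (hv : ‖v‖ = 1)
    (hev : Matrix.toEuclideanLin (Bᵀ * B) v = ‖B‖ ^ 2 • v) {z : Fin d → ℝ}
    (hz : (inner ℝ v (WithLp.toLp 2 z)) ≠ 0) (n : ℕ) :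
    (‖B‖ ^ 2) ^ (n + 1) * (|inner ℝ v (WithLp.toLp 2 z)| / ‖WithLp.toLp 2 z‖) ≤
      powerEstimate B z n ^ (n + 1) := by
  set T := Matrix.toEuclideanLin (Bᵀ * B) with hT
  have hsymm : ∀ x y, (inner ℝ (T x) y) = (inner ℝ x (T y)) := isSymmetric_gram B
  have hB2 : 0 < ‖B‖ ^ 2 := by positivity
  have hvT : ∀ x, (inner ℝ v (T x)) = ‖B‖ ^ 2 * (inner ℝ v x) := fun x => by
    rw [← hsymm, hev, real_inner_smul_left]
  have hz0 : WithLp.toLp 2 z ≠ (0 : EuclideanSpace ℝ (Fin d)) := fun h => hz (by rw [h]; simp)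
  have hT0 : ∀ x, (inner ℝ v x) ≠ 0 → 0 < ‖T x‖ := fun x hx => by
    refine norm_pos_iff.2 fun h => ?_
    have := hvT x
    rw [h, inner_zero_right] at this
    exact (mul_ne_zero hB2.ne' hx) this.symm
  have hne : ∀ k, (inner ℝ v (powerIter B z k)) ≠ 0 := fun k => by
    induction k with
    | zero =>
      simp only [powerIter, real_inner_smul_right]
      exact mul_ne_zero (inv_ne_zero (norm_ne_zero_iff.2 hz0)) hz
    | succ k ih =>
      simp only [powerIter, real_inner_smul_right]
      rw [← hT, hvT]
      exact mul_ne_zero (inv_ne_zero (hT0 _ ih).ne') (mul_ne_zero hB2.ne' ih)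
  have hpos : ∀ k, 0 < powerEstimate B z k := fun k => hT0 _ (hne k)
  have hsucc : ∀ k, T (powerIter B z k) = powerEstimate B z k • powerIter B z (k + 1) := fun k => by
    simp only [powerIter, smul_smul]
    rw [← hT, powerEstimate, ← hT, mul_inv_cancel₀ (hT0 _ (hne k)).ne', one_smul]
  have hnorm : ∀ k, ‖powerIter B z (k + 1)‖ = 1 := fun k => by
    simp only [powerIter, norm_smul, norm_inv, norm_norm]
    exact inv_mul_cancel₀ (hT0 _ (hne k)).ne'
  -- By symmetry of `T = BᵀB`, the `k`-th estimate equals `⟨T x_k, x_(k+1)⟩ = ⟨x_k, T x_(k+1)⟩`, and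
  -- Cauchy–Schwarz bounds this by the next estimate.
  have hmono : ∀ k, powerEstimate B z k ≤ powerEstimate B z (k + 1) := fun k => by
    have h1 : (inner ℝ (T (powerIter B z k)) (powerIter B z (k + 1))) = powerEstimate B z k := by
      rw [hsucc, real_inner_smul_left, real_inner_self_eq_norm_sq, hnorm]; ring
    rw [← h1, hsymm]
    refine (real_inner_le_norm _ _).trans ?_
    exact mul_le_of_le_one_left (norm_nonneg _) (norm_powerIter_le_one B z k)
  have hinner : ∀ k, ‖B‖ ^ 2 * |inner ℝ v (powerIter B z k)| =
      powerEstimate B z k * |inner ℝ v (powerIter B z (k + 1))| := fun k => by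
    have := hvT (powerIter B z k)
    rw [hsucc, real_inner_smul_right] at this
    rw [← abs_of_pos (hpos k), ← abs_mul, this, abs_mul, abs_of_pos hB2]
  -- Iterating `hinner` would give the product of all estimates so far; monotonicity replaces each
  -- of them by the last one.
  have hkey : ∀ k, (‖B‖ ^ 2) ^ (k + 1) * |inner ℝ v (powerIter B z 0)| ≤
      powerEstimate B z k ^ (k + 1) * |inner ℝ v (powerIter B z (k + 1))| := fun k => by
    induction k with
    | zero => simp [hinner]
    | succ k ih =>
      calc _ = ‖B‖ ^ 2 * ((‖B‖ ^ 2) ^ (k + 1) * |inner ℝ v (powerIter B z 0)|) := by ring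
        _ ≤ ‖B‖ ^ 2 * (powerEstimate B z k ^ (k + 1) * |inner ℝ v (powerIter B z (k + 1))|) := by gcongr
        _ = powerEstimate B z k ^ (k + 1) * (‖B‖ ^ 2 * |inner ℝ v (powerIter B z (k + 1))|) := by ring
        _ ≤ powerEstimate B z (k + 1) ^ (k + 1) *
            (powerEstimate B z (k + 1) * |inner ℝ v (powerIter B z (k + 1 + 1))|) := by
          rw [hinner]
          gcongr
          · exact mul_nonneg (hpos _).le (abs_nonneg _)
          · exact (hpos k).le
          · exact hmono k
        _ = _ := by ring
  have h0 : |inner ℝ v (powerIter B z 0)| = |inner ℝ v (WithLp.toLp 2 z)| / ‖WithLp.toLp 2 z‖ := by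
    simp only [powerIter, real_inner_smul_right, abs_mul, abs_inv, abs_norm]
    rw [div_eq_inv_mul]
  rw [← h0]
  refine (hkey n).trans (mul_le_of_le_one_right (pow_nonneg (hpos n).le _) ?_)
  have := abs_real_inner_le_norm v (powerIter B z (n + 1))
  rwa [hv, hnorm, one_mul] at this

end PowerMethod

/-! ### Gaussian vectors -/

section Gaussian

variable {d : ℕ}

/-- The density is at most `1/√(2π) ≤ 1/2`, and the interval has length `2s`. -/
lemma gaussianReal_abs_lt_le (s : ℝ) :
    gaussianReal 0 1 {x : ℝ | |x| < s} ≤ ENNReal.ofReal s := by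
  rw [gaussianReal_apply 0 one_ne_zero]
  have hpdf : ∀ x, gaussianPDF 0 1 x ≤ ENNReal.ofReal (1 / 2) := fun x => by
    refine ENNReal.ofReal_le_ofReal ?_
    rw [gaussianPDFReal_def]
    have h1 : Real.exp (-(x - 0) ^ 2 / (2 * ((1 : NNReal) : ℝ))) ≤ 1 := by
      rw [Real.exp_le_one_iff]
      simp only [NNReal.coe_one]
      have := sq_nonneg (x - 0)
      linarith
    have h2 : (√(2 * Real.pi * ((1 : NNReal) : ℝ)))⁻¹ ≤ 1 / 2 := by
      rw [one_div]
      refine inv_anti₀ two_pos ?_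
      refine Real.le_sqrt_of_sq_le ?_
      simp only [NNReal.coe_one]
      nlinarith [Real.pi_gt_three]
    calc _ ≤ (1 / 2 : ℝ) * 1 := mul_le_mul h2 h1 (Real.exp_pos _).le (by norm_num)
      _ = 1 / 2 := mul_one _
  have hset : {x : ℝ | |x| < s} = Set.Ioo (-s) s := by
    ext x; simp [abs_lt]
  calc _ ≤ ∫⁻ _ in {x : ℝ | |x| < s}, ENNReal.ofReal (1 / 2) := lintegral_mono fun x => hpdf x
    _ = ENNReal.ofReal (1 / 2) * ENNReal.ofReal (s - -s) := by
        rw [setLIntegral_const, hset, Real.volume_Ioo]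
    _ = ENNReal.ofReal s := by
        rw [← ENNReal.ofReal_mul (by norm_num)]; congr 1; ring

/-- Rotation invariance of the Gaussian vector: the functional `⟨v, ·⟩` has a centred Gaussian law
with variance `‖v‖²`. -/
lemma map_inner_pi_gaussian {v : EuclideanSpace ℝ (Fin d)} (hv : ‖v‖ = 1) :
    (Measure.pi fun _ : Fin d => gaussianReal 0 1).map
      (fun z => inner ℝ v (WithLp.toLp 2 z)) = gaussianReal 0 1 := by
  have h := IsGaussian.map_eq_gaussianReal (μ := stdGaussian (EuclideanSpace ℝ (Fin d)))
    (innerSL ℝ v)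
  rw [integral_strongDual_stdGaussian, variance_dual_stdGaussian, innerSL_apply_norm, hv,
    ← map_pi_eq_stdGaussian, Measure.map_map (by fun_prop) (by fun_prop)] at h
  simpa [Function.comp_def] using h

lemma pi_gaussian_abs_inner_lt_le {v : EuclideanSpace ℝ (Fin d)} (hv : ‖v‖ = 1) (s : ℝ) :
    (Measure.pi fun _ : Fin d => gaussianReal 0 1) {z | |inner ℝ v (WithLp.toLp 2 z)| < s} ≤
      ENNReal.ofReal s := by
  refine le_trans ?_ (gaussianReal_abs_lt_le s)
  conv_rhs => rw [← map_inner_pi_gaussian hv]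
  rw [Measure.map_apply (by fun_prop)]
  · rfl
  · exact measurableSet_lt (by fun_prop) measurable_const

/-- Markov's inequality for `‖z‖²`, whose mean is `d`. Such a crude tail suffices because only the
logarithm of `d/δ` enters the number of iterations. -/
lemma pi_gaussian_norm_sq_gt_le {s : ℝ} (hs : 0 < s) :
    (Measure.pi fun _ : Fin d => gaussianReal 0 1) {z | s < ‖WithLp.toLp 2 z‖ ^ 2} ≤
      ENNReal.ofReal (d / s) := by
  set γ := Measure.pi fun _ : Fin d => gaussianReal 0 1
  have hmem : MemLp (fun x : ℝ => x) 2 (gaussianReal 0 1) := memLp_id_gaussianReal' 2 (by simp)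
  have hi : ∀ i : Fin d, Integrable (fun z : Fin d → ℝ => z i ^ 2) γ := fun i =>
    integrable_comp_eval (μ := fun _ : Fin d => gaussianReal 0 1) (f := fun x : ℝ => x ^ 2)
      hmem.integrable_sq
  have hval : ∀ i : Fin d, ∫ z, z i ^ 2 ∂γ = 1 := fun i => by
    rw [integral_comp_eval (μ := fun _ : Fin d => gaussianReal 0 1) (f := fun x : ℝ => x ^ 2)
      hmem.integrable_sq.aestronglyMeasurable]
    have := variance_fun_id_gaussianReal (μ := 0) (v := 1)
    rw [variance_eq_integral measurable_id'.aemeasurable] at this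
    simpa using this
  have hint : ∫ z, ‖WithLp.toLp 2 z‖ ^ 2 ∂γ = d := by
    simp_rw [norm_toLp_sq]
    rw [integral_finsetSum _ fun i _ => hi i]
    simp [hval]
  have hI : Integrable (fun z : Fin d → ℝ => ‖WithLp.toLp 2 z‖ ^ 2) γ := by
    simp_rw [norm_toLp_sq]
    exact integrable_finsetSum _ fun i _ => hi i
  have hM := mul_meas_ge_le_integral_of_nonneg (Filter.Eventually.of_forall fun z => sq_nonneg _) hI s
  rw [hint] at hM
  have : γ.real {z | s ≤ ‖WithLp.toLp 2 z‖ ^ 2} ≤ d / s := by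
    rw [le_div_iff₀ hs, mul_comm]; exact hM
  calc γ {z | s < ‖WithLp.toLp 2 z‖ ^ 2} ≤ γ {z | s ≤ ‖WithLp.toLp 2 z‖ ^ 2} :=
        measure_mono (Set.ofPred_subset_ofPred.2 fun z hz => le_of_lt hz)
    _ = ENNReal.ofReal (γ.real {z | s ≤ ‖WithLp.toLp 2 z‖ ^ 2}) := by
        rw [Measure.real, ENNReal.ofReal_toReal (measure_ne_top _ _)]
    _ ≤ _ := ENNReal.ofReal_le_ofReal this

end Gaussian

/-! ### The accuracy of the estimate -/

section Accuracy

variable {m d r : ℕ}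

lemma rowMeasure_singleton (A : Matrix (Fin m) (Fin d) ℝ) (t : Fin m) :
    rowMeasure A {t} = ENNReal.ofReal (rowProb A t) := by
  rw [rowMeasure, Measure.finsetSum_apply, Finset.sum_eq_single t]
  · simp
  · intro i _ hi
    simp [hi]
  · simp

lemma isProbabilityMeasure_rowMeasure {A : Matrix (Fin m) (Fin d) ℝ} (hA : A ≠ 0) :
    IsProbabilityMeasure (rowMeasure A) := by
  constructor
  rw [← Finset.coe_univ, ← sum_measure_singleton]
  simp_rw [rowMeasure_singleton]
  rw [← ENNReal.ofReal_sum_of_nonneg fun i _ => rowProb_nonneg A i, sum_rowProb hA,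
    ENNReal.ofReal_one]

lemma pi_rowMeasure_apply {A : Matrix (Fin m) (Fin d) ℝ} (hA : A ≠ 0)
    (S : Set (Fin r → Fin m)) [DecidablePred (· ∈ S)] :
    (Measure.pi fun _ : Fin r => rowMeasure A) S =
      ENNReal.ofReal (∑ t, if t ∈ S then sampleWeight A t else 0) := by
  have := isProbabilityMeasure_rowMeasure hA
  have hS : S = ((Finset.univ.filter (· ∈ S) : Finset (Fin r → Fin m)) : Set _) := by ext; simp
  conv_lhs => rw [hS]
  rw [← sum_measure_singleton, ← Finset.sum_filter,
    ENNReal.ofReal_sum_of_nonneg fun t _ => sampleWeight_nonneg A t]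
  refine Finset.sum_congr rfl fun t _ => ?_
  rw [Measure.pi_singleton, sampleWeight,
    ENNReal.ofReal_prod_of_nonneg fun j _ => rowProb_nonneg A _]
  simp_rw [rowMeasure_singleton]

/-- The initial correlation `q` is polynomial in `δ/d`, so taking its `(n+1)`-st root with `n` of
order `log (d/δ)` costs only a constant factor. -/
lemma powerEstimate_ge {B : Matrix (Fin r) (Fin d) ℝ} (hB : 0 < ‖B‖)
    {v : EuclideanSpace ℝ (Fin d)} (hv : ‖v‖ = 1)
    (hev : Matrix.toEuclideanLin (Bᵀ * B) v = ‖B‖ ^ 2 • v) {z : Fin d → ℝ} {δ : ℝ}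
    (hδ : 0 < δ) (hδ1 : δ < 1) (hvz : δ / 2 ≤ |inner ℝ v (WithLp.toLp 2 z)|)
    (hz : ‖WithLp.toLp 2 z‖ ^ 2 ≤ 2 * d / δ) {n : ℕ} (hn : 6 * Real.log (d / δ) ≤ n) :
    1 / Real.sqrt 5 * ‖B‖ ^ 2 ≤ powerEstimate B z n := by
  have hvz0 : inner ℝ v (WithLp.toLp 2 z) ≠ 0 := fun h => by
    rw [h, abs_zero] at hvz; linarith
  have hz0 : 0 < ‖WithLp.toLp 2 z‖ := norm_pos_iff.2 fun h => hvz0 (by rw [h]; simp)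
  have hmain := pow_mul_abs_inner_le_powerEstimate_pow hB hv hev hvz0 n
  set q := |inner ℝ v (WithLp.toLp 2 z)| / ‖WithLp.toLp 2 z‖ with hq
  have hq0 : 0 ≤ q := by positivity
  have h5 : 0 < 1 / Real.sqrt 5 := by positivity
  have h51 : 1 / Real.sqrt 5 ≤ 1 := by
    rw [div_le_one (by positivity), Real.one_le_sqrt]; norm_num
  have hqlow : (1 / Real.sqrt 5) ^ (n + 1) ≤ q := by
    -- Dimension one is separate: there `q = 1`, whereas the general estimate of `q` by a power of
    -- `δ/D` uses `D ≥ 2`.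
    rcases d with _ | _ | d
    · have : WithLp.toLp 2 z = 0 := by ext i; exact i.elim0
      rw [this, norm_zero] at hz0
      exact absurd hz0 (lt_irrefl _)
    · have h1 : |inner ℝ v (WithLp.toLp 2 z)| = ‖WithLp.toLp 2 z‖ := by
        have hv' : |v 0| = 1 := by
          rw [EuclideanSpace.norm_eq] at hv
          simpa [Real.sqrt_sq_eq_abs] using hv
        rw [EuclideanSpace.norm_eq]
        simp [PiLp.inner_apply, Real.sqrt_sq_eq_abs, abs_mul, hv']
      rw [hq, h1, div_self hz0.ne']
      exact pow_le_one₀ h5.le h51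
    · set D : ℝ := ((d + 1 + 1 : ℕ) : ℝ) with hD
      have hD2 : 2 ≤ D := by rw [hD]; push_cast; linarith [Nat.cast_nonneg (α := ℝ) d]
      -- The two events give `q² ≥ δ³ / (8D)`, which is at least `(δ/D)⁶` because `8δ³ ≤ 8 < 2⁵ ≤
      -- D⁵`.
      have hq2 : (δ / D) ^ 3 ≤ q := by
        refine le_of_sq_le_sq ?_ hq0
        have h1 : (δ / 2) ^ 2 / (2 * D / δ) ≤ q ^ 2 := by
          rw [hq, div_pow |inner ℝ v (WithLp.toLp 2 z)|]
          exact div_le_div₀ (by positivity) (pow_le_pow_left₀ (by positivity) hvz 2)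
            (by positivity) hz
        refine le_trans ?_ h1
        have hδ3 : δ ^ 3 ≤ 1 := pow_le_one₀ hδ.le hδ1.le
        have hD5 : (2 : ℝ) ^ 5 ≤ D ^ 5 := pow_le_pow_left₀ (by norm_num) hD2 5
        have h2 : (δ / 2) ^ 2 / (2 * D / δ) = δ ^ 3 / (8 * D) := by field_simp; norm_num
        rw [h2, ← pow_mul, div_pow, div_le_div_iff₀ (by positivity) (by positivity)]
        have h3 : 8 * δ ^ 3 ≤ D ^ 5 := by linarith
        calc δ ^ (3 * 2) * (8 * D) = (8 * δ ^ 3) * (δ ^ 3 * D) := by ring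
          _ ≤ D ^ 5 * (δ ^ 3 * D) := by gcongr
          _ = _ := by ring
      have hlog : (δ / D) ^ 3 = Real.exp (-(3 * Real.log (D / δ))) := by
        rw [← Nat.cast_ofNat (R := ℝ), ← mul_neg, Real.exp_nat_mul, Real.exp_neg,
          Real.exp_log (by positivity), inv_div]
      -- With `e ≤ 5` each iteration gains at least a factor `exp (1/2)`, so the constant `6` in the
      -- bound on `n` is twice the exponent `3` of `δ/D`.
      have hexp5 : Real.exp (1 / 2) ≤ Real.sqrt 5 := by
        refine Real.le_sqrt_of_sq_le ?_
        rw [← Real.exp_nat_mul]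
        have := Real.exp_one_lt_d9
        norm_num
        linarith
      refine le_trans ?_ hq2
      rw [hlog]
      calc (1 / Real.sqrt 5) ^ (n + 1) ≤ (1 / Real.sqrt 5) ^ n :=
            pow_le_pow_of_le_one h5.le h51 n.le_succ
        _ ≤ (1 / Real.exp (1 / 2)) ^ n := by gcongr
        _ = Real.exp (-(n / 2)) := by
            rw [one_div, ← Real.exp_neg, ← Real.exp_nat_mul]; congr 1; ring
        _ ≤ _ := by gcongr; linarith
  by_contra hlt
  push Not at hlt
  have hpe : 0 ≤ powerEstimate B z n := norm_nonneg _
  have h1 : powerEstimate B z n ^ (n + 1) < (1 / Real.sqrt 5 * ‖B‖ ^ 2) ^ (n + 1) :=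
    pow_lt_pow_left₀ hlt hpe n.succ_ne_zero
  rw [mul_pow] at h1
  have h2 : (‖B‖ ^ 2) ^ (n + 1) * (1 / Real.sqrt 5) ^ (n + 1) ≤ (‖B‖ ^ 2) ^ (n + 1) * q := by
    gcongr
  linarith

/-- Accuracy of the spectral norm estimate. -/
lemma estimate_accuracy {A : Matrix (Fin m) (Fin d) ℝ} (hA : A ≠ 0) {ε δ : ℝ} (hε : 0 < ε)
    (hε2 : ε ≤ 1 / 2) (hδ : 0 < δ) (hδ1 : δ < 1) {n : ℕ}
    (hr : 4 * stableRank A / ε ^ 2 * Real.log (2 * d / δ) ≤ r)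
    (hn : 6 * Real.log (d / δ) ≤ n) :
    1 - 2 * δ ≤ (sampleMeasure A r).real
      {ω | 1 / (2 * Real.sqrt 5) * ‖A‖ ^ 2 ≤ estimate A r n ω ∧
        estimate A r n ω ≤ 3 / 2 * ‖A‖ ^ 2} := by
  classical
  have := isProbabilityMeasure_rowMeasure hA
  have hF := frobSq_pos hA
  have hA0 := norm_pos_of_ne_zero hA
  have hd : 0 < d := by
    rcases Nat.eq_zero_or_pos d with rfl | h
    · exact absurd (Matrix.ext fun i j => j.elim0) hA
    · exact h
  have hd1 : (1 : ℝ) ≤ d := by exact_mod_cast hd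
  have hdδ : 1 < 2 * d / δ := by rw [lt_div_iff₀ hδ]; linarith
  have hlog : 0 < Real.log (2 * d / δ) := Real.log_pos hdδ
  have hρ : 0 < stableRank A := by unfold stableRank; positivity
  -- `ε ≤ 1/2` gives `4/ε² ≥ 16`, which matches the rate `1/16` of both tail bounds.
  have hr16 : 16 * stableRank A * Real.log (2 * d / δ) ≤ r := by
    refine le_trans ?_ hr
    gcongr
    rw [le_div_iff₀ (by positivity)]
    have : ε ^ 2 ≤ (1 / 2) ^ 2 := pow_le_pow_left₀ hε.le hε2 2
    nlinarith
  have hr0 : 0 < r := by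
    have : (0 : ℝ) < r := lt_of_lt_of_le (by positivity) hr16
    exact_mod_cast this
  have htail : Real.exp (-(r * ‖A‖ ^ 2 / frobSq A / 16)) ≤ δ / (2 * d) := by
    have h1 : Real.log (2 * d / δ) ≤ r * ‖A‖ ^ 2 / frobSq A / 16 := by
      rw [le_div_iff₀ (by norm_num), le_div_iff₀ hF]
      have h2 : stableRank A * ‖A‖ ^ 2 = frobSq A := div_mul_cancel₀ _ (by positivity)
      have := mul_le_mul_of_nonneg_right hr16 (sq_nonneg ‖A‖)
      calc _ = 16 * stableRank A * Real.log (2 * d / δ) * ‖A‖ ^ 2 := by rw [← h2]; ring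
        _ ≤ _ := this
    calc _ ≤ Real.exp (-Real.log (2 * d / δ)) := by gcongr
      _ = δ / (2 * d) := by rw [Real.exp_neg, Real.exp_log (by positivity), inv_div]
  have hup := (sum_sampleWeight_upper_le hA hr0).trans
    (mul_le_mul_of_nonneg_left htail (Nat.cast_nonneg d))
  have hlow := (sum_sampleWeight_lower_le hA hr0).trans htail
  -- A top singular vector of each possible sample. It depends on the row indices only, so for fixed
  -- indices it is a deterministic direction for the Gaussian vector.
  choose v hv hBv hev using fun t : Fin r → Fin m => exists_top_singular hd (rowSample A t)
  set γ := Measure.pi fun _ : Fin d => gaussianReal 0 1 with hγ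
  set ν := Measure.pi fun _ : Fin r => rowMeasure A with hν
  set S₁ : Set (Fin r → Fin m) := {t | 3 / 2 * ‖A‖ ^ 2 < ‖rowSample A t‖ ^ 2}
  set S₂ : Set (Fin r → Fin m) := {t | ‖rowSample A t‖ ^ 2 < 1 / 2 * ‖A‖ ^ 2}
  set G : (Fin r → Fin m) → Set (Fin d → ℝ) := fun t =>
    {z | |inner ℝ (WithLp.toLp 2 (v t)) (WithLp.toLp 2 z)| < δ / 2} ∪
      {z | 2 * d / δ < ‖WithLp.toLp 2 z‖ ^ 2} with hG
  set bad : Set ((Fin r → Fin m) × (Fin d → ℝ)) := {ω | ω.2 ∈ G ω.1} with hbad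
  have hv1 : ∀ t, ‖(WithLp.toLp 2 (v t) : EuclideanSpace ℝ (Fin d))‖ = 1 := fun t => by
    have h := norm_toLp_sq (v t)
    rw [hv] at h
    exact (pow_eq_one_iff_of_nonneg (norm_nonneg _) two_ne_zero).1 h
  have hGm : ∀ t, MeasurableSet (G t) := fun t =>
    (measurableSet_lt (by fun_prop) measurable_const).union
      (measurableSet_lt measurable_const (by fun_prop))
  -- There are finitely many index vectors, so the choice of `v` raises no measurability question.
  have hbadm : MeasurableSet bad := by
    have : bad = ⋃ t, {t} ×ˢ G t := by
      ext ⟨t, z⟩; simp [hbad]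
    rw [this]
    exact MeasurableSet.iUnion fun t => (measurableSet_singleton t).prod (hGm t)
  -- Fubini: for each sample, the two Gaussian events contribute `δ/2` each, uniformly in the
  -- sample.
  have hbad_le : (ν.prod γ) bad ≤ ENNReal.ofReal δ := by
    rw [Measure.prod_apply hbadm]
    calc _ ≤ ∫⁻ _, ENNReal.ofReal δ ∂ν := by
          refine lintegral_mono fun t => ?_
          change γ (G t) ≤ _
          refine (measure_union_le _ _).trans ?_
          calc _ ≤ ENNReal.ofReal (δ / 2) + ENNReal.ofReal (d / (2 * d / δ)) :=
                add_le_add (pi_gaussian_abs_inner_lt_le (hv1 t) _)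
                  (pi_gaussian_norm_sq_gt_le (by positivity))
            _ = ENNReal.ofReal δ := by
                rw [← ENNReal.ofReal_add (by positivity) (by positivity)]
                congr 1; field_simp; ring
      _ = ENNReal.ofReal δ := by simp
  have hS_le : (ν.prod γ) (Prod.fst ⁻¹' (S₁ ∪ S₂)) ≤ ENNReal.ofReal δ := by
    have h1 : Prod.fst ⁻¹' (S₁ ∪ S₂) = (S₁ ∪ S₂) ×ˢ (Set.univ : Set (Fin d → ℝ)) := by
      ext; simp
    rw [h1, Measure.prod_prod, measure_univ, mul_one]
    refine (measure_union_le _ _).trans ?_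
    rw [pi_rowMeasure_apply hA, pi_rowMeasure_apply hA]
    have hδ2 : δ / (2 * d) ≤ δ / 2 := by gcongr; linarith
    have hδ3 : d * (δ / (2 * d)) = δ / 2 := by field_simp
    calc _ ≤ ENNReal.ofReal (δ / 2) + ENNReal.ofReal (δ / 2) :=
          add_le_add (ENNReal.ofReal_le_ofReal (hup.trans hδ3.le))
            (ENNReal.ofReal_le_ofReal (hlow.trans hδ2))
      _ = _ := by rw [← ENNReal.ofReal_add (by positivity) (by positivity)]; congr 1; ring
  set good := {ω | 1 / (2 * Real.sqrt 5) * ‖A‖ ^ 2 ≤ estimate A r n ω ∧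
        estimate A r n ω ≤ 3 / 2 * ‖A‖ ^ 2} with hgood
  have hcover : (Set.univ : Set ((Fin r → Fin m) × (Fin d → ℝ))) ⊆
      good ∪ (bad ∪ Prod.fst ⁻¹' (S₁ ∪ S₂)) := by
    rintro ⟨t, z⟩ -
    by_contra hcon
    simp only [Set.mem_union, not_or, Set.mem_preimage, hbad, hG, Set.mem_ofPred_eq, S₁, S₂,
      not_lt] at hcon
    obtain ⟨hng, ⟨h1, h2⟩, h3, h4⟩ := hcon
    refine hng ⟨?_, (powerEstimate_le _ _ _).trans h3⟩
    have hB : 0 < ‖rowSample A t‖ := by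
      have : 0 < ‖rowSample A t‖ ^ 2 := lt_of_lt_of_le (by positivity) h4
      exact (norm_nonneg _).lt_of_ne fun h => by rw [← h] at this; simp at this
    have hev' : Matrix.toEuclideanLin ((rowSample A t)ᵀ * rowSample A t) (WithLp.toLp 2 (v t)) =
        ‖rowSample A t‖ ^ 2 • WithLp.toLp 2 (v t) := by
      rw [Matrix.toLpLin_apply]
      exact congrArg (WithLp.toLp 2) (hev t)
    refine le_trans ?_ (powerEstimate_ge hB (hv1 t) hev' hδ hδ1 h1 h2 hn)
    -- The factor `1/√5` is lost by the power method, the factor `1/2` by sampling.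
    calc _ = 1 / Real.sqrt 5 * (1 / 2 * ‖A‖ ^ 2) := by field_simp
      _ ≤ _ := by gcongr
  have hone : (1 : ENNReal) ≤ (ν.prod γ) good + ENNReal.ofReal (2 * δ) := by
    calc (1 : ENNReal) = (ν.prod γ) Set.univ := measure_univ.symm
      _ ≤ _ := measure_mono hcover
      _ ≤ (ν.prod γ) good + ((ν.prod γ) bad + (ν.prod γ) (Prod.fst ⁻¹' (S₁ ∪ S₂))) :=
          (measure_union_le _ _).trans (by gcongr; exact measure_union_le _ _)
      _ ≤ (ν.prod γ) good + (ENNReal.ofReal δ + ENNReal.ofReal δ) := by gcongr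
      _ = _ := by rw [← ENNReal.ofReal_add hδ.le hδ.le]; congr 2; ring
  have hreal := ENNReal.toReal_mono (by finiteness) hone
  rw [ENNReal.toReal_add (measure_ne_top _ _) ENNReal.ofReal_ne_top,
    ENNReal.toReal_ofReal (by positivity), ENNReal.toReal_one] at hreal
  change 1 - 2 * δ ≤ ((ν.prod γ) good).toReal
  linarith

end Accuracy

/-! ### Reasoning about programs -/

section Machine

variable {ω : Tape} {s : State}

@[simp] lemma State.tick_N (k : ℕ) : (s.tick k).N = s.N := rfl
@[simp] lemma State.tick_R (k : ℕ) : (s.tick k).R = s.R := rfl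
@[simp] lemma State.tick_gpos (k : ℕ) : (s.tick k).gpos = s.gpos := rfl
@[simp] lemma State.tick_upos (k : ℕ) : (s.tick k).upos = s.upos := rfl
@[simp] lemma State.tick_time (k : ℕ) : (s.tick k).time = s.time + k := rfl
@[simp] lemma State.writeN_N (a i v b j : ℕ) :
    (s.writeN a i v).N b j = if b = a ∧ j = i then v else s.N b j := rfl
@[simp] lemma State.writeN_R (a i v : ℕ) : (s.writeN a i v).R = s.R := rfl
@[simp] lemma State.writeN_gpos (a i v : ℕ) : (s.writeN a i v).gpos = s.gpos := rfl
@[simp] lemma State.writeN_upos (a i v : ℕ) : (s.writeN a i v).upos = s.upos := rfl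
@[simp] lemma State.writeN_time (a i v : ℕ) : (s.writeN a i v).time = s.time := rfl
@[simp] lemma State.writeR_R (a i j : ℕ) (v : ℝ) (b k l : ℕ) :
    (s.writeR a i j v).R b k l = if b = a ∧ k = i ∧ l = j then v else s.R b k l := rfl
@[simp] lemma State.writeR_N (a i j : ℕ) (v : ℝ) : (s.writeR a i j v).N = s.N := rfl
@[simp] lemma State.writeR_gpos (a i j : ℕ) (v : ℝ) : (s.writeR a i j v).gpos = s.gpos := rfl
@[simp] lemma State.writeR_upos (a i j : ℕ) (v : ℝ) : (s.writeR a i j v).upos = s.upos := rfl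
@[simp] lemma State.writeR_time (a i j : ℕ) (v : ℝ) : (s.writeR a i j v).time = s.time := rfl

lemma State.writeN_N_ne {a i v b : ℕ} (h : b ≠ a) : (s.writeN a i v).N b = s.N b := by
  funext j; simp [h]

lemma State.writeR_R_ne {a i j b : ℕ} {v : ℝ} (h : b ≠ a) : (s.writeR a i j v).R b = s.R b := by
  funext k l; simp [h]

/-- Induction principle for the iterations of a loop. -/
lemma Prog.run_loop_induction {a : ℕ} {e : NExp} {p : Prog} (I : ℕ → State → Prop)
    (h0 : I 0 (s.tick (1 + e.cost)))
    (hstep : ∀ k < e.eval s, ∀ s', I k s' → I (k + 1) (p.run ω ((s'.writeN a 0 k).tick 1))) :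
    I (e.eval s) ((Prog.loop a e p).run ω s) := by
  have h : ∀ n ≤ e.eval s, I n ((List.range n).foldl
      (fun s' k => p.run ω ((s'.writeN a 0 k).tick 1)) (s.tick (1 + e.cost))) := by
    intro n hn
    induction n with
    | zero => exact h0
    | succ n ih =>
      rw [List.range_succ, List.foldl_append]
      exact hstep n hn _ (ih (Nat.le_of_succ_le hn))
  exact h _ le_rfl

/-! ### Syntactic frame rules for memory and random streams. -/

/-- The integer arrays that a program may write. -/
def Prog.writesN : Prog → List ℕ
  | .skip => []
  | .setN a _ _ => [a]
  | .setR _ _ _ _ => []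
  | .normal _ _ _ => []
  | .uniform _ _ _ => []
  | .randInt a _ _ => [a]
  | .seq p q => p.writesN ++ q.writesN
  | .iteN _ _ p q => p.writesN ++ q.writesN
  | .iteR _ _ p q => p.writesN ++ q.writesN
  | .loop a _ p => a :: p.writesN

/-- The real arrays that a program may write. -/
def Prog.writesR : Prog → List ℕ
  | .skip => []
  | .setN _ _ _ => []
  | .setR a _ _ _ => [a]
  | .normal a _ _ => [a]
  | .uniform a _ _ => [a]
  | .randInt _ _ _ => []
  | .seq p q => p.writesR ++ q.writesR
  | .iteN _ _ p q => p.writesR ++ q.writesR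
  | .iteR _ _ p q => p.writesR ++ q.writesR
  | .loop _ _ p => p.writesR

/-- Whether a program may draw normal variables. -/
def Prog.usesNormal : Prog → Bool
  | .normal _ _ _ => true
  | .seq p q => p.usesNormal || q.usesNormal
  | .iteN _ _ p q => p.usesNormal || q.usesNormal
  | .iteR _ _ p q => p.usesNormal || q.usesNormal
  | .loop _ _ p => p.usesNormal
  | _ => false

/-- Whether a program may draw uniform variables. -/
def Prog.usesUniform : Prog → Bool
  | .uniform _ _ _ => true
  | .randInt _ _ _ => true
  | .seq p q => p.usesUniform || q.usesUniform
  | .iteN _ _ p q => p.usesUniform || q.usesUniform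
  | .iteR _ _ p q => p.usesUniform || q.usesUniform
  | .loop _ _ p => p.usesUniform
  | _ => false

/-- A frame rule: the list of written arrays is computed from the syntax, so for concrete programs
the side condition is decidable. -/
lemma Prog.run_N_of_notMem {b : ℕ} (p : Prog) (h : b ∉ p.writesN) :
    (p.run ω s).N b = s.N b := by
  induction p generalizing s with
  | skip => rfl
  | setN a i e => exact State.writeN_N_ne (by simpa [writesN] using h)
  | setR a i j e => rfl
  | normal a i j => rfl
  | uniform a i j => rfl
  | randInt a i e => exact State.writeN_N_ne (by simpa [writesN] using h)
  | seq p q hp hq =>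
    simp only [writesN, List.mem_append, not_or] at h
    rw [run, hq h.2, hp h.1]
  | iteN x y p q hp hq =>
    simp only [writesN, List.mem_append, not_or] at h
    rw [run]
    split_ifs
    · rw [hp h.1]; rfl
    · rw [hq h.2]; rfl
  | iteR x y p q hp hq =>
    simp only [writesN, List.mem_append, not_or] at h
    rw [run]
    split_ifs
    · rw [hp h.1]; rfl
    · rw [hq h.2]; rfl
  | loop a e p hp =>
    simp only [writesN, List.mem_cons, not_or] at h
    refine run_loop_induction (fun _ s' => s'.N b = s.N b) rfl fun k _ s' hs' => ?_
    rw [hp h.2, State.tick_N, State.writeN_N_ne h.1, hs']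

lemma Prog.run_R_of_notMem {b : ℕ} (p : Prog) (h : b ∉ p.writesR) :
    (p.run ω s).R b = s.R b := by
  induction p generalizing s with
  | skip => rfl
  | setN a i e => rfl
  | setR a i j e => exact State.writeR_R_ne (by simpa [writesR] using h)
  | normal a i j => exact State.writeR_R_ne (by simpa [writesR] using h)
  | uniform a i j => exact State.writeR_R_ne (by simpa [writesR] using h)
  | randInt a i e => rfl
  | seq p q hp hq =>
    simp only [writesR, List.mem_append, not_or] at h
    rw [run, hq h.2, hp h.1]
  | iteN x y p q hp hq =>
    simp only [writesR, List.mem_append, not_or] at h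
    rw [run]
    split_ifs
    · rw [hp h.1]; rfl
    · rw [hq h.2]; rfl
  | iteR x y p q hp hq =>
    simp only [writesR, List.mem_append, not_or] at h
    rw [run]
    split_ifs
    · rw [hp h.1]; rfl
    · rw [hq h.2]; rfl
  | loop a e p hp =>
    refine run_loop_induction (fun _ s' => s'.R b = s.R b) rfl fun k _ s' hs' => ?_
    rw [hp h, State.tick_R, State.writeN_R, hs']

lemma Prog.run_gpos (p : Prog) (h : p.usesNormal = false) : (p.run ω s).gpos = s.gpos := by
  induction p generalizing s with
  | normal a i j => simp [usesNormal] at h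
  | skip | setN | setR | uniform | randInt => rfl
  | seq p q hp hq =>
    simp only [usesNormal, Bool.or_eq_false_iff] at h
    rw [run, hq h.2, hp h.1]
  | iteN x y p q hp hq =>
    simp only [usesNormal, Bool.or_eq_false_iff] at h
    rw [run]
    split_ifs
    · rw [hp h.1]; rfl
    · rw [hq h.2]; rfl
  | iteR x y p q hp hq =>
    simp only [usesNormal, Bool.or_eq_false_iff] at h
    rw [run]
    split_ifs
    · rw [hp h.1]; rfl
    · rw [hq h.2]; rfl
  | loop a e p hp =>
    refine run_loop_induction (fun _ s' => s'.gpos = s.gpos) rfl fun k _ s' hs' => ?_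
    rw [hp h, State.tick_gpos, State.writeN_gpos, hs']

lemma Prog.run_upos (p : Prog) (h : p.usesUniform = false) : (p.run ω s).upos = s.upos := by
  induction p generalizing s with
  | uniform a i j => simp [usesUniform] at h
  | randInt a i e => simp [usesUniform] at h
  | skip | setN | setR | normal => rfl
  | seq p q hp hq =>
    simp only [usesUniform, Bool.or_eq_false_iff] at h
    rw [run, hq h.2, hp h.1]
  | iteN x y p q hp hq =>
    simp only [usesUniform, Bool.or_eq_false_iff] at h
    rw [run]
    split_ifs
    · rw [hp h.1]; rfl
    · rw [hq h.2]; rfl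
  | iteR x y p q hp hq =>
    simp only [usesUniform, Bool.or_eq_false_iff] at h
    rw [run]
    split_ifs
    · rw [hp h.1]; rfl
    · rw [hq h.2]; rfl
  | loop a e p hp =>
    refine run_loop_induction (fun _ s' => s'.upos = s.upos) rfl fun k _ s' hs' => ?_
    rw [hp h, State.tick_upos, State.writeN_upos, hs']

/-! ### Step counts from the syntax. -/

/-- All loops run up to one of the input sizes. -/
def Prog.SizeLoops : Prog → Prop
  | .seq p q => p.SizeLoops ∧ q.SizeLoops
  | .iteN _ _ p q => p.SizeLoops ∧ q.SizeLoops
  | .iteR _ _ p q => p.SizeLoops ∧ q.SizeLoops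
  | .loop _ e p => (∃ k, e = .get 0 (.lit k)) ∧ p.SizeLoops
  | _ => True

/-- The step count of a program, in terms of the input sizes. -/
def Prog.bound (v : ℕ → ℕ) : Prog → ℕ
  | .skip => 1
  | .setN _ i e => 1 + i.cost + e.cost
  | .setR _ i j e => 1 + i.cost + j.cost + e.cost
  | .normal _ i j => 1 + i.cost + j.cost
  | .uniform _ i j => 1 + i.cost + j.cost
  | .randInt _ i e => 1 + i.cost + e.cost
  | .seq p q => p.bound v + q.bound v
  | .iteN x y p q => 1 + x.cost + y.cost + (p.bound v + q.bound v)
  | .iteR x y p q => 1 + x.cost + y.cost + (p.bound v + q.bound v)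
  -- The loop limit is evaluated in a dummy state whose integer arrays all equal `v`; under
  -- `SizeLoops` only array `0` is read.
  | .loop _ e p => 1 + e.cost + e.eval ⟨fun _ => v, fun _ _ _ => 0, 0, 0, 0⟩ * (1 + p.bound v)

/-- Array `0` is never written, so every loop limit keeps its input value. Both branches of a
conditional are charged, which makes the bound independent of the random streams. -/
lemma Prog.run_time_le (p : Prog) (h : p.SizeLoops) (h0 : 0 ∉ p.writesN) :
    (p.run ω s).time ≤ s.time + p.bound (s.N 0) := by
  induction p generalizing s with
  | skip | setN | setR | normal | uniform | randInt => exact le_of_eq rfl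
  | seq p q hp hq =>
    simp only [writesN, List.mem_append, not_or] at h0
    have h1 := hp (s := s) h.1 h0.1
    have h2 := hq (s := p.run ω s) h.2 h0.2
    rw [p.run_N_of_notMem h0.1] at h2
    rw [run, bound]; omega
  | iteN x y p q hp hq =>
    simp only [writesN, List.mem_append, not_or] at h0
    have h1 := hp (s := s.tick (1 + x.cost + y.cost)) h.1 h0.1
    have h2 := hq (s := s.tick (1 + x.cost + y.cost)) h.2 h0.2
    simp only [State.tick_N, State.tick_time] at h1 h2
    rw [run, bound]; split_ifs <;> omega
  | iteR x y p q hp hq =>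
    simp only [writesN, List.mem_append, not_or] at h0
    have h1 := hp (s := s.tick (1 + x.cost + y.cost)) h.1 h0.1
    have h2 := hq (s := s.tick (1 + x.cost + y.cost)) h.2 h0.2
    simp only [State.tick_N, State.tick_time] at h1 h2
    rw [run, bound]; split_ifs <;> omega
  | loop a e p hp =>
    simp only [writesN, List.mem_cons, not_or] at h0
    obtain ⟨⟨k, rfl⟩, hl⟩ := h
    refine (run_loop_induction (fun i s' => s'.N 0 = s.N 0 ∧ s'.time ≤ s.time +
      (1 + (NExp.get 0 (.lit k)).cost + i * (1 + p.bound (s.N 0)))) ⟨rfl, by simp⟩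
        fun i _ s' hs' => ?_).2
    have h1 := hp (s := (s'.writeN a 0 i).tick 1) hl h0.2
    rw [State.tick_N, State.writeN_N_ne h0.1, hs'.1, State.tick_time, State.writeN_time] at h1
    refine ⟨by rw [p.run_N_of_notMem h0.2, State.tick_N, State.writeN_N_ne h0.1, hs'.1], ?_⟩
    have h2 := hs'.2
    rw [Nat.add_one_mul]
    omega

/-- `R acc i j := ∑_{k < K} f`, with summation index `N v 0`. -/
def sumProg (v acc : ℕ) (i j K : NExp) (f : RExp) : Prog :=
  .seq (.setR acc i j (.ofNat (.lit 0))) (.loop v K (.setR acc i j (.add (.get acc i j) f)))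

/-- The hypotheses say that the target cell does not depend on the loop counter and that the summand
does not read the accumulator array. -/
lemma sumProg_run {v acc : ℕ} {i j K : NExp} {f : RExp} {F : ℕ → ℝ}
    (hi : ∀ s' : State, (∀ b, b ≠ v → s'.N b = s.N b) → i.eval s' = i.eval s)
    (hj : ∀ s' : State, (∀ b, b ≠ v → s'.N b = s.N b) → j.eval s' = j.eval s)
    (hK : ∀ s' : State, s'.N = s.N → K.eval s' = K.eval s)
    (hf : ∀ k < K.eval s, ∀ s' : State, (∀ b, b ≠ v → s'.N b = s.N b) → s'.N v 0 = k →
      (∀ b, b ≠ acc → s'.R b = s.R b) → f.eval s' = F k) (k l : ℕ) :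
    ((sumProg v acc i j K f).run ω s).R acc k l =
      if k = i.eval s ∧ l = j.eval s then ∑ q ∈ Finset.range (K.eval s), F q
      else s.R acc k l := by
  set s₁ := (Prog.setR acc i j (.ofNat (.lit 0))).run ω s with hs₁
  have hK₁ : K.eval s₁ = K.eval s := hK _ rfl
  have h := Prog.run_loop_induction (ω := ω) (s := s₁) (a := v) (e := K)
    (p := .setR acc i j (.add (.get acc i j) f))
    (fun q s' => (∀ b, b ≠ v → s'.N b = s.N b) ∧ (∀ b, b ≠ acc → s'.R b = s.R b) ∧
      ∀ k l, s'.R acc k l = if k = i.eval s ∧ l = j.eval s then ∑ p ∈ Finset.range q, F p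
        else s.R acc k l) ?_ ?_
  · rw [hK₁] at h
    exact h.2.2 k l
  · refine ⟨fun b _ => rfl, fun b hb => State.writeR_R_ne hb, fun k l => ?_⟩
    simp [hs₁, Prog.run, RExp.eval, NExp.eval]
  · rintro q hq s' ⟨hN, hR, hacc⟩
    rw [hK₁] at hq
    set t := (s'.writeN v 0 q).tick 1 with ht
    have htN : ∀ b, b ≠ v → t.N b = s.N b := fun b hb => by
      rw [ht, State.tick_N, State.writeN_N_ne hb, hN b hb]
    have hti := hi t htN
    have htj := hj t htN
    have htf := hf q hq t htN (by simp [ht]) hR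
    refine ⟨htN, fun b hb => (State.writeR_R_ne hb).trans (hR b hb), fun k l => ?_⟩
    simp only [Prog.run, State.tick_R, State.writeR_R, hti, htj, RExp.eval, htf, true_and]
    have htR : t.R = s'.R := rfl
    rw [htR, hacc, hacc]
    by_cases h1 : k = i.eval s ∧ l = j.eval s
    · simp [h1, Finset.sum_range_succ]
    · simp [h1]

/-- `R b k j := f` for `k < K`, with index `k = N v 0`. -/
def mapProg (v b : ℕ) (j K : NExp) (f : RExp) : Prog :=
  .loop v K (.setR b (.get v (.lit 0)) j f)

/-- The expression may read row `k` of the target array, which is still unchanged when step `k`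
begins. This permits scaling a vector in place. -/
lemma mapProg_run {v b : ℕ} {j K : NExp} {f : RExp} {F : ℕ → ℝ}
    (hj : ∀ s' : State, (∀ b, b ≠ v → s'.N b = s.N b) → j.eval s' = j.eval s)
    (hf : ∀ k < K.eval s, ∀ s' : State, (∀ c, c ≠ v → s'.N c = s.N c) → s'.N v 0 = k →
      (∀ c, c ≠ b → s'.R c = s.R c) → (∀ l, s'.R b k l = s.R b k l) → f.eval s' = F k) (k l : ℕ) :
    ((mapProg v b j K f).run ω s).R b k l =
      if k < K.eval s ∧ l = j.eval s then F k else s.R b k l := by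
  refine (Prog.run_loop_induction (ω := ω) (s := s)
    (fun q s' => (∀ c, c ≠ v → s'.N c = s.N c) ∧ (∀ c, c ≠ b → s'.R c = s.R c) ∧
      ∀ k l, s'.R b k l = if k < q ∧ l = j.eval s then F k else s.R b k l) ?_ ?_).2.2 k l
  · exact ⟨fun _ _ => rfl, fun _ _ => rfl, fun k => by simp⟩
  · rintro q hq s' ⟨hN, hR, hb⟩
    set t := (s'.writeN v 0 q).tick 1 with ht
    have htN : ∀ c, c ≠ v → t.N c = s.N c := fun c hc => by
      rw [ht, State.tick_N, State.writeN_N_ne hc, hN c hc]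
    have htv : t.N v 0 = q := by simp [ht]
    have htR : t.R = s'.R := rfl
    have htj := hj t htN
    have htf := hf q hq t htN htv hR (fun l => by rw [htR, hb, if_neg (by simp)])
    refine ⟨htN, fun c hc => (State.writeR_R_ne hc).trans (hR c hc), fun k l => ?_⟩
    simp only [Prog.run, State.tick_R, State.writeR_R, htf, true_and, NExp.eval, htv, htj]
    rw [htR, hb]
    rcases lt_trichotomy k q with h | h | h
    · simp [h.ne, h, h.trans (Nat.lt_succ_self q)]
    · simp [h]
    · simp [h.ne', h.not_gt, show ¬ k < q + 1 by omega]

end Machine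

/-! ### The alias method -/

section Alias

/-- Invariant of the partition of `i` items with weights `w` into light ones, in positions below
`lo`, and heavy ones, in positions from `hi` on; `P p` is the item in position `p` and `W p` its
weight. -/
structure PartInv (m : ℕ) (w : ℕ → ℝ) (i lo hi : ℕ) (P : ℕ → ℕ) (W : ℕ → ℝ) : Prop where
  count : lo + m = hi + i
  hi_le : hi ≤ m
  small : ∀ p < lo, 0 ≤ W p ∧ W p ≤ 1
  large : ∀ p < m, hi ≤ p → 1 ≤ W p
  -- Testing against all `g` expresses equality of the weighted point masses, without having to
  -- record that `P` is injective.
  mass : ∀ g : ℕ → ℝ, ∑ p ∈ Finset.range lo, W p * g (P p) + ∑ p ∈ Finset.Ico hi m, W p * g (P p) =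
    ∑ q ∈ Finset.range i, w q * g q

variable {m i lo hi a k : ℕ} {w W W' W₀ : ℕ → ℝ} {P P' al al' : ℕ → ℕ}

lemma PartInv.step_small (h : PartInv m w i lo hi P W) (hi' : i < m) (hw : 0 ≤ w i)
    (hw1 : w i ≤ 1) (hP : ∀ p, P' p = if p = lo then i else P p)
    (hW : ∀ p, W' p = if p = lo then w i else W p) : PartInv m w (i + 1) (lo + 1) hi P' W' := by
  have hlt : lo < hi := by have := h.count; omega
  refine ⟨by have := h.count; omega, h.hi_le, fun p hp => ?_, fun p hp hp' => ?_, fun g => ?_⟩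
  · rw [hW]
    split_ifs with h1
    · exact ⟨hw, hw1⟩
    · exact h.small p (by omega)
  · rw [hW, if_neg (by omega)]
    exact h.large p hp hp'
  · rw [Finset.sum_range_succ, Finset.sum_range_succ, ← h.mass g, hW lo, hP lo, if_pos rfl,
      if_pos rfl]
    have h1 : ∑ p ∈ Finset.range lo, W' p * g (P' p) = ∑ p ∈ Finset.range lo, W p * g (P p) :=
      Finset.sum_congr rfl fun p hp => by
        have := Finset.mem_range.1 hp
        rw [hW, hP, if_neg this.ne, if_neg this.ne]
    have h2 : ∑ p ∈ Finset.Ico hi m, W' p * g (P' p) = ∑ p ∈ Finset.Ico hi m, W p * g (P p) :=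
      Finset.sum_congr rfl fun p hp => by
        have := Finset.mem_Ico.1 hp
        rw [hW, hP, if_neg (by omega), if_neg (by omega)]
    rw [h1, h2]
    ring

lemma PartInv.step_large (h : PartInv m w i lo hi P W) (hi' : i < m)
    (hw1 : 1 ≤ w i) (hP : ∀ p, P' p = if p = hi - 1 then i else P p)
    (hW : ∀ p, W' p = if p = hi - 1 then w i else W p) :
    PartInv m w (i + 1) lo (hi - 1) P' W' := by
  -- While items remain there is a free position between the two groups, so the truncated `hi - 1`
  -- is a genuine predecessor.
  have hlt : lo < hi := by have := h.count; omega
  have hle := h.hi_le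
  refine ⟨by have := h.count; omega, by omega, fun p hp => ?_, fun p hp hp' => ?_, fun g => ?_⟩
  · rw [hW, if_neg (by omega)]
    exact h.small p hp
  · rw [hW]
    split_ifs with h1
    · exact hw1
    · exact h.large p hp (by omega)
  · have h0 : Finset.Ico (hi - 1) m = insert (hi - 1) (Finset.Ico hi m) := by
      ext p; simp only [Finset.mem_Ico, Finset.mem_insert]; omega
    rw [h0, Finset.sum_insert (by simp; omega), Finset.sum_range_succ, ← h.mass g, hW (hi - 1),
      hP (hi - 1), if_pos rfl, if_pos rfl]
    have h1 : ∑ p ∈ Finset.range lo, W' p * g (P' p) = ∑ p ∈ Finset.range lo, W p * g (P p) :=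
      Finset.sum_congr rfl fun p hp => by
        have := Finset.mem_range.1 hp
        rw [hW, hP, if_neg (by omega), if_neg (by omega)]
    have h2 : ∑ p ∈ Finset.Ico hi m, W' p * g (P' p) = ∑ p ∈ Finset.Ico hi m, W p * g (P p) :=
      Finset.sum_congr rfl fun p hp => by
        have := Finset.mem_Ico.1 hp
        rw [hW, hP, if_neg (by omega), if_neg (by omega)]
    rw [h1, h2]
    ring

/-- Invariant of the construction of the alias table: the buckets below `k` are final, positions in
`[k, a)` are light and those from `a` on are heavy. -/
structure SweepInv (m : ℕ) (W₀ : ℕ → ℝ) (k a : ℕ) (al : ℕ → ℕ) (W : ℕ → ℝ) : Prop where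
  le : k ≤ a
  nonneg : ∀ p < m, 0 ≤ W p
  le_one : ∀ p < m, p < a → W p ≤ 1
  one_le : ∀ p < m, a ≤ p → 1 ≤ W p
  -- A finished bucket keeps the share `W p` for itself and gives `1 - W p` to its alias; an
  -- unfinished position carries its current weight. The combined measure never changes.
  mass : ∀ f : ℕ → ℝ, ∑ p ∈ Finset.range k, (W p * f p + (1 - W p) * f (al p)) +
    ∑ p ∈ Finset.Ico k m, W p * f p = ∑ p ∈ Finset.range m, W₀ p * f p

lemma PartInv.sweepInv (h : PartInv m w m lo hi P W) : SweepInv m W 0 lo al W := by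
  have hlo : lo = hi := by have := h.count; omega
  subst hlo
  refine ⟨Nat.zero_le _, fun p hp => ?_, fun p _ hp => (h.small p hp).2, h.large, fun f => by simp⟩
  rcases lt_or_ge p lo with h1 | h1
  · exact (h.small p h1).1
  · exact zero_le_one.trans (h.large p hp h1)

lemma PartInv.sum_mul (h : PartInv m w m lo hi P W) (g : ℕ → ℝ) :
    ∑ p ∈ Finset.range m, W p * g (P p) = ∑ q ∈ Finset.range m, w q * g q := by
  have hlo : lo = hi := by have := h.count; omega
  subst hlo
  rw [← h.mass g, Finset.sum_range_add_sum_Ico _ h.hi_le]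

/-- Each finished bucket has total share one, so the remaining weights have mean one. If the
remaining positions are all heavy or all light, the deviations from one share a sign and sum to
zero, hence vanish. -/
lemma SweepInv.eq_one_or (h : SweepInv m W₀ k a al W) (hk : k < m)
    (hsum : ∑ p ∈ Finset.range m, W₀ p = m) : W k = 1 ∨ (k < a ∧ a < m) := by
  by_contra! hcon
  obtain ⟨h1, h2⟩ := hcon
  have hIco : ∑ p ∈ Finset.Ico k m, (W p - 1) = 0 := by
    have := h.mass fun _ => 1
    simp only [mul_one, hsum, add_sub_cancel, Finset.sum_const, Finset.card_range, nsmul_eq_mul]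
      at this
    rw [Finset.sum_sub_distrib, Finset.sum_const, Nat.card_Ico, nsmul_eq_mul, Nat.cast_sub hk.le]
    linarith
  have hmem : k ∈ Finset.Ico k m := Finset.mem_Ico.2 ⟨le_rfl, hk⟩
  rcases h.le.eq_or_lt with hka | hka
  · have := (Finset.sum_eq_zero_iff_of_nonneg fun p hp => ?_).1 hIco k hmem
    · exact h1 (by linarith)
    · have := Finset.mem_Ico.1 hp
      linarith [h.one_le p this.2 (hka ▸ this.1)]
  · have := (Finset.sum_eq_zero_iff_of_nonpos fun p hp => ?_).1 hIco k hmem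
    · exact h1 (by linarith)
    · have := Finset.mem_Ico.1 hp
      linarith [h.le_one p this.2 (by have := h2 hka; omega)]

/-- Bucket `k` is topped up from the first heavy position `a`. Since `W a ≥ 1`, the rest stays
nonnegative; once it is at most one, `a` joins the light block `[k, a)` and is reached later by the
same sweep, so no stack is needed. If no such donor exists then `W k = 1`, and the write changes
nothing, even when `a = k` or `a ≥ m`. -/
lemma SweepInv.step (h : SweepInv m W₀ k a al W) (hk : k < m)
    (hsum : ∑ p ∈ Finset.range m, W₀ p = m) (hal : ∀ p, al' p = if p = k then a else al p)
    (hW : ∀ p, W' p = if p = a then W a - (1 - W k) else W p) {a' : ℕ}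
    (ha' : a' = if W' a ≤ 1 then a + 1 else a) : SweepInv m W₀ (k + 1) a' al' W' := by
  have halk : al' k = a := by rw [hal, if_pos rfl]
  have hk1 := h.le
  have hals : ∀ p ∈ Finset.range k, al' p = al p := fun p hp => by
    have := Finset.mem_range.1 hp
    rw [hal, if_neg (by omega)]
  rcases h.eq_one_or hk hsum with h1 | ⟨hka, ham⟩
  · have hWW : W' = W := by
      funext p
      rw [hW, h1]
      split_ifs with hp
      · rw [hp]; ring
      · rfl
    subst hWW
    refine ⟨?_, h.nonneg, fun p hp hpa => ?_, fun p hp hpa => ?_, fun f => ?_⟩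
    · rw [ha']
      split_ifs with h2
      · omega
      -- If `a = k`, then `W k = 1` forces `a` to advance, which keeps it ahead of the finished
      -- buckets.
      · rcases hk1.eq_or_lt with h3 | h3
        · rw [← h3, h1] at h2; exact absurd le_rfl h2
        · exact h3
    · rw [ha'] at hpa
      split_ifs at hpa with h2
      · rcases Nat.lt_succ_iff_lt_or_eq.1 hpa with h3 | h3
        · exact h.le_one p hp h3
        · rw [h3]; exact h2
      · exact h.le_one p hp hpa
    · refine h.one_le p hp (le_trans ?_ hpa)
      rw [ha']; split_ifs <;> omega
    · rw [← h.mass f, Finset.sum_range_succ, h1, ← Finset.sum_Ioo_add_eq_sum_Ico hk, h1]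
      have : Finset.Ico (k + 1) m = Finset.Ioo k m := by ext; simp
      rw [this, Finset.sum_congr rfl fun p hp => by rw [hals p hp]]
      ring
  · have hWa : W' a = W a - (1 - W k) := by rw [hW, if_pos rfl]
    have hWne : ∀ p, p ≠ a → W' p = W p := fun p hp => by rw [hW, if_neg hp]
    have hge := h.one_le a ham le_rfl
    have hWk := h.nonneg k hk
    refine ⟨by rw [ha']; split_ifs <;> omega, fun p hp => ?_, fun p hp hpa => ?_, fun p hp hpa => ?_,
      fun f => ?_⟩
    · by_cases hpa : p = a
      · rw [hpa, hWa]; linarith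
      · rw [hWne p hpa]; exact h.nonneg p hp
    · rw [ha'] at hpa
      split_ifs at hpa with h2
      · rcases Nat.lt_succ_iff_lt_or_eq.1 hpa with h3 | h3
        · rw [hWne p h3.ne]; exact h.le_one p hp h3
        · rw [h3]; exact h2
      · rw [hWne p hpa.ne]; exact h.le_one p hp hpa
    · rw [ha'] at hpa
      split_ifs at hpa with h2
      · rw [hWne p (by omega)]; exact h.one_le p hp (by omega)
      · by_cases h3 : p = a
        · rw [h3]; exact (not_le.1 h2).le
        · rw [hWne p h3]; exact h.one_le p hp hpa
    · have h0 : Finset.Ico (k + 1) m = Finset.Ioo k m := by ext; simp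
      have h1 : ∑ p ∈ Finset.range k, (W' p * f p + (1 - W' p) * f (al' p)) =
          ∑ p ∈ Finset.range k, (W p * f p + (1 - W p) * f (al p)) :=
        Finset.sum_congr rfl fun p hp => by
          have := Finset.mem_range.1 hp
          rw [hals p hp, hWne p (by omega)]
      have hmem : a ∈ Finset.Ioo k m := Finset.mem_Ioo.2 ⟨hka, ham⟩
      have h2 : ∑ p ∈ Finset.Ioo k m, W' p * f p =
          ∑ p ∈ Finset.Ioo k m, W p * f p - (1 - W k) * f a := by
        rw [← Finset.add_sum_erase _ _ hmem, ← Finset.add_sum_erase _ (fun p => W p * f p) hmem,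
          hWa, Finset.sum_congr rfl fun p hp => by rw [hWne p (Finset.ne_of_mem_erase hp)]]
        ring
      rw [← h.mass f, Finset.sum_range_succ, h1, h0, h2, ← Finset.sum_Ioo_add_eq_sum_Ico hk, halk,
        hWne k hka.ne]
      ring

/-- The item drawn from an alias table with bucket `k` and threshold variable `u`. -/
def aliasPick (P al : ℕ → ℕ) (W : ℕ → ℝ) (k : ℕ) (u : ℝ) : ℕ :=
  open Classical in if u ≤ W k then P k else P (al k)

/-- An alias table for the weights `w`, which have mean one. -/
structure AliasTable (m : ℕ) (w : ℕ → ℝ) (P al : ℕ → ℕ) (W : ℕ → ℝ) : Prop where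
  mem_Icc : ∀ p < m, 0 ≤ W p ∧ W p ≤ 1
  mass : ∀ g : ℕ → ℝ, ∑ p ∈ Finset.range m, (W p * g (P p) + (1 - W p) * g (P (al p))) =
    ∑ q ∈ Finset.range m, w q * g q

lemma SweepInv.aliasTable (h : SweepInv m W₀ m a al W)
    (h₀ : ∀ g : ℕ → ℝ, ∑ p ∈ Finset.range m, W₀ p * g (P p) = ∑ q ∈ Finset.range m, w q * g q) :
    AliasTable m w P al W := by
  refine ⟨fun p hp => ⟨h.nonneg p hp, h.le_one p hp (hp.trans_le h.le)⟩, fun g => ?_⟩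
  rw [← h₀ g]
  simpa using h.mass fun p => g (P p)

end Alias

/-! ### The program -/

section Program

/-- The content of the cell `N a 0`. -/
abbrev NExp.var (a : ℕ) : NExp := .get a (.lit 0)

/-- `R acc k 0 := ∑_{q < K₂} f` for `k < K₁`, with `k = N 1 0` and `q = N 2 0`. -/
def rowSumProg (acc c₁ c₂ : ℕ) (f : RExp) : Prog :=
  .loop 1 (.get 0 (.lit c₁)) (sumProg 2 acc (.var 1) (.lit 0) (.get 0 (.lit c₂)) f)

/-- Squared row norms in `R 2`. -/
def rowNormProg : Prog :=
  rowSumProg 2 0 1 (.mul (.get 0 (.var 1) (.var 2)) (.get 0 (.var 1) (.var 2)))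

/-- Squared Frobenius norm in `R 3 0 0`. -/
def frobProg : Prog :=
  sumProg 1 3 (.lit 0) (.lit 0) (.get 0 (.lit 0)) (.get 2 (.var 1) (.lit 0))

/-- One step of the partition into light and heavy rows. -/
def partBody : Prog :=
  .seq (.setR 5 (.lit 0) (.lit 0) (.mul (.ofNat (.get 0 (.lit 0)))
      (.div (.get 2 (.var 1) (.lit 0)) (.get 3 (.lit 0) (.lit 0)))))
    (.iteR (.get 5 (.lit 0) (.lit 0)) (.ofNat (.lit 1))
      (.seq (.setN 4 (.var 6) (.var 1))
        (.seq (.setR 4 (.var 6) (.lit 0) (.get 5 (.lit 0) (.lit 0)))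
          (.setN 6 (.lit 0) (.add (.var 6) (.lit 1)))))
      (.seq (.setN 7 (.lit 0) (.sub (.var 7) (.lit 1)))
        (.seq (.setN 4 (.var 7) (.var 1))
          (.setR 4 (.var 7) (.lit 0) (.get 5 (.lit 0) (.lit 0))))))

/-- The partition into light and heavy rows. -/
def partProg : Prog :=
  .seq (.setN 6 (.lit 0) (.lit 0))
    (.seq (.setN 7 (.lit 0) (.get 0 (.lit 0))) (.loop 1 (.get 0 (.lit 0)) partBody))

/-- One step of the construction of the alias table. -/
def sweepBody : Prog :=
  .seq (.setN 5 (.var 1) (.var 6))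
    (.seq (.setR 4 (.var 6) (.lit 0) (.sub (.get 4 (.var 6) (.lit 0))
        (.sub (.ofNat (.lit 1)) (.get 4 (.var 1) (.lit 0)))))
      (.iteR (.get 4 (.var 6) (.lit 0)) (.ofNat (.lit 1))
        (.setN 6 (.lit 0) (.add (.var 6) (.lit 1))) .skip))

/-- The construction of the alias table. -/
def sweepProg : Prog := .loop 1 (.get 0 (.lit 0)) sweepBody

/-- Draw a row index into `N 9 0`. -/
def drawProg : Prog :=
  .seq (.randInt 8 (.lit 0) (.get 0 (.lit 0)))
    (.seq (.uniform 5 (.lit 0) (.lit 0))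
      (.iteR (.get 5 (.lit 0) (.lit 0)) (.get 4 (.var 8) (.lit 0))
        (.setN 9 (.lit 0) (.get 4 (.var 8)))
        (.setN 9 (.lit 0) (.get 4 (.get 5 (.var 8))))))

/-- Store the sampled row in column `N 1 0` of `R 6`. -/
def storeProg : Prog :=
  mapProg 2 6 (.var 1) (.get 0 (.lit 1)) (.div (.get 0 (.var 9) (.var 2))
    (.sqrt (.mul (.ofNat (.get 0 (.lit 2)))
      (.div (.get 2 (.var 9) (.lit 0)) (.get 3 (.lit 0) (.lit 0))))))

/-- The row sample, transposed, in `R 6`. -/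
def sampleProg : Prog := .loop 1 (.get 0 (.lit 2)) (.seq drawProg storeProg)

/-- A standard normal vector in `R 7`. -/
def normalProg : Prog := .loop 1 (.get 0 (.lit 1)) (.normal 7 (.var 1) (.lit 0))

/-- The norm of the vector `R b` in `R 1 0 0`. -/
def normProg (b : ℕ) : Prog :=
  .seq (sumProg 1 1 (.lit 0) (.lit 0) (.get 0 (.lit 1))
      (.mul (.get b (.var 1) (.lit 0)) (.get b (.var 1) (.lit 0))))
    (.setR 1 (.lit 0) (.lit 0) (.sqrt (.get 1 (.lit 0) (.lit 0))))

/-- `R 7 := R b / R 1 0 0`. -/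
def scaleProg (b : ℕ) : Prog :=
  mapProg 1 7 (.lit 0) (.get 0 (.lit 1))
    (.div (.get b (.var 1) (.lit 0)) (.get 1 (.lit 0) (.lit 0)))

/-- The product of the Gram matrix of the row sample with `R 7` in `R 9`, its norm in `R 1 0 0`. -/
def gramProg : Prog :=
  .seq (rowSumProg 8 2 1 (.mul (.get 6 (.var 2) (.var 1)) (.get 7 (.var 2) (.lit 0))))
    (.seq (rowSumProg 9 1 2 (.mul (.get 6 (.var 1) (.var 2)) (.get 8 (.var 2) (.lit 0))))
      (normProg 9))

/-- The power iteration. -/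
def powerProg : Prog := .loop 3 (.get 0 (.lit 3)) (.seq gramProg (scaleProg 9))

/-- Preparation of the row sample. -/
def tableProg : Prog := .seq rowNormProg (.seq frobProg (.seq partProg sweepProg))

/-- The randomized power method with row sampling. -/
def estimateProg : Prog :=
  .seq tableProg (.seq sampleProg (.seq normalProg (.seq (normProg 7)
    (.seq (scaleProg 7) (.seq powerProg gramProg)))))

variable {ω : Tape} {s : State}

lemma rowSumProg_run {acc c₁ c₂ : ℕ} {f : RExp} {F : ℕ → ℕ → ℝ}
    (hf : ∀ k < s.N 0 c₁, ∀ q < s.N 0 c₂, ∀ s' : State, (∀ b, b ≠ 1 → b ≠ 2 → s'.N b = s.N b) →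
      s'.N 1 0 = k → s'.N 2 0 = q → (∀ b, b ≠ acc → s'.R b = s.R b) → f.eval s' = F k q)
    {k : ℕ} (hk : k < s.N 0 c₁) :
    ((rowSumProg acc c₁ c₂ f).run ω s).R acc k 0 = ∑ q ∈ Finset.range (s.N 0 c₂), F k q := by
  refine (Prog.run_loop_induction (ω := ω) (s := s) (e := .get 0 (.lit c₁))
    (fun n s' => (∀ b, b ≠ 1 → b ≠ 2 → s'.N b = s.N b) ∧ (∀ b, b ≠ acc → s'.R b = s.R b) ∧
      ∀ k < n, s'.R acc k 0 = ∑ q ∈ Finset.range (s.N 0 c₂), F k q) ?_ ?_).2.2 k hk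
  · exact ⟨fun _ _ _ => rfl, fun _ _ => rfl, fun k hk => absurd hk (Nat.not_lt_zero _)⟩
  · rintro n hn s' ⟨hN, hR, hacc⟩
    set t := (s'.writeN 1 0 n).tick 1 with ht
    have htN : ∀ b, b ≠ 1 → b ≠ 2 → t.N b = s.N b := fun b h1 h2 => by
      rw [ht, State.tick_N, State.writeN_N_ne h1, hN b h1 h2]
    have htv : t.N 1 0 = n := by simp [ht]
    have htR : t.R = s'.R := rfl
    refine ⟨fun b h1 h2 => ?_, fun b hb => ?_, fun k hk => ?_⟩
    · rw [Prog.run_N_of_notMem _ (by simp [sumProg, Prog.writesN, h2]), htN b h1 h2]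
    · rw [Prog.run_R_of_notMem _ (by simp [sumProg, Prog.writesR, hb]), htR, hR b hb]
    · have hev : NExp.eval t (.get 0 (.lit c₂)) = s.N 0 c₂ := by
        simp [NExp.eval, htN 0 (by decide) (by decide)]
      rw [sumProg_run (F := F n)]
      · rw [hev, NExp.eval, NExp.eval, NExp.eval, htv, htR]
        split_ifs with h1
        · rw [h1.1]
        · exact hacc k (by simp only [and_true] at h1; omega)
      · intro u hu; simp [NExp.eval, hu 1 (by decide)]
      · intro u hu; rfl
      · intro u hu; simp [NExp.eval, hu]
      · intro q hq u huN huq huR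
        rw [hev] at hq
        refine hf n hn q hq u (fun b h1 h2 => by rw [huN b h2, htN b h1 h2])
          (by rw [huN 1 (by decide), htv]) huq fun b hb => by rw [huR b hb, htR, hR b hb]

lemma rowNormProg_run {i : ℕ} (hi : i < s.N 0 0) :
    (rowNormProg.run ω s).R 2 i 0 = ∑ j ∈ Finset.range (s.N 0 1), s.R 0 i j ^ 2 := by
  refine rowSumProg_run (F := fun i j => s.R 0 i j ^ 2) ?_ hi
  intro k _ q _ s' _ h1 h2 hR
  simp [RExp.eval, NExp.eval, h1, h2, hR, pow_two]

lemma frobProg_run :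
    (frobProg.run ω s).R 3 0 0 = ∑ i ∈ Finset.range (s.N 0 0), s.R 2 i 0 := by
  unfold frobProg
  rw [sumProg_run (F := fun i => s.R 2 i 0)]
  · simp [NExp.eval]
  · intro _ _; rfl
  · intro _ _; rfl
  · intro s' h; simp [NExp.eval, h]
  · intro k _ s' _ h1 hR
    simp [RExp.eval, NExp.eval, h1, hR]

lemma partBody_run_of_le {x : ℝ} (hx : x = s.N 0 0 * (s.R 2 (s.N 1 0) 0 / s.R 3 0 0))
    (h : x ≤ 1) : (partBody.run ω s).N 6 0 = s.N 6 0 + 1 ∧ (partBody.run ω s).N 7 0 = s.N 7 0 ∧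
      (∀ p, (partBody.run ω s).N 4 p = if p = s.N 6 0 then s.N 1 0 else s.N 4 p) ∧
      ∀ p, (partBody.run ω s).R 4 p 0 = if p = s.N 6 0 then x else s.R 4 p 0 := by
  simp [partBody, Prog.run, RExp.eval, NExp.eval, ← hx, h]

lemma partBody_run_of_not_le {x : ℝ} (hx : x = s.N 0 0 * (s.R 2 (s.N 1 0) 0 / s.R 3 0 0))
    (h : ¬ x ≤ 1) : (partBody.run ω s).N 6 0 = s.N 6 0 ∧
      (partBody.run ω s).N 7 0 = s.N 7 0 - 1 ∧
      (∀ p, (partBody.run ω s).N 4 p = if p = s.N 7 0 - 1 then s.N 1 0 else s.N 4 p) ∧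
      ∀ p, (partBody.run ω s).R 4 p 0 = if p = s.N 7 0 - 1 then x else s.R 4 p 0 := by
  simp [partBody, Prog.run, RExp.eval, NExp.eval, ← hx, h]

lemma partProg_run {w : ℕ → ℝ} (hw : ∀ i < s.N 0 0, w i = s.N 0 0 * (s.R 2 i 0 / s.R 3 0 0))
    (hw0 : ∀ i < s.N 0 0, 0 ≤ w i) :
    ∃ hi, PartInv (s.N 0 0) w (s.N 0 0) ((partProg.run ω s).N 6 0) hi ((partProg.run ω s).N 4)
      (fun p => (partProg.run ω s).R 4 p 0) := by
  set s₁ := (Prog.setN 7 (.lit 0) (.get 0 (.lit 0))).run ω ((Prog.setN 6 (.lit 0) (.lit 0)).run ω s)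
    with hs₁
  have hs₁0 : s₁.N 0 = s.N 0 := by
    funext j; simp [hs₁, Prog.run]
  have h := Prog.run_loop_induction (ω := ω) (s := s₁) (a := 1) (e := .get 0 (.lit 0))
    (p := partBody) (fun i s' => s'.N 0 = s.N 0 ∧ s'.R 2 = s.R 2 ∧ s'.R 3 = s.R 3 ∧
      PartInv (s.N 0 0) w i (s'.N 6 0) (s'.N 7 0) (s'.N 4) (fun p => s'.R 4 p 0)) ?_ ?_
  · have he : NExp.eval s₁ (.get 0 (.lit 0)) = s.N 0 0 := by simp [NExp.eval, hs₁0]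
    rw [he] at h
    exact ⟨_, h.2.2.2⟩
  · refine ⟨hs₁0, rfl, rfl, ?_⟩
    have h6 : s₁.N 6 0 = 0 := by simp [hs₁, Prog.run, NExp.eval]
    have h7 : s₁.N 7 0 = s.N 0 0 := by simp [hs₁, Prog.run, NExp.eval]
    rw [State.tick_N, h6, h7]
    exact ⟨by simp, le_rfl, by simp, fun p h1 h2 => absurd h1 (not_lt.2 h2), fun g => by simp⟩
  · rintro i hi s' ⟨h0, h2, h3, hinv⟩
    have hi' : i < s.N 0 0 := by simpa [NExp.eval, hs₁0] using hi
    refine ⟨?_, ?_, ?_, ?_⟩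
    · rw [Prog.run_N_of_notMem _ (by decide), State.tick_N, State.writeN_N_ne (by decide), h0]
    · rw [Prog.run_R_of_notMem _ (by decide)]; exact h2
    · rw [Prog.run_R_of_notMem _ (by decide)]; exact h3
    · set t := (s'.writeN 1 0 i).tick 1 with ht
      have htb : ∀ b, b ≠ 1 → t.N b = s'.N b := fun b hb => State.writeN_N_ne hb
      have ht1 : t.N 1 0 = i := by simp [ht]
      have htR : t.R = s'.R := rfl
      have hwi : w i = t.N 0 0 * (t.R 2 (t.N 1 0) 0 / t.R 3 0 0) := by
        rw [hw i hi', htb 0 (by decide), htR, h0, h2, h3, ht1]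
      by_cases hle : w i ≤ 1
      · obtain ⟨e6, e7, e4, eR⟩ := partBody_run_of_le (ω := ω) hwi hle
        rw [e6, e7, htb 6 (by decide), htb 7 (by decide)]
        rw [htb 6 (by decide), htb 4 (by decide), ht1] at e4
        rw [htb 6 (by decide), htR] at eR
        exact hinv.step_small hi' (hw0 i hi') hle e4 eR
      · obtain ⟨e6, e7, e4, eR⟩ := partBody_run_of_not_le (ω := ω) hwi hle
        rw [e6, e7, htb 6 (by decide), htb 7 (by decide)]
        rw [htb 7 (by decide), htb 4 (by decide), ht1] at e4
        rw [htb 7 (by decide), htR] at eR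
        exact hinv.step_large hi' (not_le.1 hle).le e4 eR

lemma sweepBody_run :
    (∀ p, (sweepBody.run ω s).N 5 p = if p = s.N 1 0 then s.N 6 0 else s.N 5 p) ∧
      (∀ p, (sweepBody.run ω s).R 4 p 0 =
        if p = s.N 6 0 then s.R 4 (s.N 6 0) 0 - (1 - s.R 4 (s.N 1 0) 0) else s.R 4 p 0) ∧
      (sweepBody.run ω s).N 6 0 =
        if (sweepBody.run ω s).R 4 (s.N 6 0) 0 ≤ 1 then s.N 6 0 + 1 else s.N 6 0 := by
  by_cases h : s.R 4 (s.N 6 0) 0 - (1 - s.R 4 (s.N 1 0) 0) ≤ 1 <;>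
    simp [sweepBody, Prog.run, RExp.eval, NExp.eval, h, -tsub_le_iff_right]

lemma sweepProg_run {W₀ : ℕ → ℝ} (hsum : ∑ p ∈ Finset.range (s.N 0 0), W₀ p = s.N 0 0)
    (h : SweepInv (s.N 0 0) W₀ 0 (s.N 6 0) (s.N 5) (fun p => s.R 4 p 0)) :
    SweepInv (s.N 0 0) W₀ (s.N 0 0) ((sweepProg.run ω s).N 6 0) ((sweepProg.run ω s).N 5)
      (fun p => (sweepProg.run ω s).R 4 p 0) := by
  refine (Prog.run_loop_induction (ω := ω) (s := s) (a := 1) (e := .get 0 (.lit 0))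
    (p := sweepBody) (fun k s' => s'.N 0 = s.N 0 ∧
      SweepInv (s.N 0 0) W₀ k (s'.N 6 0) (s'.N 5) (fun p => s'.R 4 p 0)) ⟨rfl, h⟩ ?_).2
  rintro k hk s' ⟨h0, hinv⟩
  refine ⟨?_, ?_⟩
  · rw [Prog.run_N_of_notMem _ (by decide), State.tick_N, State.writeN_N_ne (by decide), h0]
  · set t := (s'.writeN 1 0 k).tick 1 with ht
    have htb : ∀ b, b ≠ 1 → t.N b = s'.N b := fun b hb => State.writeN_N_ne hb
    have ht1 : t.N 1 0 = k := by simp [ht]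
    have htR : t.R = s'.R := rfl
    obtain ⟨e5, eR, e6⟩ := sweepBody_run (ω := ω) (s := t)
    rw [ht1, htb 6 (by decide), htb 5 (by decide)] at e5
    rw [ht1, htb 6 (by decide), htR] at eR
    rw [htb 6 (by decide)] at e6
    exact hinv.step hk hsum e5 eR e6

lemma tableProg_run (hpos : 0 < ∑ i ∈ Finset.range (s.N 0 0),
      ∑ j ∈ Finset.range (s.N 0 1), s.R 0 i j ^ 2) :
    (∀ i < s.N 0 0, (tableProg.run ω s).R 2 i 0 = ∑ j ∈ Finset.range (s.N 0 1), s.R 0 i j ^ 2) ∧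
      (tableProg.run ω s).R 3 0 0 = ∑ i ∈ Finset.range (s.N 0 0),
        ∑ j ∈ Finset.range (s.N 0 1), s.R 0 i j ^ 2 ∧
      AliasTable (s.N 0 0) (fun i => s.N 0 0 * ((∑ j ∈ Finset.range (s.N 0 1), s.R 0 i j ^ 2) /
          ∑ i ∈ Finset.range (s.N 0 0), ∑ j ∈ Finset.range (s.N 0 1), s.R 0 i j ^ 2))
        ((tableProg.run ω s).N 4) ((tableProg.run ω s).N 5)
        (fun p => (tableProg.run ω s).R 4 p 0) := by
  set F := ∑ i ∈ Finset.range (s.N 0 0), ∑ j ∈ Finset.range (s.N 0 1), s.R 0 i j ^ 2 with hF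
  set w : ℕ → ℝ := fun i => s.N 0 0 * ((∑ j ∈ Finset.range (s.N 0 1), s.R 0 i j ^ 2) / F) with hw
  set s₁ := rowNormProg.run ω s with hs₁
  set s₂ := frobProg.run ω s₁ with hs₂
  set s₃ := partProg.run ω s₂ with hs₃
  set s₄ := sweepProg.run ω s₃ with hs₄
  have hrun : tableProg.run ω s = s₄ := rfl
  have h01 : s₁.N 0 = s.N 0 := Prog.run_N_of_notMem _ (by decide)
  have h02 : s₂.N 0 = s.N 0 := (Prog.run_N_of_notMem _ (by decide)).trans h01
  have h03 : s₃.N 0 = s.N 0 := (Prog.run_N_of_notMem _ (by decide)).trans h02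
  have hr2 : s₄.R 2 = s₁.R 2 := by
    rw [hs₄, Prog.run_R_of_notMem _ (by decide), hs₃, Prog.run_R_of_notMem _ (by decide), hs₂,
      Prog.run_R_of_notMem _ (by decide)]
  have hr22 : s₂.R 2 = s₁.R 2 := Prog.run_R_of_notMem _ (by decide)
  have hr3 : s₄.R 3 = s₂.R 3 := by
    rw [hs₄, Prog.run_R_of_notMem _ (by decide), hs₃, Prog.run_R_of_notMem _ (by decide)]
  have hP : s₄.N 4 = s₃.N 4 := Prog.run_N_of_notMem _ (by decide)
  have hrow : ∀ i < s.N 0 0, s₁.R 2 i 0 = ∑ j ∈ Finset.range (s.N 0 1), s.R 0 i j ^ 2 :=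
    fun i hi => rowNormProg_run hi
  have hfrob : s₂.R 3 0 0 = F := by
    rw [hs₂, frobProg_run, h01]
    exact Finset.sum_congr rfl fun i hi => hrow i (Finset.mem_range.1 hi)
  have hw0 : ∀ i < s₂.N 0 0, 0 ≤ w i := fun i _ => by positivity
  obtain ⟨hi, hpart⟩ := partProg_run (ω := ω) (s := s₂) (w := w) (fun i hi => by
    rw [h02] at hi
    rw [h02, hr22, hrow i hi, hfrob]) hw0
  rw [h02] at hpart
  have hsum : ∑ p ∈ Finset.range (s.N 0 0), s₃.R 4 p 0 = s.N 0 0 := by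
    have := hpart.sum_mul fun _ => 1
    simp only [mul_one] at this
    refine this.trans ?_
    rw [hw, ← Finset.mul_sum, ← Finset.sum_div, ← hF, div_self hpos.ne', mul_one]
  have hsweep := sweepProg_run (ω := ω) (s := s₃) (W₀ := fun p => s₃.R 4 p 0)
    (by rw [h03]; exact hsum) (by rw [h03]; exact hpart.sweepInv)
  rw [h03] at hsweep
  rw [hrun, hr2, hr3]
  refine ⟨hrow, hfrob, ?_⟩
  rw [hP]
  exact hsweep.aliasTable hpart.sum_mul

end Program

/-! ### Correctness of the program -/

section Correctness

variable {ω : Tape} {s : State} {m d r : ℕ}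

/-- The row index drawn from the uniform variables `u`, `v`. -/
def drawIndex (s : State) (u v : unitInterval) : ℕ :=
  aliasPick (s.N 4) (s.N 5) (fun p => s.R 4 p 0) ⌊(u : ℝ) * (s.N 0 0 : ℝ)⌋₊ v

lemma drawProg_run :
    (drawProg.run ω s).N 9 0 = drawIndex s (ω.2 s.upos) (ω.2 (s.upos + 1)) ∧
      (drawProg.run ω s).upos = s.upos + 2 := by
  by_cases h : ((ω.2 (s.upos + 1) : unitInterval) : ℝ) ≤
      s.R 4 ⌊((ω.2 s.upos : unitInterval) : ℝ) * (s.N 0 0 : ℝ)⌋₊ 0 <;>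
    simp [drawProg, Prog.run, RExp.eval, NExp.eval, drawIndex, aliasPick, h]

lemma storeProg_run (k l : ℕ) :
    (storeProg.run ω s).R 6 k l = if k < s.N 0 1 ∧ l = s.N 1 0 then
      s.R 0 (s.N 9 0) k / Real.sqrt (s.N 0 2 * (s.R 2 (s.N 9 0) 0 / s.R 3 0 0))
      else s.R 6 k l := by
  refine (mapProg_run (F := fun k => s.R 0 (s.N 9 0) k /
    Real.sqrt (s.N 0 2 * (s.R 2 (s.N 9 0) 0 / s.R 3 0 0))) ?_ ?_ k l).trans ?_
  · intro s' h; simp [NExp.eval, h 1 (by decide)]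
  · intro k _ s' hN hk hR _
    simp [RExp.eval, NExp.eval, hN, hk, hR]
  · simp [NExp.eval]

/-- A draw consumes exactly two uniforms whichever branch is taken, so the `j`-th index depends only
on entries `2j` and `2j + 1` of the stream. Independence of the indices rests on this. -/
lemma sampleProg_run (hu : s.upos = 0) {l j : ℕ} (hl : l < s.N 0 1) (hj : j < s.N 0 2) :
    (sampleProg.run ω s).R 6 l j =
      s.R 0 (drawIndex s (ω.2 (2 * j)) (ω.2 (2 * j + 1))) l /
        Real.sqrt (s.N 0 2 * (s.R 2 (drawIndex s (ω.2 (2 * j)) (ω.2 (2 * j + 1))) 0 /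
          s.R 3 0 0)) := by
  refine (Prog.run_loop_induction (ω := ω) (s := s) (a := 1) (e := .get 0 (.lit 2))
    (p := .seq drawProg storeProg) (fun q s' => s'.upos = 2 * q ∧
      (∀ b, b = 0 ∨ b = 4 ∨ b = 5 → s'.N b = s.N b) ∧
      (∀ b, b = 0 ∨ b = 2 ∨ b = 3 ∨ b = 4 → s'.R b = s.R b) ∧
      ∀ l < s.N 0 1, ∀ j < q, s'.R 6 l j =
        s.R 0 (drawIndex s (ω.2 (2 * j)) (ω.2 (2 * j + 1))) l /
        Real.sqrt (s.N 0 2 * (s.R 2 (drawIndex s (ω.2 (2 * j)) (ω.2 (2 * j + 1))) 0 /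
          s.R 3 0 0))) ?_ ?_).2.2.2 l hl j hj
  · exact ⟨hu, fun _ _ => rfl, fun _ _ => rfl, fun _ _ j hj => absurd hj (Nat.not_lt_zero _)⟩
  · rintro q hq s' ⟨hup, hN, hR, h6⟩
    set t := (s'.writeN 1 0 q).tick 1 with ht
    have htb : ∀ b, b ≠ 1 → t.N b = s'.N b := fun b hb => State.writeN_N_ne hb
    have ht1 : t.N 1 0 = q := by simp [ht]
    have htR : t.R = s'.R := rfl
    have htu : t.upos = 2 * q := hup
    set t₂ := drawProg.run ω t with ht₂
    obtain ⟨h9, hu2⟩ := drawProg_run (ω := ω) (s := t)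
    rw [← ht₂, htu] at h9 hu2
    have hdraw : ∀ u v, drawIndex t u v = drawIndex s u v := fun u v => by
      simp only [drawIndex]
      rw [htb 4 (by decide), htb 5 (by decide), htb 0 (by decide), htR, hN 4 (by decide),
        hN 5 (by decide), hN 0 (by decide), hR 4 (by decide)]
    rw [hdraw] at h9
    have h2N : ∀ b, b ≠ 8 → b ≠ 9 → t₂.N b = t.N b := fun b h1 h2 =>
      Prog.run_N_of_notMem _ (by simp [drawProg, Prog.writesN, h1, h2])
    have h2R : ∀ b, b ≠ 5 → t₂.R b = t.R b := fun b h1 =>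
      Prog.run_R_of_notMem _ (by simp [drawProg, Prog.writesR, h1])
    have hrun : (Prog.seq drawProg storeProg).run ω t = storeProg.run ω t₂ := rfl
    rw [hrun]
    refine ⟨?_, fun b hb => ?_, fun b hb => ?_, fun l hl j hj => ?_⟩
    · rw [Prog.run_upos _ (by decide), hu2]; ring
    · have hb1 : b ≠ 1 ∧ b ≠ 2 ∧ b ≠ 8 ∧ b ≠ 9 := by omega
      rw [Prog.run_N_of_notMem _ (by simp [storeProg, mapProg, Prog.writesN, hb1.2.1]),
        h2N b hb1.2.2.1 hb1.2.2.2, htb b hb1.1, hN b hb]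
    · have hb1 : b ≠ 5 ∧ b ≠ 6 := by omega
      rw [Prog.run_R_of_notMem _ (by simp [storeProg, mapProg, Prog.writesR, hb1.2]),
        h2R b hb1.1, htR, hR b hb]
    · rw [storeProg_run, h9, h2N 0 (by decide) (by decide), h2N 1 (by decide) (by decide), ht1,
        h2R 0 (by decide), h2R 2 (by decide), h2R 3 (by decide), h2R 6 (by decide),
        htb 0 (by decide), hN 0 (by decide), htR, hR 0 (by decide), hR 2 (by decide),
        hR 3 (by decide)]
      by_cases hjq : j = q
      · subst hjq
        rw [if_pos ⟨hl, rfl⟩]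
      · rw [if_neg (by tauto)]
        exact h6 l hl j (by omega)

lemma normalProg_run (hg : s.gpos = 0) {l : ℕ} (hl : l < s.N 0 1) :
    (normalProg.run ω s).R 7 l 0 = ω.1 l := by
  refine (Prog.run_loop_induction (ω := ω) (s := s) (a := 1) (e := .get 0 (.lit 1))
    (p := .normal 7 (.var 1) (.lit 0)) (fun q s' => s'.gpos = q ∧ ∀ l < q, s'.R 7 l 0 = ω.1 l)
    ⟨hg, fun _ h => absurd h (Nat.not_lt_zero _)⟩ ?_).2 l hl
  rintro q hq s' ⟨hg, h7⟩
  refine ⟨by simp [Prog.run, hg], fun l hl => ?_⟩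
  simp only [Prog.run, NExp.eval, State.tick_R, State.writeR_R, State.tick_N, State.writeN_N,
    State.writeN_R, State.tick_gpos, State.writeN_gpos, true_and, and_true, if_true, hg]
  split_ifs with h
  · rw [h]
  · exact h7 l (by omega)

lemma normProg_run {b : ℕ} (hb : b ≠ 1) :
    ((normProg b).run ω s).R 1 0 0 =
      Real.sqrt (∑ l ∈ Finset.range (s.N 0 1), s.R b l 0 ^ 2) := by
  have h := sumProg_run (ω := ω) (s := s) (v := 1) (acc := 1) (i := .lit 0) (j := .lit 0)
    (K := .get 0 (.lit 1)) (f := .mul (.get b (.var 1) (.lit 0)) (.get b (.var 1) (.lit 0)))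
    (F := fun l => s.R b l 0 ^ 2) (fun _ _ => rfl) (fun _ _ => rfl)
    (fun s' h => by simp [NExp.eval, h]) (fun k _ s' _ hk hR => by
      simp [RExp.eval, NExp.eval, hk, hR b hb, pow_two]) 0 0
  simp only [NExp.eval, and_self, if_true] at h
  simp [normProg, Prog.run, RExp.eval, NExp.eval, h]

lemma scaleProg_run {b : ℕ} (hb : b ≠ 1) {l : ℕ} (hl : l < s.N 0 1) :
    ((scaleProg b).run ω s).R 7 l 0 = s.R b l 0 / s.R 1 0 0 := by
  refine (mapProg_run (F := fun l => s.R b l 0 / s.R 1 0 0) (fun _ _ => rfl) ?_ l 0).trans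
    (if_pos ⟨hl, rfl⟩)
  intro k _ s' _ hk hR hk7
  by_cases hb7 : b = 7
  · subst hb7
    simp [RExp.eval, NExp.eval, hk, hR, hk7]
  · simp [RExp.eval, NExp.eval, hk, hR, hb7]

lemma gramProg_run {B : Matrix (Fin r) (Fin d) ℝ} {x : EuclideanSpace ℝ (Fin d)}
    (hd : s.N 0 1 = d) (hr : s.N 0 2 = r) (hB : ∀ (l : Fin d) (j : Fin r), s.R 6 l j = B j l)
    (hx : ∀ l : Fin d, s.R 7 l 0 = x l) :
    (∀ l : Fin d, (gramProg.run ω s).R 9 l 0 = Matrix.toEuclideanLin (Bᵀ * B) x l) ∧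
      (gramProg.run ω s).R 1 0 0 = ‖Matrix.toEuclideanLin (Bᵀ * B) x‖ := by
  set s₁ := (rowSumProg 8 2 1 (.mul (.get 6 (.var 2) (.var 1))
    (.get 7 (.var 2) (.lit 0)))).run ω s with hs₁
  set s₂ := (rowSumProg 9 1 2 (.mul (.get 6 (.var 1) (.var 2))
    (.get 8 (.var 2) (.lit 0)))).run ω s₁ with hs₂
  have hrun : gramProg.run ω s = (normProg 9).run ω s₂ := rfl
  have h01 : s₁.N 0 = s.N 0 := Prog.run_N_of_notMem _ (by decide)
  have h02 : s₂.N 0 = s.N 0 := (Prog.run_N_of_notMem _ (by decide)).trans h01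
  have h16 : s₁.R 6 = s.R 6 := Prog.run_R_of_notMem _ (by decide)
  have h8 : ∀ j : Fin r, s₁.R 8 j 0 = (B *ᵥ x) j := fun j => by
    have := rowSumProg_run (ω := ω) (s := s) (acc := 8) (c₁ := 2) (c₂ := 1)
      (f := .mul (.get 6 (.var 2) (.var 1)) (.get 7 (.var 2) (.lit 0)))
      (F := fun k q => s.R 6 q k * s.R 7 q 0) (fun k _ q _ s' _ h1 h2 hR => by
        simp [RExp.eval, NExp.eval, h1, h2, hR]) (k := j) (hr ▸ j.2)
    rw [← hs₁, hd, Finset.sum_range] at this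
    rw [this]
    simp [Matrix.mulVec, dotProduct, hB, hx]
  have h9 : ∀ l : Fin d, s₂.R 9 l 0 = Matrix.toEuclideanLin (Bᵀ * B) x l := fun l => by
    have := rowSumProg_run (ω := ω) (s := s₁) (acc := 9) (c₁ := 1) (c₂ := 2)
      (f := .mul (.get 6 (.var 1) (.var 2)) (.get 8 (.var 2) (.lit 0)))
      (F := fun k q => s₁.R 6 k q * s₁.R 8 q 0) (fun k _ q _ s' _ h1 h2 hR => by
        simp [RExp.eval, NExp.eval, h1, h2, hR]) (k := l) (by rw [h01, hd]; exact l.2)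
    rw [← hs₂, h01, hr, Finset.sum_range] at this
    rw [this, Matrix.toLpLin_apply, ← Matrix.mulVec_mulVec]
    simp [h16, h8, hB, Matrix.mulVec, dotProduct]
  rw [hrun]
  refine ⟨fun l => ?_, ?_⟩
  · rw [Prog.run_R_of_notMem _ (by decide), h9]
  · rw [normProg_run (by decide), h02, hd, Finset.sum_range, EuclideanSpace.norm_eq]
    simp [h9]

lemma powerProg_run {B : Matrix (Fin r) (Fin d) ℝ} {z : Fin d → ℝ}
    (hd : s.N 0 1 = d) (hr : s.N 0 2 = r) (hB : ∀ (l : Fin d) (j : Fin r), s.R 6 l j = B j l)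
    (hx : ∀ l : Fin d, s.R 7 l 0 = powerIter B z 0 l) (l : Fin d) :
    (powerProg.run ω s).R 7 l 0 = powerIter B z (s.N 0 3) l := by
  refine (Prog.run_loop_induction (ω := ω) (s := s) (a := 3) (e := .get 0 (.lit 3))
    (p := .seq gramProg (scaleProg 9)) (fun q s' => s'.N 0 = s.N 0 ∧ s'.R 6 = s.R 6 ∧
      ∀ l : Fin d, s'.R 7 l 0 = powerIter B z q l) ⟨rfl, rfl, hx⟩ ?_).2.2 l
  rintro q hq s' ⟨h0, h6, h7⟩
  refine ⟨?_, ?_, fun l => ?_⟩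
  · rw [Prog.run_N_of_notMem _ (by decide), State.tick_N, State.writeN_N_ne (by decide), h0]
  · rw [Prog.run_R_of_notMem _ (by decide), State.tick_R, State.writeN_R, h6]
  · set t := (s'.writeN 3 0 q).tick 1 with ht
    have ht0 : t.N 0 = s.N 0 := by
      rw [ht, State.tick_N, State.writeN_N_ne (by decide), h0]
    obtain ⟨h9, h1⟩ := gramProg_run (ω := ω) (s := t) (B := B) (x := powerIter B z q)
      (by rw [ht0, hd]) (by rw [ht0, hr]) (fun l j => by rw [← hB, ← h6]; rfl) h7
    have hg0 : (gramProg.run ω t).N 0 = s.N 0 :=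
      (Prog.run_N_of_notMem _ (by decide)).trans ht0
    rw [Prog.run, scaleProg_run (by decide) (by rw [hg0, hd]; exact l.2), h9, h1, powerIter,
      div_eq_inv_mul]
    rfl

/-- The preparation of the table is deterministic, so its final state may be computed on the zero
streams and regarded as a function of the input. -/
lemma Prog.run_congr (p : Prog) (h1 : p.usesNormal = false) (h2 : p.usesUniform = false)
    (ω ω' : Tape) (s : State) : p.run ω s = p.run ω' s := by
  induction p generalizing s with
  | normal a i j => simp [usesNormal] at h1
  | uniform a i j => simp [usesUniform] at h2
  | randInt a i e => simp [usesUniform] at h2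
  | skip | setN | setR => rfl
  | seq p q hp hq =>
    simp only [usesNormal, usesUniform, Bool.or_eq_false_iff] at h1 h2
    rw [run, run, hp h1.1 h2.1, hq h1.2 h2.2]
  | iteN x y p q hp hq =>
    simp only [usesNormal, usesUniform, Bool.or_eq_false_iff] at h1 h2
    rw [run, run, hp h1.1 h2.1, hq h1.2 h2.2]
  | iteR x y p q hp hq =>
    simp only [usesNormal, usesUniform, Bool.or_eq_false_iff] at h1 h2
    rw [run, run, hp h1.1 h2.1, hq h1.2 h2.2]
  | loop a e p hp =>
    rw [run, run]
    congr 1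
    funext s' k
    exact hp h1 h2 _

/-- The machine state after the preparation of the alias table. -/
def tableState (A : Matrix (Fin m) (Fin d) ℝ) (r n : ℕ) : State :=
  tableProg.run (fun _ => 0, fun _ => 0) (inputState A r n)

lemma inputState_R {A : Matrix (Fin m) (Fin d) ℝ} {n : ℕ} (i : Fin m) (j : Fin d) :
    (inputState A r n).R 0 i j = A i j := by
  simp [inputState]

lemma sum_sq_inputState {A : Matrix (Fin m) (Fin d) ℝ} {n : ℕ} (i : Fin m) :
    ∑ j ∈ Finset.range d, (inputState A r n).R 0 i j ^ 2 = ∑ j, A i j ^ 2 := by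
  rw [Finset.sum_range]
  simp [inputState_R]

lemma frobSq_inputState {A : Matrix (Fin m) (Fin d) ℝ} {n : ℕ} :
    ∑ i ∈ Finset.range m, ∑ j ∈ Finset.range d, (inputState A r n).R 0 i j ^ 2 = frobSq A := by
  rw [Finset.sum_range]
  simp only [sum_sq_inputState]
  rfl

/-- The weights `m p_i`, extended by zero. -/
def aliasWeight (A : Matrix (Fin m) (Fin d) ℝ) (i : ℕ) : ℝ :=
  if h : i < m then m * rowProb A ⟨i, h⟩ else 0

lemma tableState_spec {A : Matrix (Fin m) (Fin d) ℝ} (hA : A ≠ 0) (r n : ℕ) :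
    (tableState A r n).N 0 = (inputState A r n).N 0 ∧
      (tableState A r n).R 0 = (inputState A r n).R 0 ∧
      (tableState A r n).upos = 0 ∧ (tableState A r n).gpos = 0 ∧
      (∀ i : Fin m, (tableState A r n).R 2 i 0 / (tableState A r n).R 3 0 0 = rowProb A i) ∧
      AliasTable m (aliasWeight A) ((tableState A r n).N 4) ((tableState A r n).N 5)
        (fun p => (tableState A r n).R 4 p 0) := by
  have hF := frobSq_pos hA
  obtain ⟨h2, h3, hal⟩ := tableProg_run (ω := (fun _ => 0, fun _ => 0)) (s := inputState A r n)
    ((frobSq_inputState (A := A)).symm ▸ hF :)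
  change AliasTable m _ _ _ _ at hal
  have hFr : ∑ i ∈ Finset.range ((inputState A r n).N 0 0),
      ∑ j ∈ Finset.range ((inputState A r n).N 0 1), (inputState A r n).R 0 i j ^ 2 = frobSq A :=
    frobSq_inputState
  refine ⟨Prog.run_N_of_notMem _ (by decide), Prog.run_R_of_notMem _ (by decide),
    Prog.run_upos _ (by decide), Prog.run_gpos _ (by decide), fun i => ?_, hal.mem_Icc, fun g => ?_⟩
  · rw [tableState, h3, h2 i i.2, hFr]
    change (∑ j ∈ Finset.range d, (inputState A r n).R 0 i j ^ 2) / _ = _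
    rw [sum_sq_inputState, rowProb]
  · refine (hal.mass g).trans (Finset.sum_congr rfl fun q hq => ?_)
    have hq' := Finset.mem_range.1 hq
    rw [hFr, aliasWeight, dif_pos hq', rowProb]
    change m * ((∑ j ∈ Finset.range d, (inputState A r n).R 0 (⟨q, hq'⟩ : Fin m) j ^ 2) / _) * _ = _
    rw [sum_sq_inputState]

/-- Arithmetic is exact, so output and estimate agree pathwise as soon as the drawn indices are in
range. -/
lemma estimateProg_output {A : Matrix (Fin m) (Fin d) ℝ} (hA : A ≠ 0) {n : ℕ}
    (t : Fin r → Fin m)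
    (ht : ∀ j : Fin r, drawIndex (tableState A r n) (ω.2 (2 * j)) (ω.2 (2 * j + 1)) = t j) :
    estimateProg.output A r n ω = estimate A r n (t, fun l => ω.1 l) := by
  obtain ⟨hN0, hR0, hu, hg, hp, -⟩ := tableState_spec hA r n
  set B := rowSample A t with hB
  set z : Fin d → ℝ := fun l => ω.1 l with hz
  obtain ⟨s₀, hs₀⟩ : ∃ x, x = tableState A r n := ⟨_, rfl⟩
  rw [← hs₀] at hN0 hR0 hu hg hp ht
  have hs₀' : tableProg.run ω (inputState A r n) = s₀ := by
    rw [hs₀]; exact Prog.run_congr _ (by decide) (by decide) _ _ _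
  obtain ⟨s₁, hs₁⟩ : ∃ x, x = sampleProg.run ω s₀ := ⟨_, rfl⟩
  obtain ⟨s₂, hs₂⟩ : ∃ x, x = normalProg.run ω s₁ := ⟨_, rfl⟩
  obtain ⟨s₃, hs₃⟩ : ∃ x, x = (normProg 7).run ω s₂ := ⟨_, rfl⟩
  obtain ⟨s₄, hs₄⟩ : ∃ x, x = (scaleProg 7).run ω s₃ := ⟨_, rfl⟩
  obtain ⟨s₅, hs₅⟩ : ∃ x, x = powerProg.run ω s₄ := ⟨_, rfl⟩
  have hrun : estimateProg.run ω (inputState A r n) = gramProg.run ω s₅ := by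
    simp only [estimateProg, Prog.run, hs₀', hs₁, hs₂, hs₃, hs₄, hs₅]
  have n1 : s₁.N 0 = s₀.N 0 := by
    rw [hs₁, Prog.run_N_of_notMem _ (by decide)]
  have n2 : s₂.N 0 = s₀.N 0 := by
    rw [hs₂, Prog.run_N_of_notMem _ (by decide), n1]
  have n3 : s₃.N 0 = s₀.N 0 := by
    rw [hs₃, Prog.run_N_of_notMem _ (by decide), n2]
  have n4 : s₄.N 0 = s₀.N 0 := by
    rw [hs₄, Prog.run_N_of_notMem _ (by decide), n3]
  have n5 : s₅.N 0 = s₀.N 0 := by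
    rw [hs₅, Prog.run_N_of_notMem _ (by decide), n4]
  have hd : s₀.N 0 1 = d := by rw [hN0]; rfl
  have hr : s₀.N 0 2 = r := by rw [hN0]; rfl
  have hn : s₀.N 0 3 = n := by rw [hN0]; rfl
  have hB1 : ∀ (l : Fin d) (j : Fin r), s₁.R 6 l j = B j l := fun l j => by
    rw [hs₁, sampleProg_run hu (by rw [hd]; exact l.2) (by rw [hr]; exact j.2), ht j, hp, hr, hR0,
      inputState_R, hB, rowSample_apply]
  have hB4' : s₄.R 6 = s₁.R 6 := by
    rw [hs₄, Prog.run_R_of_notMem _ (by decide), hs₃, Prog.run_R_of_notMem _ (by decide), hs₂,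
      Prog.run_R_of_notMem _ (by decide)]
  have hB4 : ∀ (l : Fin d) (j : Fin r), s₄.R 6 l j = B j l := fun l j => by rw [hB4', hB1]
  have hB5 : ∀ (l : Fin d) (j : Fin r), s₅.R 6 l j = B j l := fun l j => by
    rw [hs₅, Prog.run_R_of_notMem _ (by decide), hB4]
  have h27 : ∀ l : Fin d, s₂.R 7 l 0 = z l := fun l => by
    have hg1 : s₁.gpos = 0 := by rw [hs₁, Prog.run_gpos _ (by decide), hg]
    rw [hs₂, normalProg_run (ω := ω) (s := s₁) hg1 (by rw [n1, hd]; exact l.2)]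
  have h31 : s₃.R 1 0 0 = ‖WithLp.toLp 2 z‖ := by
    rw [hs₃, normProg_run (by decide), n2, hd, Finset.sum_range, EuclideanSpace.norm_eq]
    simp [h27]
  have h37 : ∀ l : Fin d, s₃.R 7 l 0 = z l := fun l => by
    rw [hs₃, Prog.run_R_of_notMem _ (by decide), h27]
  have h47 : ∀ l : Fin d, s₄.R 7 l 0 = powerIter B z 0 l := fun l => by
    have h := scaleProg_run (ω := ω) (s := s₃) (b := 7) (by decide) (l := l)
      (show (l : ℕ) < s₃.N 0 1 by rw [n3, hd]; exact l.2)
    rw [← hs₄, h37, h31] at h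
    rw [h]
    exact div_eq_inv_mul _ _
  have h57 := powerProg_run (ω := ω) (s := s₄) (by rw [n4, hd]) (by rw [n4, hr]) hB4 h47
  rw [n4, hn, ← hs₅] at h57
  have hd5 : s₅.N 0 1 = d := by rw [n5, hd]
  have hr5 : s₅.N 0 2 = r := by rw [n5, hr]
  unfold Prog.output estimate powerEstimate
  rw [hrun, (gramProg_run (ω := ω) (x := powerIter B z n) hd5 hr5 hB5 h57).2]

end Correctness

/-! ### The law of the output -/

section Law

/-- The preimage of a finite box is a finite box over the image of `e`. It extracts the first `d`
normals and the pairs of uniforms from the streams. -/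
lemma infinitePi_map_comp_injective {ι κ X : Type*} [MeasurableSpace X] (μ : Measure X)
    [IsProbabilityMeasure μ] {e : κ → ι} (he : Function.Injective e) :
    (Measure.infinitePi fun _ : ι => μ).map (fun x k => x (e k)) =
      Measure.infinitePi fun _ : κ => μ := by
  classical
  refine Measure.eq_infinitePi _ fun s t ht => ?_
  have hext : ∀ k, Function.extend e t (fun _ => Set.univ) (e k) = t k := fun k =>
    he.extend_apply _ _ _
  rw [Measure.map_apply (by fun_prop) (.pi s.countable_toSet fun _ _ => ht _)]
  have : (fun (x : ι → X) k => x (e k)) ⁻¹' ((s : Set κ).pi t) =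
      ((s.image e : Finset ι) : Set ι).pi (Function.extend e t fun _ => Set.univ) := by
    ext x
    simp [Set.mem_pi, hext]
  rw [this, Measure.infinitePi_pi]
  · rw [Finset.prod_image fun _ _ _ _ h => he h]
    simp [hext]
  · intro i hi
    obtain ⟨k, -, rfl⟩ := Finset.mem_image.1 hi
    rw [hext]
    exact ht k

lemma map_floor_mul_volume {m : ℕ} (hm : 0 < m) :
    (volume : Measure unitInterval).map (fun u : unitInterval => ⌊(u : ℝ) * (m : ℝ)⌋₊) =
      ∑ k ∈ Finset.range m, ENNReal.ofReal (1 / m) • Measure.dirac k := by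
  have hm' : (0 : ℝ) < m := Nat.cast_pos.2 hm
  have hmeas : Measurable fun u : unitInterval => ⌊(u : ℝ) * (m : ℝ)⌋₊ :=
    Nat.measurable_floor.comp (by fun_prop)
  refine Measure.ext_of_singleton fun k => ?_
  rw [Measure.map_apply hmeas (measurableSet_singleton k), Measure.finsetSum_apply]
  by_cases hk : k < m
  · have hk' : (k : ℝ) + 1 ≤ m := by exact_mod_cast hk
    have hk0 : (0 : ℝ) ≤ k := Nat.cast_nonneg k
    have hset : (fun u : unitInterval => ⌊(u : ℝ) * (m : ℝ)⌋₊) ⁻¹' {k} =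
        {u : unitInterval | (k : ℝ) / m ≤ u ∧ (u : ℝ) < (k + 1) / m} := by
      ext u
      have hu : 0 ≤ (u : ℝ) * m := mul_nonneg u.2.1 hm'.le
      simp only [Set.mem_preimage, Set.mem_singleton_iff, Nat.floor_eq_iff hu, Set.mem_ofPred_eq,
        div_le_iff₀ hm', lt_div_iff₀ hm']
    have hIco : {u : unitInterval | (k : ℝ) / m ≤ u ∧ (u : ℝ) < (k + 1) / m} =
        Set.Ico (⟨k / m, by positivity, by rw [div_le_one hm']; linarith⟩ : unitInterval)
          ⟨(k + 1) / m, by positivity, by rw [div_le_one hm']; exact hk'⟩ := rfl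
    rw [hset, hIco, unitInterval.volume_Ico, Finset.sum_eq_single k]
    · simp only [Measure.smul_apply, Measure.dirac_apply_of_mem (Set.mem_singleton k), smul_eq_mul,
        mul_one]
      congr 1
      ring
    · intro j _ hj
      simp [hj]
    · intro h
      exact absurd (Finset.mem_range.2 hk) h
  -- An index `k ≥ m` can arise only from `u = 1`, a null event.
  · have h0 : (fun u : unitInterval => ⌊(u : ℝ) * (m : ℝ)⌋₊) ⁻¹' {k} ⊆ Set.Ici 1 := by
      intro u hu
      have hu' : ⌊(u : ℝ) * (m : ℝ)⌋₊ = k := hu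
      have h1 : (m : ℝ) ≤ (u : ℝ) * m := by
        refine le_trans ?_ (Nat.floor_le (mul_nonneg u.2.1 hm'.le))
        rw [hu']
        exact_mod_cast not_lt.1 hk
      have h2 : (1 : ℝ) ≤ u := by nlinarith
      exact h2
    rw [measure_mono_null h0 (by rw [unitInterval.volume_Ici]; simp), Finset.sum_eq_zero]
    intro j hj
    have : j ≠ k := fun h => hk (h ▸ Finset.mem_range.1 hj)
    simp [this]

variable {m : ℕ} {w W : ℕ → ℝ} {P al : ℕ → ℕ}

lemma measurable_aliasPick (P al : ℕ → ℕ) (W : ℕ → ℝ) (k : ℕ) :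
    Measurable fun v : unitInterval => aliasPick P al W k v := by
  classical
  unfold aliasPick
  refine Measurable.ite ?_ measurable_const measurable_const
  exact measurableSet_le (by fun_prop) measurable_const

lemma measurable_aliasPick_prod (P al : ℕ → ℕ) (W : ℕ → ℝ) (m : ℕ) :
    Measurable fun p : unitInterval × unitInterval =>
      aliasPick P al W ⌊(p.1 : ℝ) * (m : ℝ)⌋₊ p.2 := by
  have h1 : Measurable fun q : ℕ × unitInterval => aliasPick P al W q.1 q.2 :=
    measurable_from_prod_countable_right fun k => measurable_aliasPick P al W k
  have h2 : Measurable fun p : unitInterval × unitInterval => (⌊(p.1 : ℝ) * (m : ℝ)⌋₊, p.2) :=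
    (Nat.measurable_floor.comp (by fun_prop)).prodMk measurable_snd
  exact h1.comp h2

lemma AliasTable.volume_aliasPick_eq (h : AliasTable m w P al W) {k : ℕ} (hk : k < m) (i : ℕ) :
    (volume : Measure unitInterval) {v | aliasPick P al W k v = i} =
      ENNReal.ofReal (W k * (if P k = i then 1 else 0) +
        (1 - W k) * (if P (al k) = i then 1 else 0)) := by
  obtain ⟨h0, h1⟩ := h.mem_Icc k hk
  by_cases hP : P k = i <;> by_cases hal : P (al k) = i
  · have : {v : unitInterval | aliasPick P al W k v = i} = Set.univ := by
      ext v; simp [aliasPick, hP, hal]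
    rw [this]
    simp [hP, hal]
  · have : {v : unitInterval | aliasPick P al W k v = i} = Set.Iic ⟨W k, h0, h1⟩ := by
      ext v
      simp only [aliasPick, Set.mem_ofPred_eq, Set.mem_Iic, ← Subtype.coe_le_coe]
      split_ifs with h2 <;> simp [hP, hal, h2]
    rw [this, unitInterval.volume_Iic]
    simp [hP, hal]
  · have : {v : unitInterval | aliasPick P al W k v = i} = Set.Ioi ⟨W k, h0, h1⟩ := by
      ext v
      simp only [aliasPick, Set.mem_ofPred_eq, Set.mem_Ioi, ← Subtype.coe_lt_coe]
      split_ifs with h2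
      · simpa [hP] using h2
      · simpa [hal] using h2
    rw [this, unitInterval.volume_Ioi]
    simp [hP, hal]
  · have : {v : unitInterval | aliasPick P al W k v = i} = ∅ := by
      ext v
      simp only [aliasPick, Set.mem_ofPred_eq, Set.mem_empty_iff_false, iff_false]
      split_ifs <;> assumption
    rw [this]
    simp [hP, hal]

/-- Conditioning on the uniform bucket leaves the mean of the bucket shares; the mass identity of
the table, tested on the indicator of `i`, evaluates it. -/
lemma AliasTable.map_aliasPick (h : AliasTable m w P al W) (hm : 0 < m)
    (hw : ∀ q < m, 0 ≤ w q) :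
    ((volume : Measure unitInterval).prod (volume : Measure unitInterval)).map
      (fun p => aliasPick P al W ⌊(p.1 : ℝ) * (m : ℝ)⌋₊ p.2) =
      ∑ q ∈ Finset.range m, ENNReal.ofReal (w q / m) • Measure.dirac q := by
  have hm' : (0 : ℝ) < m := Nat.cast_pos.2 hm
  have hmeas := measurable_aliasPick_prod P al W m
  refine Measure.ext_of_singleton fun i => ?_
  have hfl : Measurable fun u : unitInterval => ⌊(u : ℝ) * (m : ℝ)⌋₊ :=
    Nat.measurable_floor.comp (by fun_prop)
  have h1 : ((volume : Measure unitInterval).prod (volume : Measure unitInterval))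
      ((fun p => aliasPick P al W ⌊(p.1 : ℝ) * (m : ℝ)⌋₊ p.2) ⁻¹' {i}) =
      ∑ k ∈ Finset.range m, ENNReal.ofReal (1 / m) *
        (volume : Measure unitInterval) {v | aliasPick P al W k v = i} := by
    rw [Measure.prod_apply (hmeas (measurableSet_singleton i))]
    have := lintegral_map (μ := (volume : Measure unitInterval))
      (f := fun k : ℕ => (volume : Measure unitInterval) {v | aliasPick P al W k v = i})
      (measurable_of_countable _) hfl
    rw [map_floor_mul_volume hm, lintegral_finsetSum_measure] at this
    simp only [lintegral_smul_measure, lintegral_dirac, smul_eq_mul] at this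
    exact this.symm
  rw [Measure.map_apply hmeas (measurableSet_singleton i), h1, Measure.finsetSum_apply]
  have h2 : ∀ q ∈ Finset.range m, (ENNReal.ofReal (w q / m) • Measure.dirac q) {i} =
      ENNReal.ofReal (1 / m * (w q * if q = i then 1 else 0)) := fun q hq => by
    by_cases hqi : q = i
    · simp [hqi, div_eq_inv_mul]
    · simp [hqi]
  have h3 : ∑ q ∈ Finset.range m, 1 / (m : ℝ) * (w q * if q = i then 1 else 0) =
      ∑ k ∈ Finset.range m, 1 / (m : ℝ) * (W k * (if P k = i then 1 else 0) +
        (1 - W k) * (if P (al k) = i then 1 else 0)) := by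
    rw [← Finset.mul_sum, ← Finset.mul_sum, h.mass fun q => if q = i then 1 else 0]
  rw [Finset.sum_congr rfl h2, ← ENNReal.ofReal_sum_of_nonneg, h3, ENNReal.ofReal_sum_of_nonneg]
  · refine Finset.sum_congr rfl fun k hk => ?_
    rw [h.volume_aliasPick_eq (Finset.mem_range.1 hk), ← ENNReal.ofReal_mul (by positivity)]
  · intro k hk
    obtain ⟨h3, h4⟩ := h.mem_Icc k (Finset.mem_range.1 hk)
    have h5 : 0 ≤ 1 - W k := by linarith
    positivity
  · intro q hq
    have := hw q (Finset.mem_range.1 hq)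
    positivity

variable {d r : ℕ}

lemma measurable_powerIter (B : Matrix (Fin r) (Fin d) ℝ) (n : ℕ) :
    Measurable fun z => powerIter B z n := by
  induction n with
  | zero =>
    simp only [powerIter]
    fun_prop
  | succ n ih =>
    simp only [powerIter]
    have h : Measurable fun z => Matrix.toEuclideanLin (Bᵀ * B) (powerIter B z n) :=
      (LinearMap.continuous_of_finiteDimensional
        (Matrix.toEuclideanLin (Bᵀ * B))).measurable.comp ih
    exact h.norm.inv.smul h

lemma measurable_estimate (A : Matrix (Fin m) (Fin d) ℝ) (r n : ℕ) :
    Measurable (estimate A r n) := by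
  refine measurable_from_prod_countable_right fun t => ?_
  exact ((LinearMap.continuous_of_finiteDimensional
    (Matrix.toEuclideanLin ((rowSample A t)ᵀ * rowSample A t))).measurable.comp
    (measurable_powerIter (rowSample A t) n)).norm

/-- The reduction of an index to `Fin m`. -/
def clampFin (hm : 0 < m) (k : ℕ) : Fin m := if h : k < m then ⟨k, h⟩ else ⟨0, hm⟩

lemma clampFin_val (hm : 0 < m) {k : ℕ} (hk : k < m) : (clampFin hm k : ℕ) = k := by
  simp [clampFin, hk]

lemma pos_of_ne_zero {A : Matrix (Fin m) (Fin d) ℝ} (hA : A ≠ 0) : 0 < m := by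
  rcases Nat.eq_zero_or_pos m with rfl | h
  · exact absurd (Matrix.ext fun i j => i.elim0) hA
  · exact h

lemma map_drawIndex {A : Matrix (Fin m) (Fin d) ℝ} (hA : A ≠ 0) (r n : ℕ) :
    ((volume : Measure unitInterval).prod (volume : Measure unitInterval)).map
      (fun p => drawIndex (tableState A r n) p.1 p.2) =
      ∑ i : Fin m, ENNReal.ofReal (rowProb A i) • Measure.dirac (i : ℕ) := by
  obtain ⟨hN, -, -, -, -, hal⟩ := tableState_spec hA r n
  have hm := pos_of_ne_zero hA
  have hm' : (m : ℝ) ≠ 0 := Nat.cast_ne_zero.2 hm.ne'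
  have h := hal.map_aliasPick hm fun q hq => by
    rw [aliasWeight, dif_pos hq]
    exact mul_nonneg (Nat.cast_nonneg m) (rowProb_nonneg A _)
  have hN0 : (tableState A r n).N 0 0 = m := by rw [hN]; rfl
  simp only [drawIndex, hN0]
  rw [h, Finset.sum_range]
  refine Finset.sum_congr rfl fun i _ => ?_
  rw [aliasWeight, dif_pos i.2, mul_div_cancel_left₀ _ hm']

lemma measurable_drawIndex (s : State) :
    Measurable fun p : unitInterval × unitInterval => drawIndex s p.1 p.2 :=
  measurable_aliasPick_prod _ _ _ _

/-- The randomness of the estimator as a function of the random streams. -/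
def sampleMap {A : Matrix (Fin m) (Fin d) ℝ} (hA : A ≠ 0) (r n : ℕ) (ω : Tape) :
    (Fin r → Fin m) × (Fin d → ℝ) :=
  (fun j => clampFin (pos_of_ne_zero hA)
    (drawIndex (tableState A r n) (ω.2 (2 * j)) (ω.2 (2 * j + 1))), fun l => ω.1 l)

lemma map_clampFin_drawIndex {A : Matrix (Fin m) (Fin d) ℝ} (hA : A ≠ 0) (r n : ℕ) :
    ((volume : Measure unitInterval).prod (volume : Measure unitInterval)).map
      (fun p => clampFin (pos_of_ne_zero hA) (drawIndex (tableState A r n) p.1 p.2)) =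
      rowMeasure A := by
  have h := congrArg (Measure.map (clampFin (pos_of_ne_zero hA))) (map_drawIndex hA r n)
  rw [Measure.map_map (measurable_of_countable _) (measurable_drawIndex _)] at h
  refine h.trans ?_
  rw [← Measure.mapₗ_apply_of_measurable (measurable_of_countable _), map_sum, rowMeasure]
  refine Finset.sum_congr rfl fun i _ => ?_
  rw [map_smul, Measure.mapₗ_apply_of_measurable (measurable_of_countable _),
    Measure.map_dirac' (measurable_of_countable _)]
  congr 2
  exact Fin.ext (clampFin_val _ i.2)

lemma ae_drawIndex_lt {A : Matrix (Fin m) (Fin d) ℝ} (hA : A ≠ 0) (r n : ℕ) :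
    ∀ᵐ p ∂((volume : Measure unitInterval).prod (volume : Measure unitInterval)),
      drawIndex (tableState A r n) p.1 p.2 < m := by
  have h : ∀ᵐ k ∂(((volume : Measure unitInterval).prod (volume : Measure unitInterval)).map
      (fun p => drawIndex (tableState A r n) p.1 p.2)), k < m := by
    rw [map_drawIndex hA, ae_iff, Measure.finsetSum_apply]
    refine Finset.sum_eq_zero fun i _ => ?_
    simp
  exact ae_of_ae_map (measurable_drawIndex _).aemeasurable h

lemma map_pair_infinitePi {X : Type*} [MeasurableSpace X] (μ : Measure X)
    [IsProbabilityMeasure μ] :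
    (Measure.infinitePi fun _ : ℕ => μ).map (fun u (j : Fin r) => (u (2 * j), u (2 * j + 1))) =
      Measure.pi fun _ : Fin r => μ.prod μ := by
  -- Pairs of uniforms are read off through `(j, b) ↦ 2j + b` with `b < 2`; currying then exhibits
  -- them as independent pairs.
  have he : Function.Injective fun p : Fin r × Fin 2 => 2 * (p.1 : ℕ) + p.2 := by
    rintro ⟨i, a⟩ ⟨j, b⟩ h
    simp only at h
    ext <;> simp only <;> omega
  have h1 := infinitePi_map_comp_injective μ he
  have h2 := Measure.infinitePi_map_curry (fun (_ : Fin r) (_ : Fin 2) => μ)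
  have h3 := Measure.infinitePi_map_pi (fun _ : Fin r => Measure.infinitePi fun _ : Fin 2 => μ)
    (f := fun _ y => (y 0, y 1)) (fun _ => by fun_prop)
  have h4 : (Measure.infinitePi fun _ : Fin 2 => μ).map (fun y => (y 0, y 1)) = μ.prod μ := by
    rw [Measure.infinitePi_eq_pi]
    exact (measurePreserving_finTwoArrow μ).map_eq
  rw [← h2, ← h1, Measure.map_map (by fun_prop) (by fun_prop),
    Measure.map_map (by fun_prop) (by fun_prop)] at h3
  simp only [h4] at h3
  rw [Measure.infinitePi_eq_pi (ι := Fin r)] at h3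
  exact h3

lemma measurePreserving_sampleMap {A : Matrix (Fin m) (Fin d) ℝ} (hA : A ≠ 0) (r n : ℕ) :
    MeasurePreserving (sampleMap hA r n) tapeMeasure (sampleMeasure A r) := by
  have := isProbabilityMeasure_rowMeasure hA
  have hG : MeasurePreserving (fun (x : ℕ → ℝ) (l : Fin d) => x l)
      (Measure.infinitePi fun _ : ℕ => gaussianReal 0 1)
      (Measure.pi fun _ : Fin d => gaussianReal 0 1) :=
    ⟨by fun_prop, by
      rw [infinitePi_map_comp_injective _ Fin.val_injective, Measure.infinitePi_eq_pi]⟩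
  have hf : Measurable fun p : unitInterval × unitInterval =>
      clampFin (pos_of_ne_zero hA) (drawIndex (tableState A r n) p.1 p.2) :=
    (measurable_of_countable (clampFin (pos_of_ne_zero hA))).comp
      (measurable_drawIndex (tableState A r n))
  have hU : MeasurePreserving (fun (u : ℕ → unitInterval) (j : Fin r) =>
      clampFin (pos_of_ne_zero hA) (drawIndex (tableState A r n) (u (2 * j)) (u (2 * j + 1))))
      (Measure.infinitePi fun _ : ℕ => (volume : Measure unitInterval))
      (Measure.pi fun _ : Fin r => rowMeasure A) := by
    have h1 : MeasurePreserving (fun (u : ℕ → unitInterval) (j : Fin r) =>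
        (u (2 * j), u (2 * j + 1)))
        (Measure.infinitePi fun _ : ℕ => (volume : Measure unitInterval)) _ :=
      ⟨by fun_prop, map_pair_infinitePi _⟩
    have h2 := measurePreserving_pi (fun _ : Fin r => (volume : Measure unitInterval).prod
      (volume : Measure unitInterval)) (fun _ : Fin r => rowMeasure A)
      (f := fun _ p => clampFin (pos_of_ne_zero hA) (drawIndex (tableState A r n) p.1 p.2))
      (fun _ => ⟨hf, map_clampFin_drawIndex hA r n⟩)
    exact h2.comp h1
  exact Measure.measurePreserving_swap.comp (hG.prod hU)

/-- Off the null event that some index is out of range, the output is `estimate` composed with the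
measure-preserving `sampleMap`. -/
lemma identDistrib_output {A : Matrix (Fin m) (Fin d) ℝ} (hA : A ≠ 0) (r n : ℕ) :
    IdentDistrib (estimateProg.output A r n) (estimate A r n) tapeMeasure (sampleMeasure A r) := by
  have hS := measurePreserving_sampleMap hA r n
  have hE := measurable_estimate A r n
  have hlt : ∀ᵐ ω ∂tapeMeasure, ∀ j : Fin r,
      drawIndex (tableState A r n) (ω.2 (2 * j)) (ω.2 (2 * j + 1)) < m := by
    rw [ae_all_iff]
    intro j
    have h1 : MeasurePreserving (fun (u : ℕ → unitInterval) (j : Fin r) =>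
        (u (2 * j), u (2 * j + 1)))
        (Measure.infinitePi fun _ : ℕ => (volume : Measure unitInterval)) _ :=
      ⟨by fun_prop, map_pair_infinitePi _⟩
    have h2 : MeasurePreserving (fun ω : Tape => (ω.2 (2 * j), ω.2 (2 * j + 1))) tapeMeasure
        ((volume : Measure unitInterval).prod (volume : Measure unitInterval)) :=
      ((measurePreserving_eval _ j).comp h1).comp measurePreserving_snd
    exact h2.quasiMeasurePreserving.ae (ae_drawIndex_lt hA r n)
  have hae : estimateProg.output A r n =ᵐ[tapeMeasure] estimate A r n ∘ sampleMap hA r n := by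
    filter_upwards [hlt] with ω hω
    exact estimateProg_output hA _ fun j => (clampFin_val _ (hω j)).symm
  refine ⟨(hE.comp hS.measurable).aemeasurable.congr hae.symm, hE.aemeasurable, ?_⟩
  rw [Measure.map_congr hae, ← Measure.map_map hE hS.measurable, hS.map_eq]

end Law

/-! ### The running time -/

section Runtime

/-- `‖A‖² = ‖A v‖² ≤ ‖A‖_F²` for a top singular vector `v`. The running-time bound uses it to absorb
the rounding of `r`. -/
lemma one_le_stableRank {m d : ℕ} {A : Matrix (Fin m) (Fin d) ℝ} (hA : A ≠ 0) :
    1 ≤ stableRank A := by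
  have hd : 0 < d := by
    rcases Nat.eq_zero_or_pos d with rfl | h
    · exact absurd (Matrix.ext fun i j => j.elim0) hA
    · exact h
  obtain ⟨v, hv, hAv, -⟩ := exists_top_singular hd A
  have h := sum_sq_mulVec_le_frobSq A v
  rw [hAv, hv, mul_one] at h
  have := norm_pos_of_ne_zero hA
  rwa [stableRank, one_le_div (by positivity)]

lemma estimateProg_sizeLoops : estimateProg.SizeLoops := by
  simp [estimateProg, tableProg, rowSumProg, rowNormProg, frobProg, partBody, partProg, sweepBody,
    sweepProg, drawProg, storeProg, sampleProg, normalProg, normProg, scaleProg, gramProg,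
    powerProg, Prog.SizeLoops, sumProg, mapProg]

lemma zero_notMem_writesN_estimateProg : 0 ∉ estimateProg.writesN := by decide

/-- Lower-order terms are absorbed because `m`, `d` and `r` are at least one. The number of
iterations may be zero, hence the factor `v 3 + 1`, which also covers the final Gram product. -/
lemma estimateProg_bound_le (v : ℕ → ℕ) (h0 : 1 ≤ v 0) (h1 : 1 ≤ v 1) (h2 : 1 ≤ v 2) :
    estimateProg.bound v ≤ 500 * (v 0 * v 1 + v 2 * v 1 * (v 3 + 1)) := by
  simp only [estimateProg, tableProg, rowSumProg, rowNormProg, frobProg, partBody, partProg,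
    sweepBody, sweepProg, drawProg, storeProg, sampleProg, normalProg, normProg, scaleProg,
    gramProg, powerProg, sumProg, mapProg, Prog.bound, NExp.cost, RExp.cost, NExp.eval, NExp.var]
  have e0 : v 0 ≤ v 0 * v 1 := Nat.le_mul_of_pos_right _ h1
  have e1 : v 1 ≤ v 1 * v 2 := Nat.le_mul_of_pos_right _ h2
  have e2 : v 2 ≤ v 1 * v 2 := Nat.le_mul_of_pos_left _ h1
  have e3 := Nat.mul_le_mul_right (v 3) e1
  have e4 := Nat.mul_le_mul_right (v 3) e2
  have e5 : v 3 ≤ v 2 * v 3 := Nat.le_mul_of_pos_left _ h2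
  ring_nf
  ring_nf at e0 e1 e2 e3 e4 e5
  omega

variable {m d : ℕ}

lemma estimateProg_runtime_le {A : Matrix (Fin m) (Fin d) ℝ} (hA : A ≠ 0) {ε δ : ℝ} (hε : 0 < ε)
    (hε2 : ε ≤ 1 / 2) (hδ : 0 < δ) (hδd : 2 * δ ≤ d) {r n : ℕ}
    (hr : r = ⌈4 * stableRank A / ε ^ 2 * Real.log (2 * d / δ)⌉₊)
    (hn : n = ⌈6 * Real.log (d / δ)⌉₊) (ω : Tape) :
    (estimateProg.runtime A r n ω : ℝ) ≤
      72000 * (m * d + stableRank A * d / ε ^ 2 * Real.log (d / δ) ^ 2) := by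
  have hm := pos_of_ne_zero hA
  have hd' : (0 : ℝ) < d := by linarith
  have hd : 0 < d := by exact_mod_cast hd'
  have hρ := one_le_stableRank hA
  set ρ := stableRank A
  set L := Real.log (d / δ) with hL
  -- The condition `2δ ≤ d` serves only this: `L` is bounded below, so additive constants are
  -- absorbed into multiples of `L`.
  have hlog2 : Real.log 2 ≤ L := Real.log_le_log two_pos (by rw [le_div_iff₀ hδ]; exact hδd)
  have h2 := Real.log_two_gt_d9
  have hlog : Real.log (2 * d / δ) = Real.log 2 + L := by
    rw [mul_div_assoc, Real.log_mul two_ne_zero (by positivity)]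
  have hε3 : 4 ≤ ρ / ε ^ 2 := by
    rw [le_div_iff₀ (by positivity)]
    nlinarith
  have ha : 4 * ρ / ε ^ 2 * Real.log (2 * d / δ) = 4 * (ρ / ε ^ 2) * (Real.log 2 + L) := by
    rw [hlog, mul_div_assoc]
  have ha1 : 1 ≤ 4 * (ρ / ε ^ 2) * (Real.log 2 + L) := by nlinarith
  rw [ha] at hr
  set κ := ρ / ε ^ 2 with hκ
  -- `r ≤ 4κ(log 2 + L) + 1 ≤ 8κL + 1`, and the last term is at most `8κL`.
  have hr1 : (r : ℝ) ≤ 16 * κ * L := by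
    have := (Nat.ceil_lt_add_one (zero_le_one.trans ha1)).le
    rw [← hr] at this
    nlinarith
  have hr0 : 1 ≤ r := by
    rw [hr]
    exact Nat.ceil_pos.2 (zero_lt_one.trans_le ha1)
  -- `n + 1 ≤ 6L + 2`, and `2 ≤ 3 log 2 ≤ 3L`. The final constant is `72000 = 500 · 16 · 9`.
  have hn1 : (n : ℝ) + 1 ≤ 9 * L := by
    have := (Nat.ceil_lt_add_one (a := 6 * L) (by linarith)).le
    rw [← hn] at this
    linarith
  have ht : estimateProg.runtime A r n ω ≤ 500 * (m * d + r * d * (n + 1)) := by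
    have h1 := estimateProg.run_time_le (ω := ω) (s := inputState A r n) estimateProg_sizeLoops
      zero_notMem_writesN_estimateProg
    have h3 := estimateProg_bound_le ((inputState A r n).N 0) hm hd hr0
    have h4 : (inputState A r n).time = 0 := rfl
    rw [h4, zero_add] at h1
    exact h1.trans h3
  have ht' : (estimateProg.runtime A r n ω : ℝ) ≤ 500 * (m * d + r * d * (n + 1)) := by
    exact_mod_cast ht
  have hrn : (r : ℝ) * d * (n + 1) ≤ 16 * κ * L * d * (9 * L) := by
    have hL0 : 0 < L := by linarith
    have hκ0 : 0 < κ := by linarith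
    gcongr
  have hmd : (0 : ℝ) ≤ m * d := by positivity
  have e : ρ * d / ε ^ 2 * L ^ 2 = κ * L * d * L := by
    rw [hκ]
    ring
  rw [e]
  linarith

end Runtime

end RowSampling

end

open RowSampling in
theorem mainTheorem7 :
    ∃ c : ℝ, 0 < c ∧
    (∀ (m d : ℕ) (A : Matrix (Fin m) (Fin d) ℝ), A ≠ 0 →
      ∀ ε δ : ℝ, 0 < ε → ε ≤ 1 / 2 → 0 < δ → δ < 1 →
      ∀ r n : ℕ, 4 * stableRank A / ε ^ 2 * Real.log (2 * d / δ) ≤ r →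
        c * Real.log (d / δ) ≤ n →
        1 - 2 * δ ≤ (sampleMeasure A r).real
          {ω | 1 / (2 * Real.sqrt 5) * ‖A‖ ^ 2 ≤ estimate A r n ω ∧
            estimate A r n ω ≤ 3 / 2 * ‖A‖ ^ 2}) ∧
    ∃ (P : Prog) (C : ℝ), 0 < C ∧
      ∀ (m d : ℕ) (A : Matrix (Fin m) (Fin d) ℝ), A ≠ 0 →
        (∀ r n : ℕ, 1 ≤ r →
          IdentDistrib (P.output A r n) (estimate A r n) tapeMeasure (sampleMeasure A r)) ∧
        ∀ ε δ : ℝ, 0 < ε → ε ≤ 1 / 2 → 0 < δ → δ < 1 → 2 * δ ≤ d →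
          ∀ r n : ℕ, r = ⌈4 * stableRank A / ε ^ 2 * Real.log (2 * d / δ)⌉₊ →
            n = ⌈c * Real.log (d / δ)⌉₊ →
            ∀ ω : Tape, (P.runtime A r n ω : ℝ) ≤
              C * (m * d + stableRank A * d / ε ^ 2 * Real.log (d / δ) ^ 2) := by
  refine ⟨6, by norm_num, fun m d A hA ε δ hε hε2 hδ hδ1 r n hr hn =>
    estimate_accuracy hA hε hε2 hδ hδ1 hr hn, estimateProg, 72000, by norm_num,
    fun m d A hA => ⟨fun r n _ => identDistrib_output hA r n,
      fun ε δ hε hε2 hδ _ hδd r n hr hn ω => estimateProg_runtime_le hA hε hε2 hδ hδd hr hn ω⟩⟩
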